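/- Let $V$ be a finite-dimensional complex vector space with a symplectic form $\Omega$, and let $\Gamma\subset \operatorname{Sp}(V)$ be a finite subgroup. Let $S=\{s\in\Gamma : \operatorname{rk}(s-1_V)=2\}$ be the set of symplectic reflections, with decomposition $S=S_0\sqcup\dots\sqcup S_r$ into conjugacy classes of $\Gamma$ (there may be none), and for $s\in S$ let $\pi_s$ be the projection of $V$ onto $\operatorname{im}(s-1_V)$ along $\ker(s-1_V)$. Let $\mathfrak{p}_{univ}$ be the vector space with basis $t,c_0,\dots,c_r$, and let the universal symplectic reflection algebra $\mathbf H$ be the quotient of $(T(V)\#\Gamma)[t,c_0,\dots,c_r]$ by the relations $$u\otimes v-v\otimes u=t\,\Omega(u,v)+\sum_{i=0}^r c_i\sum_{s\in S_i}\Omega(\pi_su,\pi_sv)\,s,\qquad u,v\in V,$$ graded by $\deg\Gamma=0$, $\deg V=1$, $\deg\mathfrak{p}_{univ}=2$. For a complex vector space $\mathfrak{p}'$, placed in degree $2$, a graded flat deformation of $S(V)\#\Gamma$ over $S(\mathfrak{p}')$ means a $\mathbb Z$-graded $S(\mathfrak{p}')$-algebra $\mathbf H'$ which is a free graded $S(\mathfrak{p}')$-module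 (it has a basis of homogeneous elements), together with an isomorphism of graded algebras $\mathbf H'/(\mathfrak{p}')\cong S(V)\#\Gamma$. Theorem. 1. $\mathbf H$ is a graded flat deformation of $S(V)\#\Gamma$ over $S(\mathfrak{p}_{univ})$, where the identification $\mathbf H/(\mathfrak{p}_{univ})=S(V)\#\Gamma$ is the canonical one. In particular $\mathbf H$ is a free graded $S(\mathfrak{p}_{univ})$-module. 2. Assume that $\Gamma$ is symplectically irreducible, i.e. $V\ne 0$ and the only $\Gamma$-stable subspaces of $V$ on which $\Omega$ is nondegenerate are $0$ and $V$. Then $\mathbf H$ is universal: for every complex vector space $\mathfrak{p}'$ and every graded flat deformation $\mathbf H'$ of $S(V)\#\Gamma$ over $S(\mathfrak{p}')$ there are a unique linear map $\nu:\mathfrak{p}_{univ}\to\mathfrak{p}'$ and a unique isomorphism $S(\mathfrak{p}')\otimes_{S(\mathfrak{p}_{univ})}\mathbf H\xrightarrow{\sim}\mathbf H'$ of graded $S(\mathfrak{p}')$-algebras that induces the identity of $S(V)\#\Gamma$ modulo $\mathfrak{p}'$, where $S(\mathfrak{p}')$ is an $S(\mathfrak{p}_{univ})$-algebra through $\nu$.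 -/

import Mathlib

open scoped TensorProduct

noncomputable section

namespace SympRefl

/-! ### Finite groups of symplectomorphisms -/

section Group

variable {V : Type*} [AddCommGroup V] [Module ℂ V]

/-- The group `Sp(V)` of linear automorphisms of `V` preserving the form `Ω`. -/
def Sp (Ω : LinearMap.BilinForm ℂ V) : Subgroup (V ≃ₗ[ℂ] V) where
  carrier := {g | ∀ u v, Ω (g u) (g v) = Ω u v}
  mul_mem' {a b} ha hb u v := by
    simp only [Set.mem_ofPred_eq] at ha hb
    simp [LinearEquiv.mul_apply, ha, hb]
  one_mem' u v := rfl
  inv_mem' {a} ha u v := by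
    simp only [Set.mem_ofPred_eq] at ha
    rw [← ha (a⁻¹ u) (a⁻¹ v)]
    simp

/-- `V` is symplectically irreducible under `Γ`: it is nonzero, and its only `Γ`-stable subspaces
on which `Ω` is nondegenerate are `0` and `V`. -/
def SymplecticallyIrreducible (Ω : LinearMap.BilinForm ℂ V) (Γ : Subgroup (V ≃ₗ[ℂ] V)) : Prop :=
  Nontrivial V ∧ ∀ W : Submodule ℂ V, (∀ g ∈ Γ, ∀ w ∈ W, g w ∈ W) →
    (Ω.restrict W).Nondegenerate → W = ⊥ ∨ W = ⊤

variable {Γ : Subgroup (V ≃ₗ[ℂ] V)}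

/-- The linear endomorphism `γ - 1` of `V`. -/
def subOne (s : Γ) : V →ₗ[ℂ] V := ((s : V ≃ₗ[ℂ] V) : V →ₗ[ℂ] V) - LinearMap.id

/-- `γ ∈ Γ` is a symplectic reflection if `rk (γ - 1) = 2`. -/
def IsSymplecticReflection (s : Γ) : Prop :=
  Module.finrank ℂ (LinearMap.range (subOne s)) = 2

variable (Γ) in
/-- The set of conjugacy classes of `Γ` consisting of symplectic reflections. -/
def ReflectionClass : Type _ :=
  {C : ConjClasses Γ // ∃ s : Γ, IsSymplecticReflection s ∧ ConjClasses.mk s = C}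

/-- The conjugacy class of a symplectic reflection. -/
def reflectionClass (s : {s : Γ // IsSymplecticReflection s}) : ReflectionClass Γ :=
  ⟨ConjClasses.mk s.1, s.1, s.2, rfl⟩

/-- An element of a finite group is semisimple, so `V = im (s - 1) ⊕ ker (s - 1)`. -/
theorem isCompl_range_ker [Finite Γ] [FiniteDimensional ℂ V] (s : Γ) :
    IsCompl (LinearMap.range (subOne s)) (LinearMap.ker (subOne s)) := by
  have hd : Disjoint (LinearMap.range (subOne s)) (LinearMap.ker (subOne s)) := by
    rw [Submodule.disjoint_def]
    rintro w ⟨v, rfl⟩ hw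
    set w := subOne s v with hwdef
    have h1 : (s : V ≃ₗ[ℂ] V) v = v + w := by simp [hwdef, subOne]
    have h2 : (s : V ≃ₗ[ℂ] V) w = w := by
      have : (s : V ≃ₗ[ℂ] V) w - w = 0 := by simpa [subOne] using hw
      exact sub_eq_zero.mp this
    have h3 : ∀ n : ℕ, ((s : V ≃ₗ[ℂ] V) ^ n) v = v + (n : ℂ) • w := by
      intro n
      induction n with
      | zero => simp
      | succ n ih =>
        rw [pow_succ', LinearEquiv.mul_apply, ih, map_add, map_smul, h1, h2]
        push_cast
        rw [add_smul, one_smul]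
        abel
    have h4 := h3 (orderOf s)
    have h5 : ((s : V ≃ₗ[ℂ] V) ^ orderOf s) = 1 := by
      rw [← Subgroup.coe_pow, pow_orderOf_eq_one, Subgroup.coe_one]
    rw [h5] at h4
    have h6 : ((orderOf s : ℕ) : ℂ) • w = 0 := by simpa using h4
    rcases smul_eq_zero.mp h6 with h | h
    · exact absurd (Nat.cast_eq_zero.mp h) (orderOf_pos s).ne'
    · exact h
  refine ⟨hd, codisjoint_iff.mpr ?_⟩
  apply Submodule.eq_top_of_disjoint _ _ _ hd
  exact (LinearMap.finrank_range_add_finrank_ker (subOne s)).ge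

/-- The projection `π_s` of `V` onto `im (s - 1)` along `ker (s - 1)`. -/
def proj [Finite Γ] [FiniteDimensional ℂ V] (s : Γ) : V →ₗ[ℂ] V :=
  (LinearMap.range (subOne s)).projection (LinearMap.ker (subOne s)) (isCompl_range_ker s)

end Group

/-! ### Smash products -/

section Smash

variable {V : Type*} [AddCommGroup V] [Module ℂ V]

/-- The natural action of `Γ` on `T(V)` by algebra automorphisms. -/
instance tensorAction (Γ : Subgroup (V ≃ₗ[ℂ] V)) : MulSemiringAction Γ (TensorAlgebra ℂ V) where
  smul g x := TensorAlgebra.lift ℂ (TensorAlgebra.ι ℂ ∘ₗ ((g : V ≃ₗ[ℂ] V) : V →ₗ[ℂ] V)) x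
  one_smul x := by
    change TensorAlgebra.lift ℂ _ x = AlgHom.id ℂ _ x
    congr 1
    ext v
    simp
  mul_smul g h x := by
    change TensorAlgebra.lift ℂ _ x =
      ((TensorAlgebra.lift ℂ _).comp (TensorAlgebra.lift ℂ _)) x
    congr 1
    ext v
    simp
  smul_zero g := map_zero (TensorAlgebra.lift ℂ _)
  smul_add g x y := map_add (TensorAlgebra.lift ℂ _) x y
  smul_one g := map_one (TensorAlgebra.lift ℂ _)
  smul_mul g x y := map_mul (TensorAlgebra.lift ℂ _) x y

/-- The natural action of `Γ` on `S(V)` by algebra automorphisms. -/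
instance symAction (Γ : Subgroup (V ≃ₗ[ℂ] V)) : MulSemiringAction Γ (SymmetricAlgebra ℂ V) where
  smul g x := SymmetricAlgebra.lift (SymmetricAlgebra.ι ℂ V ∘ₗ ((g : V ≃ₗ[ℂ] V) : V →ₗ[ℂ] V)) x
  one_smul x := by
    change SymmetricAlgebra.lift _ x = AlgHom.id ℂ _ x
    congr 1
    ext v
    simp
  mul_smul g h x := by
    change SymmetricAlgebra.lift _ x =
      ((SymmetricAlgebra.lift _).comp (SymmetricAlgebra.lift _)) x
    congr 1
    ext v
    simp
  smul_zero g := map_zero (SymmetricAlgebra.lift _)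
  smul_add g x y := map_add (SymmetricAlgebra.lift _) x y
  smul_one g := map_one (SymmetricAlgebra.lift _)
  smul_mul g x y := map_mul (SymmetricAlgebra.lift _) x y

variable (Γ : Subgroup (V ≃ₗ[ℂ] V))

theorem tensor_smul_def (g : Γ) (x : TensorAlgebra ℂ V) :
    g • x = TensorAlgebra.lift ℂ (TensorAlgebra.ι ℂ ∘ₗ ((g : V ≃ₗ[ℂ] V) : V →ₗ[ℂ] V)) x := rfl

theorem sym_smul_def (g : Γ) (x : SymmetricAlgebra ℂ V) :
    g • x = SymmetricAlgebra.lift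
      (SymmetricAlgebra.ι ℂ V ∘ₗ ((g : V ≃ₗ[ℂ] V) : V →ₗ[ℂ] V)) x := rfl

instance tensorAction_smulCommClass : SMulCommClass Γ ℂ (TensorAlgebra ℂ V) :=
  ⟨fun g c x => by simp [tensor_smul_def]⟩

instance symAction_smulCommClass : SMulCommClass Γ ℂ (SymmetricAlgebra ℂ V) :=
  ⟨fun g c x => by simp [sym_smul_def]⟩

/-- `T(V) # Γ`: finite sums of `a ⊗ g`, with product `(a ⊗ g)(b ⊗ h) = a g(b) ⊗ g h`. -/
abbrev TensorSmash : Type _ := SkewMonoidAlgebra (TensorAlgebra ℂ V) Γ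

/-- `S(V) # Γ`: finite sums of `a ⊗ g`, with product `(a ⊗ g)(b ⊗ h) = a g(b) ⊗ g h`. -/
abbrev SymSmash : Type _ := SkewMonoidAlgebra (SymmetricAlgebra ℂ V) Γ

/-- The homogeneous component `S^k(P)` of the symmetric algebra. -/
def symPow (P : Type*) [AddCommGroup P] [Module ℂ P] (k : ℕ) :
    Submodule ℂ (SymmetricAlgebra ℂ P) :=
  LinearMap.range (SymmetricAlgebra.ι ℂ P) ^ k

/-- The homogeneous component `T^k(V)` of the tensor algebra. -/
def tensorPow (V : Type*) [AddCommGroup V] [Module ℂ V] (k : ℕ) :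
    Submodule ℂ (TensorAlgebra ℂ V) :=
  LinearMap.range (TensorAlgebra.ι ℂ (M := V)) ^ k

/-- The grading of `S(V) # Γ` with `deg V = 1` and `deg Γ = 0`. -/
def smashGrading (n : ℤ) : Submodule ℂ (SymSmash Γ) :=
  Submodule.span ℂ {x | ∃ (k : ℕ) (a : SymmetricAlgebra ℂ V) (g : Γ),
    a ∈ symPow V k ∧ (k : ℤ) = n ∧ x = SkewMonoidAlgebra.single g a}

/-- The inclusion `S(V) → S(V) # Γ`. -/
def symIncl : SymmetricAlgebra ℂ V →ₐ[ℂ] SymSmash Γ where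
  toFun a := SkewMonoidAlgebra.single 1 a
  map_one' := rfl
  map_zero' := SkewMonoidAlgebra.single_zero_right _
  map_mul' a b := by simp [SkewMonoidAlgebra.single_mul_single]
  map_add' a b := SkewMonoidAlgebra.single_add _ _ _
  commutes' r := rfl

/-- The canonical surjection `T(V) # Γ → S(V) # Γ`. -/
def tensorToSym : TensorSmash Γ →ₐ[ℂ] SymSmash Γ :=
  SkewMonoidAlgebra.liftNCAlgHom ((symIncl Γ).comp (SymmetricAlgebra.algHom ℂ V))
    (SkewMonoidAlgebra.of (SymmetricAlgebra ℂ V) Γ) (by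
      intro x g
      have key : SymmetricAlgebra.algHom ℂ V (g • x) = g • SymmetricAlgebra.algHom ℂ V x := by
        have : (SymmetricAlgebra.algHom ℂ V).comp (TensorAlgebra.lift ℂ
            (TensorAlgebra.ι ℂ ∘ₗ ((g : V ≃ₗ[ℂ] V) : V →ₗ[ℂ] V))) =
            (SymmetricAlgebra.lift (SymmetricAlgebra.ι ℂ V ∘ₗ
              ((g : V ≃ₗ[ℂ] V) : V →ₗ[ℂ] V))).comp (SymmetricAlgebra.algHom ℂ V) := by
          ext v
          have h : SymmetricAlgebra.algHom ℂ V (TensorAlgebra.ι ℂ v) =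
            SymmetricAlgebra.ι ℂ V v := rfl
          simp only [AlgHom.comp_toLinearMap, LinearMap.comp_apply, AlgHom.toLinearMap_apply,
            TensorAlgebra.lift_ι_apply, LinearEquiv.coe_coe, h, SymmetricAlgebra.lift_ι_apply]
          rfl
        exact congrArg (fun f => f x) this
      change SkewMonoidAlgebra.single 1 (SymmetricAlgebra.algHom ℂ V (g • x)) *
        SkewMonoidAlgebra.single g 1 =
        SkewMonoidAlgebra.single g 1 *
        SkewMonoidAlgebra.single 1 (SymmetricAlgebra.algHom ℂ V x)
      rw [SkewMonoidAlgebra.single_mul_single, SkewMonoidAlgebra.single_mul_single, key]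
      simp)

end Smash

/-! ### The universal symplectic reflection algebra -/

section Algebra

variable {V : Type*} [AddCommGroup V] [Module ℂ V]

/-- The parameter space, with basis `t = single none 1` and `c_i = single (some i) 1`, where `i`
runs over the conjugacy classes of symplectic reflections. -/
abbrev Param (Γ : Subgroup (V ≃ₗ[ℂ] V)) : Type _ := Option (ReflectionClass Γ) →₀ ℂ

/-- The parameter `t`, as an element of `S(Param)`. -/
def tVar (Γ : Subgroup (V ≃ₗ[ℂ] V)) : SymmetricAlgebra ℂ (Param Γ) :=
  SymmetricAlgebra.ι ℂ (Param Γ) (Finsupp.single none 1)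

/-- The parameter `c_i`, as an element of `S(Param)`. -/
def cVar {Γ : Subgroup (V ≃ₗ[ℂ] V)} (i : ReflectionClass Γ) : SymmetricAlgebra ℂ (Param Γ) :=
  SymmetricAlgebra.ι ℂ (Param Γ) (Finsupp.single (some i) 1)

/-- A vector of `V` as an element of `T(V) # Γ`. -/
def vec (Γ : Subgroup (V ≃ₗ[ℂ] V)) (v : V) : TensorSmash Γ :=
  SkewMonoidAlgebra.single 1 (TensorAlgebra.ι ℂ v)

/-- An element of `Γ` as an element of `T(V) # Γ`. -/
def grp {Γ : Subgroup (V ≃ₗ[ℂ] V)} (g : Γ) : TensorSmash Γ := SkewMonoidAlgebra.single g 1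

theorem tensorToSym_vec (Γ : Subgroup (V ≃ₗ[ℂ] V)) (v : V) :
    tensorToSym Γ (vec Γ v) = SkewMonoidAlgebra.single 1 (SymmetricAlgebra.ι ℂ V v) := by
  change SkewMonoidAlgebra.liftNC _ _ (SkewMonoidAlgebra.single 1 (TensorAlgebra.ι ℂ v)) = _
  rw [SkewMonoidAlgebra.liftNC_single, map_one, mul_one]
  rfl

/-- The map `S(Param) → S(V) # Γ` which kills the parameters. -/
def paramToSmash (Γ : Subgroup (V ≃ₗ[ℂ] V)) : SymmetricAlgebra ℂ (Param Γ) →ₐ[ℂ] SymSmash Γ :=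
  (Algebra.ofId ℂ (SymSmash Γ)).comp SymmetricAlgebra.algebraMapInv

theorem paramToSmash_ι (Γ : Subgroup (V ≃ₗ[ℂ] V)) (p : Param Γ) :
    paramToSmash Γ (SymmetricAlgebra.ι ℂ (Param Γ) p) = 0 := by
  rw [paramToSmash, AlgHom.comp_apply, SymmetricAlgebra.algebraMapInv_ι, map_zero]

theorem paramToSmash_commute (Γ : Subgroup (V ≃ₗ[ℂ] V)) (p : SymmetricAlgebra ℂ (Param Γ))
    (x : SymSmash Γ) :
    Commute (paramToSmash Γ p) x :=
  Algebra.commute_algebraMap_left (SymmetricAlgebra.algebraMapInv p : ℂ) x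

/-- The map `(T(V) # Γ)[t, c_i] → S(V) # Γ` which kills the parameters. -/
def preToSmash (Γ : Subgroup (V ≃ₗ[ℂ] V)) :
    SymmetricAlgebra ℂ (Param Γ) ⊗[ℂ] TensorSmash Γ →ₐ[ℂ] SymSmash Γ :=
  Algebra.TensorProduct.lift (paramToSmash Γ) (tensorToSym Γ)
    (fun p x => paramToSmash_commute Γ p (tensorToSym Γ x))

theorem preToSmash_tmul (Γ : Subgroup (V ≃ₗ[ℂ] V)) (p : SymmetricAlgebra ℂ (Param Γ))
    (x : TensorSmash Γ) :
    preToSmash Γ (p ⊗ₜ[ℂ] x) = paramToSmash Γ p * tensorToSym Γ x :=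
  Algebra.TensorProduct.lift_tmul _ _ _ _ _

variable [FiniteDimensional ℂ V]

/-- The relations
`u ⊗ v - v ⊗ u = t Ω(u, v) + ∑_i c_i ∑_{s ∈ S_i} Ω(π_s u, π_s v) s` for `u, v ∈ V`
in `(T(V) # Γ)[t, c_i]`, the latter being `S(Param) ⊗ (T(V) # Γ)`. The double sum is written as one
sum over all symplectic reflections `s`. -/
inductive Rel (Ω : LinearMap.BilinForm ℂ V) (Γ : Subgroup (V ≃ₗ[ℂ] V)) [Finite Γ] :
    SymmetricAlgebra ℂ (Param Γ) ⊗[ℂ] TensorSmash Γ →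
    SymmetricAlgebra ℂ (Param Γ) ⊗[ℂ] TensorSmash Γ → Prop
  | comm (u v : V) : Rel Ω Γ
      (1 ⊗ₜ[ℂ] (vec Γ u * vec Γ v - vec Γ v * vec Γ u))
      (tVar Γ ⊗ₜ[ℂ] (Ω u v • (1 : TensorSmash Γ)) +
        ∑ᶠ s : {s : Γ // IsSymplecticReflection s},
          cVar (reflectionClass s) ⊗ₜ[ℂ] (Ω (proj s.1 u) (proj s.1 v) • grp s.1))

/-- The universal symplectic reflection algebra `H` of `(V, Γ)`. -/
def SRA (Ω : LinearMap.BilinForm ℂ V) (Γ : Subgroup (V ≃ₗ[ℂ] V)) [Finite Γ] : Type _ :=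
  RingQuot (Rel Ω Γ)

variable (Ω : LinearMap.BilinForm ℂ V) (Γ : Subgroup (V ≃ₗ[ℂ] V)) [Finite Γ]

instance : Ring (SRA Ω Γ) := inferInstanceAs (Ring (RingQuot (Rel Ω Γ)))

instance : Algebra ℂ (SRA Ω Γ) := inferInstanceAs (Algebra ℂ (RingQuot (Rel Ω Γ)))

instance : Algebra (SymmetricAlgebra ℂ (Param Γ)) (SRA Ω Γ) :=
  inferInstanceAs (Algebra (SymmetricAlgebra ℂ (Param Γ)) (RingQuot (Rel Ω Γ)))

instance : IsScalarTower ℂ (SymmetricAlgebra ℂ (Param Γ)) (SRA Ω Γ) :=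
  inferInstanceAs (IsScalarTower ℂ (SymmetricAlgebra ℂ (Param Γ)) (RingQuot (Rel Ω Γ)))

/-- The quotient map `(T(V) # Γ)[t, c_i] → H`. -/
def mkSRA : SymmetricAlgebra ℂ (Param Γ) ⊗[ℂ] TensorSmash Γ →ₐ[ℂ] SRA Ω Γ :=
  RingQuot.mkAlgHom ℂ (Rel Ω Γ)

/-- The grading of `H` with `deg Γ = 0`, `deg V = 1`, `deg Param = 2`. -/
def sraGrading (n : ℤ) : Submodule ℂ (SRA Ω Γ) :=
  Submodule.span ℂ {x | ∃ (j k : ℕ) (p : SymmetricAlgebra ℂ (Param Γ)) (a : TensorAlgebra ℂ V)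
    (g : Γ), p ∈ symPow (Param Γ) j ∧ a ∈ tensorPow V k ∧ (2 * j + k : ℤ) = n ∧
      x = mkSRA Ω Γ (p ⊗ₜ[ℂ] SkewMonoidAlgebra.single g a)}

theorem preToSmash_rel {x y : SymmetricAlgebra ℂ (Param Γ) ⊗[ℂ] TensorSmash Γ}
    (h : Rel Ω Γ x y) : preToSmash Γ x = preToSmash Γ y := by
  obtain ⟨u, v⟩ := h
  have hfin : Finite {s : Γ // IsSymplecticReflection s} := inferInstance
  have h1 : preToSmash Γ (1 ⊗ₜ[ℂ] (vec Γ u * vec Γ v - vec Γ v * vec Γ u)) = 0 := by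
    rw [preToSmash_tmul, map_sub, map_mul, map_mul, tensorToSym_vec, tensorToSym_vec,
      SkewMonoidAlgebra.single_mul_single, SkewMonoidAlgebra.single_mul_single, one_smul, one_smul,
      mul_comm (SymmetricAlgebra.ι ℂ V u), sub_self, mul_zero]
  rw [h1, map_add, map_finsum _ (Set.toFinite _), preToSmash_tmul, tVar, paramToSmash_ι, zero_mul,
    zero_add]
  symm
  apply finsum_eq_zero_of_forall_eq_zero
  intro s
  rw [preToSmash_tmul, cVar, paramToSmash_ι, zero_mul]

/-- The canonical map `H → S(V) # Γ` which kills the parameters and is the identity on `V`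
and `Γ`. -/
def sraToSmash : SRA Ω Γ →ₐ[ℂ] SymSmash Γ :=
  RingQuot.liftAlgHom ℂ ⟨preToSmash Γ, fun _ _ h => preToSmash_rel Ω Γ h⟩

end Algebra

/-! ### Graded deformations -/

section Deformation

variable {V : Type*} [AddCommGroup V] [Module ℂ V] (Γ : Subgroup (V ≃ₗ[ℂ] V))

/-- `A`, with the grading `𝒜` and the map `π : A → S(V) # Γ`, is a graded `S(P)`-algebra
(with `deg P = 2`) which is a free graded `S(P)`-module and for which `π` induces
an isomorphism of graded algebras `A / (P) ≅ S(V) # Γ`. -/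
structure IsGradedFlatDeformation {P A : Type*} [AddCommGroup P] [Module ℂ P] [Ring A]
    [Algebra ℂ A] [Algebra (SymmetricAlgebra ℂ P) A] [IsScalarTower ℂ (SymmetricAlgebra ℂ P) A]
    (𝒜 : ℤ → Submodule ℂ A) (π : A →ₐ[ℂ] SymSmash Γ) : Prop where
  gradedMonoid : SetLike.GradedMonoid 𝒜
  isInternal : DirectSum.IsInternal 𝒜
  param_mem : ∀ p : P,
    algebraMap (SymmetricAlgebra ℂ P) A (SymmetricAlgebra.ι ℂ P p) ∈ 𝒜 2
  /-- There is a basis over `S(P)` consisting of homogeneous elements. -/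
  free : ∃ B : Set A, (∀ b ∈ B, ∃ n, b ∈ 𝒜 n) ∧
    LinearIndependent (SymmetricAlgebra ℂ P) (Subtype.val : B → A) ∧
    Submodule.span (SymmetricAlgebra ℂ P) B = ⊤
  surjective : Function.Surjective π
  map_mem : ∀ n, ∀ a ∈ 𝒜 n, π a ∈ smashGrading Γ n
  /-- The kernel of `π` is the ideal generated by (the central elements) `P`. -/
  ker_eq : RingHom.ker π = Ideal.span (Set.range fun p : P =>
    algebraMap (SymmetricAlgebra ℂ P) A (SymmetricAlgebra.ι ℂ P p))

end Deformation

/-! ### Base change -/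

section BaseChange

variable {P P' : Type*} [AddCommGroup P] [Module ℂ P] [AddCommGroup P'] [Module ℂ P']

/-- The homomorphism `S(P) → S(P')` induced by a linear map `ν : P → P'`. -/
def symMap (ν : P →ₗ[ℂ] P') : SymmetricAlgebra ℂ P →ₐ[ℂ] SymmetricAlgebra ℂ P' :=
  SymmetricAlgebra.lift (SymmetricAlgebra.ι ℂ P' ∘ₗ ν)

/-- The ring `S(P')`, regarded as an `S(P)`-algebra through the homomorphism `S(P) → S(P')` induced
by `ν : P → P'`. -/
def SymVia (_ν : P →ₗ[ℂ] P') : Type _ := SymmetricAlgebra ℂ P'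

variable (ν : P →ₗ[ℂ] P')

instance : CommRing (SymVia ν) := inferInstanceAs (CommRing (SymmetricAlgebra ℂ P'))

instance : Algebra ℂ (SymVia ν) := inferInstanceAs (Algebra ℂ (SymmetricAlgebra ℂ P'))

instance : Algebra (SymmetricAlgebra ℂ P') (SymVia ν) :=
  inferInstanceAs (Algebra (SymmetricAlgebra ℂ P') (SymmetricAlgebra ℂ P'))

instance : Algebra (SymmetricAlgebra ℂ P) (SymVia ν) := (symMap ν).toRingHom.toAlgebra

instance : SMulCommClass (SymmetricAlgebra ℂ P) (SymmetricAlgebra ℂ P') (SymVia ν) :=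
  ⟨fun a b c => by simp only [Algebra.smul_def]; ring⟩

instance : SMulCommClass (SymmetricAlgebra ℂ P) ℂ (SymVia ν) :=
  ⟨fun a b c => by simp only [Algebra.smul_def]; ring⟩

/-- The base change `S(P') ⊗_{S(P)} A` along the homomorphism induced by `ν : P → P'`. -/
abbrev BaseChange (A : Type*) [Ring A] [Algebra (SymmetricAlgebra ℂ P) A] : Type _ :=
  SymVia ν ⊗[SymmetricAlgebra ℂ P] A

variable {A : Type*} [Ring A] [Algebra (SymmetricAlgebra ℂ P) A]

/-- The element `s ⊗ a` of the base change. -/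
def BaseChange.tmul (s : SymmetricAlgebra ℂ P') (a : A) : BaseChange ν A :=
  (show SymVia ν from s) ⊗ₜ[SymmetricAlgebra ℂ P] a

/-- The grading of the base change induced by a grading of `A`, with `deg P' = 2`. -/
def BaseChange.grading [Algebra ℂ A] (𝒜 : ℤ → Submodule ℂ A) (n : ℤ) :
    Submodule ℂ (BaseChange ν A) :=
  Submodule.span ℂ {x | ∃ (j : ℕ) (m : ℤ) (s : SymmetricAlgebra ℂ P') (a : A),
    s ∈ symPow P' j ∧ a ∈ 𝒜 m ∧ 2 * j + m = n ∧ x = BaseChange.tmul ν s a}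

end BaseChange

end SympRefl

end

open scoped TensorProduct

set_option linter.unusedSectionVars false

noncomputable section

/-! Flatness is a Poincaré–Birkhoff–Witt theorem. Words in a basis of V followed by a group element
can be sorted at the cost of shorter words, so the ordered monomials x_α g span H over S(p_univ)
(`span_sraMono`). For independence, H is made to act on the free S(p_univ)-module on the symbols x_α
g. The product of a basis vector with a monomial is defined by the recursion which the relations
force (`ordAct`), and an induction on the degree shows that the resulting operators satisfy all the
relations (`ordMod_relations`). The one real obstruction appears on reordering three vectors: for
each s, the cyclic sum of form_s(u,v)(s w - w) has to vanish. For s = 1 this is trivial; for a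
symplectic reflection it is Cramer's rule in the plane im(s - 1) (`cramer_plane`). Acting on the
unit monomial then returns x_α g itself, whence independence. Independence of the graded pieces
comes from an endomorphism acting on degree n by 2^n.

For universality, let H' be a graded flat deformation over S(P'). It has no negative degrees, and
the kernel of π in degree n is spanned by the products of P' with degree n - 2. Hence π is bijective
in degrees 0 and 1, and Γ and V lift uniquely to H'. A commutator of lifted vectors lies in the
kernel in degree 2, so it equals ∑ κ_g(u,v) g with κ_g(u,v) in P'. By freeness (`exists_symbol`)
these coefficients are unique; so they are bilinear, alternating and Γ-invariant, and the Jacobi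
identity of H' descends to them. For s ≠ 1 that identity forces κ_s = 0 unless rk(s - 1) = 2, and
then κ_s is a multiple of Ω(π_s u, π_s v). The form κ_1 is invariant and alternating, and symplectic
irreducibility makes it a multiple of Ω (`exists_eq_smul_of_invariant`); as V need not be
irreducible as a representation, Schur's lemma does not suffice, and nilpotent self-adjoint
endomorphisms have to be excluded.

These multiples define ν and a homomorphism H → H'. After base change it is injective because the
ordered monomials stay independent modulo P', which lifts to independence over S(P'), and surjective
by the graded Nakayama lemma. Uniqueness holds because the lifts of V and Γ are unique and their
commutators determine ν. -/

namespace SympRefl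

/-! ### The free module on ordered monomials and the recursive definition of the action. -/

section OrderedMonomials

variable {V : Type*} [AddCommGroup V] [Module ℂ V]

/-- The data of commutation relations `u v - v u = ∑ s, form s u v • coef s • s`, subject to
equivariance under `Γ` and to the Jacobi identity. -/
structure CommutatorDatum (Γ : Subgroup (V ≃ₗ[ℂ] V)) (R : Type*) [CommRing R] where
  form : Γ → LinearMap.BilinForm ℂ V
  coef : Γ → R
  alt : ∀ s, (form s).IsAlt
  form_conj : ∀ (g s : Γ) (u v : V),
    form (g * s * g⁻¹) ((g : V ≃ₗ[ℂ] V) u) ((g : V ≃ₗ[ℂ] V) v) = form s u v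
  coef_conj : ∀ g s : Γ, coef (g * s * g⁻¹) = coef s
  jacobi : ∀ (s : Γ) (u v w : V),
    form s u v • ((s : V ≃ₗ[ℂ] V) w - w) + form s v w • ((s : V ≃ₗ[ℂ] V) u - u) +
      form s w u • ((s : V ≃ₗ[ℂ] V) v - v) = 0

variable {Γ : Subgroup (V ≃ₗ[ℂ] V)} {R : Type*} [CommRing R] [Algebra ℂ R]
  {ι : Type*} [LinearOrder ι]

/-- The free module on the ordered monomials `x_α g`, for `α` a multiset of indices and `g ∈ Γ`. -/
abbrev OrdMod (ι : Type*) (Γ : Subgroup (V ≃ₗ[ℂ] V)) (R : Type*) [CommRing R] : Type _ :=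
  (Multiset ι × Γ) →₀ R

/-- The ordered monomial `x_α g`. -/
def mono (R : Type*) [CommRing R] (α : Multiset ι) (g : Γ) : OrdMod ι Γ R := Finsupp.single (α, g) 1

/-- The span of the ordered monomials of degree less than `k`. -/
def filt (ι : Type*) (Γ : Subgroup (V ≃ₗ[ℂ] V)) (R : Type*) [CommRing R] (k : ℕ) :
    Submodule R (OrdMod ι Γ R) :=
  Submodule.span R {x | ∃ (α : Multiset ι) (g : Γ), α.card < k ∧ x = mono R α g}

theorem mono_mem_filt {k : ℕ} {α : Multiset ι} (h : α.card < k) (g : Γ) :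
    mono R α g ∈ filt ι Γ R k :=
  Submodule.subset_span ⟨α, g, h, rfl⟩

theorem filt_mono {k l : ℕ} (h : k ≤ l) : filt ι Γ R k ≤ filt ι Γ R l := by
  apply Submodule.span_mono
  rintro _ ⟨α, g, hα, rfl⟩
  exact ⟨α, g, hα.trans_le h, rfl⟩

theorem exists_mem_filt (m : OrdMod ι Γ R) : ∃ k, m ∈ filt ι Γ R k := by
  induction m using Finsupp.induction_linear with
  | zero => exact ⟨0, zero_mem _⟩
  | add f g hf hg =>
    obtain ⟨k, hk⟩ := hf
    obtain ⟨l, hl⟩ := hg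
    exact ⟨max k l, add_mem (filt_mono (le_max_left _ _) hk) (filt_mono (le_max_right _ _) hl)⟩
  | single p r =>
    refine ⟨p.1.card + 1, ?_⟩
    have : Finsupp.single p r = r • mono R p.1 p.2 := by simp [mono]
    rw [this]
    exact Submodule.smul_mem _ _ (mono_mem_filt (Nat.lt_succ_self _) _)

theorem smul_mem_filt {k : ℕ} (c : ℂ) {m : OrdMod ι Γ R} (h : m ∈ filt ι Γ R k) :
    c • m ∈ filt ι Γ R k := by
  rw [← algebraMap_smul R c m]
  exact Submodule.smul_mem _ _ h

/-- Two linear maps agree in degrees less than `k` if they agree on the monomials. -/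
theorem eq_of_mem_filt {M : Type*} [AddCommGroup M] [Module R M] {k : ℕ}
    {f f' : OrdMod ι Γ R →ₗ[R] M}
    (h : ∀ (α : Multiset ι) (g : Γ), α.card < k → f (mono R α g) = f' (mono R α g))
    {m : OrdMod ι Γ R} (hm : m ∈ filt ι Γ R k) : f m = f' m := by
  refine LinearMap.eqOn_span ?_ hm
  rintro _ ⟨α, g, hα, rfl⟩
  exact h α g hα

theorem map_mem_filt {k l : ℕ} {f : OrdMod ι Γ R →ₗ[R] OrdMod ι Γ R}
    (h : ∀ (α : Multiset ι) (g : Γ), α.card < k → f (mono R α g) ∈ filt ι Γ R l)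
    {m : OrdMod ι Γ R} (hm : m ∈ filt ι Γ R k) : f m ∈ filt ι Γ R l := by
  have : filt ι Γ R k ≤ (filt ι Γ R l).comap f := by
    refine Submodule.span_le.mpr ?_
    rintro _ ⟨α, g, hα, rfl⟩
    exact h α g hα
  exact this hm

/-- A nonempty multiset of indices has a least element. -/
theorem multiset_cases (α : Multiset ι) :
    α = 0 ∨ ∃ j β, α = j ::ₘ β ∧ ∀ a ∈ β, j ≤ a := by
  rcases h : α.sort with _ | ⟨j, l⟩
  · left
    rw [← Multiset.sort_eq α (· ≤ ·), h]
    rfl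
  · right
    have hs := Multiset.pairwise_sort α (· ≤ ·)
    rw [h, List.pairwise_cons] at hs
    refine ⟨j, l, ?_, fun a ha => hs.1 a (by simpa using ha)⟩
    rw [← Multiset.sort_eq α (· ≤ ·), h]
    rfl

variable (b : Module.Basis ι ℂ V)

/-- The operators of multiplication by vectors, if `f i p` is the product of `b i` with the
monomial `p`. -/
def vecOp (f : ι → Multiset ι × Γ → OrdMod ι Γ R) : V →ₗ[ℂ] Module.End R (OrdMod ι Γ R) :=
  b.constr ℂ fun i => Finsupp.linearCombination R (f i)

/-- The operators of multiplication by group elements, if `f i p` is the product of `b i` with the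
monomial `p`. -/
def grpOp (f : ι → Multiset ι × Γ → OrdMod ι Γ R) (s : Γ) : Module.End R (OrdMod ι Γ R) :=
  Finsupp.linearCombination R fun p =>
    p.1.sort.foldr (fun i m => vecOp b f ((s : V ≃ₗ[ℂ] V) (b i)) m) (mono R 0 (s * p.2))

theorem vecOp_basis (f : ι → Multiset ι × Γ → OrdMod ι Γ R) (i : ι) (α : Multiset ι) (g : Γ) :
    vecOp b f (b i) (mono R α g) = f i (α, g) := by
  simp [vecOp, mono]

theorem grpOp_zero (f : ι → Multiset ι × Γ → OrdMod ι Γ R) (s g : Γ) :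
    grpOp b f s (mono R 0 g) = mono R 0 (s * g) := by
  simp [grpOp, mono]

theorem grpOp_cons (f : ι → Multiset ι × Γ → OrdMod ι Γ R) (s : Γ) {j : ι} {β : Multiset ι} (g : Γ)
    (h : ∀ a ∈ β, j ≤ a) :
    grpOp b f s (mono R (j ::ₘ β) g) =
      vecOp b f ((s : V ≃ₗ[ℂ] V) (b j)) (grpOp b f s (mono R β g)) := by
  simp [grpOp, mono, Multiset.sort_cons j β (· ≤ ·) h]

/-- Locality of the operator: below degree k it depends only on the values of `f` there. This allows
the truncated table of products in the recursion to be exchanged for the full one. -/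
theorem vecOp_congr {f f' : ι → Multiset ι × Γ → OrdMod ι Γ R} {k : ℕ}
    (h : ∀ i p, p.1.card < k → f i p = f' i p) (v : V) {m : OrdMod ι Γ R}
    (hm : m ∈ filt ι Γ R k) : vecOp b f v m = vecOp b f' v m := by
  refine eq_of_mem_filt (fun α g hα => ?_) hm
  have : (LinearMap.applyₗ' ℂ (mono R α g)).comp
      (LinearMap.restrictScalarsₗ ℂ R _ _ ℂ ∘ₗ vecOp b f) =
      (LinearMap.applyₗ' ℂ (mono R α g)).comp
      (LinearMap.restrictScalarsₗ ℂ R _ _ ℂ ∘ₗ vecOp b f') := by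
    refine b.ext fun i => ?_
    simpa [vecOp_basis] using h i (α, g) hα
  exact congrArg (fun f => f v) this

/-- Multiplication by a basis vector raises the degree by at most one. -/
def RaisesDegree (f : ι → Multiset ι × Γ → OrdMod ι Γ R) : Prop :=
  ∀ i p, f i p ∈ filt ι Γ R (p.1.card + 2)

variable {b}

theorem RaisesDegree.vecOp_mem {f : ι → Multiset ι × Γ → OrdMod ι Γ R} (hf : RaisesDegree f)
    {k : ℕ} (v : V) {m : OrdMod ι Γ R} (hm : m ∈ filt ι Γ R k) :
    vecOp b f v m ∈ filt ι Γ R (k + 1) := by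
  refine map_mem_filt (fun α g hα => ?_) hm
  rw [vecOp, Module.Basis.constr_apply, Finsupp.sum, LinearMap.sum_apply]
  refine Submodule.sum_mem _ fun i _ => smul_mem_filt _ ?_
  have := hf i (α, g)
  simp only [mono, Finsupp.linearCombination_single, one_smul]
  exact filt_mono (by simp only; omega) this

theorem RaisesDegree.grpOp_mono_mem {f : ι → Multiset ι × Γ → OrdMod ι Γ R} (hf : RaisesDegree f)
    (s : Γ) (α : Multiset ι) (g : Γ) :
    grpOp b f s (mono R α g) ∈ filt ι Γ R (α.card + 1) := by
  induction hn : α.card generalizing α with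
  | zero =>
    obtain rfl := Multiset.card_eq_zero.mp hn
    rw [grpOp_zero]
    exact mono_mem_filt (by simp) _
  | succ n ih =>
    rcases multiset_cases α with rfl | ⟨j, β, rfl, h⟩
    · simp at hn
    · rw [grpOp_cons b f s g h]
      exact hf.vecOp_mem _ (ih β (by simpa using hn))

theorem RaisesDegree.grpOp_mem {f : ι → Multiset ι × Γ → OrdMod ι Γ R} (hf : RaisesDegree f)
    {k : ℕ} (s : Γ) {m : OrdMod ι Γ R} (hm : m ∈ filt ι Γ R k) :
    grpOp b f s m ∈ filt ι Γ R k :=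
  map_mem_filt (fun α g hα => filt_mono (Nat.succ_le_of_lt hα) (hf.grpOp_mono_mem s α g)) hm

/-- A monomial of degree exactly k is allowed here: its image is built by applying vectors
successively to elements of degree less than k, so only products below degree k are consulted. -/
theorem RaisesDegree.grpOp_congr {f f' : ι → Multiset ι × Γ → OrdMod ι Γ R} (hf : RaisesDegree f)
    {k : ℕ} (h : ∀ i p, p.1.card < k → f i p = f' i p) (s : Γ) (α : Multiset ι) (g : Γ)
    (hα : α.card ≤ k) : grpOp b f s (mono R α g) = grpOp b f' s (mono R α g) := by
  induction hn : α.card generalizing α with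
  | zero =>
    obtain rfl := Multiset.card_eq_zero.mp hn
    rw [grpOp_zero, grpOp_zero]
  | succ n ih =>
    rcases multiset_cases α with rfl | ⟨j, β, rfl, hj⟩
    · simp at hn
    · rw [Multiset.card_cons] at hα hn
      rw [grpOp_cons b f s g hj, grpOp_cons b f' s g hj, ← ih β (by omega) (by omega)]
      exact vecOp_congr b h _ (filt_mono (by omega) (hf.grpOp_mono_mem s β g))

variable [Fintype Γ] (D : CommutatorDatum Γ R)

variable (b) in
/-- The recursion for the product of a basis vector with an ordered monomial. -/
def ordStep (f : ι → Multiset ι × Γ → OrdMod ι Γ R) (i : ι) (p : Multiset ι × Γ) : OrdMod ι Γ R :=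
  match p.1.sort with
  | [] => mono R (i ::ₘ p.1) p.2
  | j :: l => if i ≤ j then mono R (i ::ₘ p.1) p.2 else
      -- This is x_i x_j x_l = x_j (x_i x_l) + [x_i, x_j] x_l. In x_j (x_i x_l) the leading part x_j
      -- x_{i,l} is already ordered and is entered directly as a monomial; it has the degree of `p`,
      -- so asking `f` for it would break the recursion. Only the lower-order remainder of x_i x_l
      -- is passed to `f`.
      mono R (i ::ₘ p.1) p.2 + vecOp b f (b j) (f i (l, p.2) - mono R (i ::ₘ l) p.2) +
      ∑ s, D.form s (b i) (b j) • D.coef s • grpOp b f s (mono R l p.2)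

theorem ordStep_of_le (f : ι → Multiset ι × Γ → OrdMod ι Γ R) (i : ι) (α : Multiset ι) (g : Γ)
    (h : ∀ a ∈ α, i ≤ a) : ordStep b D f i (α, g) = mono R (i ::ₘ α) g := by
  rcases multiset_cases α with rfl | ⟨j, β, rfl, hj⟩
  · simp [ordStep]
  · rw [ordStep]
    simp only [Multiset.sort_cons j β (· ≤ ·) hj]
    rw [if_pos (h j (by simp))]

theorem ordStep_of_lt (f : ι → Multiset ι × Γ → OrdMod ι Γ R) {i j : ι} (β : Multiset ι) (g : Γ)
    (hj : ∀ a ∈ β, j ≤ a) (hi : j < i) : ordStep b D f i (j ::ₘ β, g) =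
      mono R (i ::ₘ j ::ₘ β) g + vecOp b f (b j) (f i (β, g) - mono R (i ::ₘ β) g) +
      ∑ s, D.form s (b i) (b j) • D.coef s • grpOp b f s (mono R β g) := by
  rw [ordStep]
  simp only [Multiset.sort_cons j β (· ≤ ·) hj]
  rw [if_neg hi.not_ge, Multiset.sort_eq]

variable (b) in
/-- The product of a basis vector with an ordered monomial. -/
def ordAct (i : ι) (p : Multiset ι × Γ) : OrdMod ι Γ R :=
  -- The value 0 outside smaller degrees only serves to make the recursion well founded; `ordAct_eq`
  -- shows that it never influences the result.
  ordStep b D (fun i' q => if _ : q.1.card < p.1.card then ordAct i' q else 0) i p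
termination_by p.1.card

theorem filt_le_add_two {k : ℕ} : filt ι Γ R k ≤ filt ι Γ R (k + 2) := filt_mono (by omega)

/-- A commutator of two vectors contains no vectors, so each reordering lowers the degree by two.
Since `filt k` consists of degrees less than k, the error is two degrees below the leading monomial.
This is what keeps the recursive calls in smaller degrees. -/
theorem ordAct_sub_mem (i : ι) (p : Multiset ι × Γ) :
    ordAct b D i p - mono R (i ::ₘ p.1) p.2 ∈ filt ι Γ R p.1.card := by
  induction hk : p.1.card using Nat.strong_induction_on generalizing i p with
  | _ k ih =>
  subst hk
  obtain ⟨α, g⟩ := p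
  rw [ordAct]
  set f : ι → Multiset ι × Γ → OrdMod ι Γ R :=
    fun i' q => if _ : q.1.card < α.card then ordAct b D i' q else 0 with hfdef
  have hf : RaisesDegree f := by
    intro i' q
    simp only [hfdef]
    split_ifs with h
    · have h1 := filt_le_add_two (ih _ h i' q rfl)
      have h2 : mono R (i' ::ₘ q.1) q.2 ∈ filt ι Γ R (q.1.card + 2) :=
        mono_mem_filt (by simp) _
      simpa using add_mem h1 h2
    · exact zero_mem _
  rcases multiset_cases α with rfl | ⟨j, β, rfl, hj⟩
  · rw [ordStep_of_le D f i 0 g (by simp), sub_self]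
    exact zero_mem _
  · by_cases hij : i ≤ j
    · rw [ordStep_of_le D f i (j ::ₘ β) g, sub_self]
      · exact zero_mem _
      · intro a ha
        rcases Multiset.mem_cons.mp ha with rfl | ha
        · exact hij
        · exact hij.trans (hj a ha)
    · rw [ordStep_of_lt D f β g hj (not_le.mp hij)]
      simp only [add_assoc, add_sub_cancel_left]
      have hβ : (β.card) < (j ::ₘ β).card := by simp
      refine add_mem ?_ (Submodule.sum_mem _ fun s _ => smul_mem_filt _ (Submodule.smul_mem _ _ ?_))
      · have h3 : f i (β, g) = ordAct b D i (β, g) := by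
          simp only [hfdef]
          rw [dif_pos hβ]
        rw [h3]
        have := ih _ hβ i (β, g) rfl
        exact filt_mono (by simp) (hf.vecOp_mem (b j) this)
      · exact filt_mono (by simp) (hf.grpOp_mono_mem s β g)

theorem ordAct_raisesDegree : RaisesDegree (ordAct b D) := by
  intro i p
  have h1 := filt_le_add_two (ordAct_sub_mem (b := b) D i p)
  have h2 : mono R (i ::ₘ p.1) p.2 ∈ filt ι Γ R (p.1.card + 2) := mono_mem_filt (by simp) _
  simpa using add_mem h1 h2

/-- The guard in the recursion can be dropped: by `ordAct_sub_mem` every product that `ordStep`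
requests has smaller degree than the given monomial. -/
theorem ordAct_eq (i : ι) (p : Multiset ι × Γ) :
    ordAct b D i p = ordStep b D (ordAct b D) i p := by
  obtain ⟨α, g⟩ := p
  rw [ordAct]
  set f : ι → Multiset ι × Γ → OrdMod ι Γ R :=
    fun i' q => if _ : q.1.card < α.card then ordAct b D i' q else 0 with hfdef
  have hcongr : ∀ i' (q : Multiset ι × Γ), q.1.card < α.card → ordAct b D i' q = f i' q := by
    intro i' q h
    simp only [hfdef]
    rw [dif_pos h]
  rcases multiset_cases α with rfl | ⟨j, β, rfl, hj⟩
  · rw [ordStep_of_le D f i 0 g (by simp), ordStep_of_le D _ i 0 g (by simp)]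
  · by_cases hij : i ≤ j
    · have : ∀ a ∈ j ::ₘ β, i ≤ a := by
        intro a ha
        rcases Multiset.mem_cons.mp ha with rfl | ha
        · exact hij
        · exact hij.trans (hj a ha)
      rw [ordStep_of_le D f i _ g this, ordStep_of_le D _ i _ g this]
    · rw [ordStep_of_lt D f β g hj (not_le.mp hij), ordStep_of_lt D _ β g hj (not_le.mp hij)]
      have hβ : (β.card) < (j ::ₘ β).card := by simp
      have h1 : vecOp b f (b j) (f i (β, g) - mono R (i ::ₘ β) g) =
          vecOp b (ordAct b D) (b j) (ordAct b D i (β, g) - mono R (i ::ₘ β) g) := by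
        rw [vecOp_congr b hcongr (b j) (filt_mono hβ.le (ordAct_sub_mem (b := b) D i (β, g))),
          hcongr i (β, g) hβ]
      have h2 : ∀ s, grpOp b f s (mono R β g) = grpOp b (ordAct b D) s (mono R β g) := fun s =>
        ((ordAct_raisesDegree (b := b) D).grpOp_congr hcongr s β g hβ.le).symm
      rw [h1]
      simp only [h2]

variable (b) in
/-- Multiplication by a vector. -/
def vecEnd : V →ₗ[ℂ] Module.End R (OrdMod ι Γ R) := vecOp b (ordAct b D)

variable (b) in
/-- Multiplication by a group element. -/
def grpEnd (s : Γ) : Module.End R (OrdMod ι Γ R) := grpOp b (ordAct b D) s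

variable (b) in
/-- Multiplication by the commutator of two vectors. -/
def commEnd (u v : V) : Module.End R (OrdMod ι Γ R) :=
  ∑ s, D.form s u v • D.coef s • grpEnd b D s

theorem grpEnd_mem {k : ℕ} (s : Γ) {m : OrdMod ι Γ R} (hm : m ∈ filt ι Γ R k) :
    grpEnd b D s m ∈ filt ι Γ R k :=
  (ordAct_raisesDegree D).grpOp_mem s hm

theorem vecEnd_sub_mem (i : ι) (α : Multiset ι) (g : Γ) :
    vecEnd b D (b i) (mono R α g) - mono R (i ::ₘ α) g ∈ filt ι Γ R α.card := by
  rw [vecEnd, vecOp_basis]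
  exact ordAct_sub_mem D i (α, g)

theorem vecEnd_of_le {i : ι} {α : Multiset ι} (g : Γ) (h : ∀ a ∈ α, i ≤ a) :
    vecEnd b D (b i) (mono R α g) = mono R (i ::ₘ α) g := by
  rw [vecEnd, vecOp_basis, ordAct_eq, ordStep_of_le _ _ _ _ _ h]

theorem grpEnd_zero (s g : Γ) : grpEnd b D s (mono R 0 g) = mono R 0 (s * g) := grpOp_zero b _ s g

theorem grpEnd_cons (s : Γ) {j : ι} {β : Multiset ι} (g : Γ) (h : ∀ a ∈ β, j ≤ a) :
    grpEnd b D s (mono R (j ::ₘ β) g) =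
      vecEnd b D ((s : V ≃ₗ[ℂ] V) (b j)) (grpEnd b D s (mono R β g)) :=
  grpOp_cons b _ s g h

theorem commEnd_apply (u v : V) (m : OrdMod ι Γ R) :
    commEnd b D u v m = ∑ s, D.form s u v • D.coef s • grpEnd b D s m := by
  simp [commEnd]

theorem commEnd_self (u : V) : commEnd b D u u = 0 := by
  simp [commEnd, D.alt _ u]

theorem commEnd_swap (u v : V) (m : OrdMod ι Γ R) :
    commEnd b D u v m = - commEnd b D v u m := by
  rw [commEnd_apply, commEnd_apply, ← Finset.sum_neg_distrib]
  refine Finset.sum_congr rfl fun s _ => ?_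
  rw [← LinearMap.IsAlt.neg (D.alt s) v u, neg_smul]

/-- The defining commutation relation, when one of the indices precedes the monomial. -/
theorem vecEnd_comm_of_lt {i j : ι} {β : Multiset ι} (g : Γ) (hj : ∀ a ∈ β, j ≤ a) (hi : j < i) :
    vecEnd b D (b i) (vecEnd b D (b j) (mono R β g)) =
      vecEnd b D (b j) (vecEnd b D (b i) (mono R β g)) +
        commEnd b D (b i) (b j) (mono R β g) := by
  have h1 : vecEnd b D (b j) (mono R (i ::ₘ β) g) = mono R (j ::ₘ i ::ₘ β) g := by
    apply vecEnd_of_le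
    intro a ha
    rcases Multiset.mem_cons.mp ha with rfl | ha
    · exact hi.le
    · exact hj a ha
  rw [vecEnd_of_le D g hj, vecEnd, vecOp_basis, ordAct_eq, ordStep_of_lt D _ β g hj hi, map_sub,
    commEnd_apply]
  change _ + (_ - vecEnd b D (b j) (mono R (i ::ₘ β) g)) + _ = _
  rw [h1, Multiset.cons_swap, vecOp_basis]
  simp only [grpEnd]
  abel

theorem vecEnd_comm_of_le {i j : ι} {β : Multiset ι} (g : Γ) (hj : ∀ a ∈ β, j ≤ a) (hi : j ≤ i) :
    vecEnd b D (b i) (vecEnd b D (b j) (mono R β g)) =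
      vecEnd b D (b j) (vecEnd b D (b i) (mono R β g)) +
        commEnd b D (b i) (b j) (mono R β g) := by
  rcases hi.eq_or_lt with rfl | hi
  · simp [commEnd_self]
  · exact vecEnd_comm_of_lt D g hj hi

end OrderedMonomials

/-! ### The operators satisfy the relations: a simultaneous induction on the degree. -/

section OrderedMonomials

variable {V : Type*} [AddCommGroup V] [Module ℂ V] {Γ : Subgroup (V ≃ₗ[ℂ] V)} {R : Type*}
  [CommRing R] [Algebra ℂ R] {ι : Type*} [LinearOrder ι] {b : Module.Basis ι ℂ V} [Fintype Γ]
  (D : CommutatorDatum Γ R)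

theorem basis_induction {κ : Type*} (b : Module.Basis κ ℂ V) {p : V → Prop} (hb : ∀ i, p (b i)) (h0 : p 0)
    (hadd : ∀ u v, p u → p v → p (u + v)) (hsmul : ∀ (c : ℂ) u, p u → p (c • u)) (v : V) :
    p v := by
  have hv : v ∈ Submodule.span ℂ (Set.range b) := b.span_eq ▸ Submodule.mem_top
  induction hv using Submodule.span_induction with
  | mem x h => obtain ⟨i, rfl⟩ := h; exact hb i
  | zero => exact h0
  | add x y _ _ hx hy => exact hadd x y hx hy
  | smul c x _ hx => exact hsmul c x hx

theorem commEnd_add_left (u u' v : V) (m : OrdMod ι Γ R) :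
    commEnd b D (u + u') v m = commEnd b D u v m + commEnd b D u' v m := by
  simp only [commEnd_apply, map_add, LinearMap.add_apply, add_smul, Finset.sum_add_distrib]

theorem commEnd_smul_left (c : ℂ) (u v : V) (m : OrdMod ι Γ R) :
    commEnd b D (c • u) v m = c • commEnd b D u v m := by
  simp only [commEnd_apply, map_smul, LinearMap.smul_apply, smul_eq_mul, Finset.smul_sum, mul_smul]

theorem vecEnd_add (u v : V) (m : OrdMod ι Γ R) :
    vecEnd b D (u + v) m = vecEnd b D u m + vecEnd b D v m := by simp

theorem vecEnd_smul (c : ℂ) (v : V) (m : OrdMod ι Γ R) :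
    vecEnd b D (c • v) m = c • vecEnd b D v m := by simp

theorem end_map_smul (f : Module.End R (OrdMod ι Γ R)) (c : ℂ) (m : OrdMod ι Γ R) :
    f (c • m) = c • f m := by
  rw [← algebraMap_smul R c m, map_smul, algebraMap_smul]

theorem vecEnd_zero_left (m : OrdMod ι Γ R) : vecEnd b D 0 m = 0 := by simp

theorem commEnd_zero_left (v : V) (m : OrdMod ι Γ R) : commEnd b D 0 v m = 0 := by
  simp [commEnd_apply]

/-- Commutation relation at `m`. -/
def CommAt (b : Module.Basis ι ℂ V) (m : OrdMod ι Γ R) (u v : V) : Prop :=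
  vecEnd b D u (vecEnd b D v m) = vecEnd b D v (vecEnd b D u m) + commEnd b D u v m

theorem CommAt.symm {m : OrdMod ι Γ R} {u v : V} (h : CommAt D b m u v) : CommAt D b m v u := by
  rw [CommAt] at h ⊢
  rw [h, commEnd_swap D v u]
  abel

theorem commAt_of_basis {m : OrdMod ι Γ R} (h : ∀ i j, CommAt D b m (b i) (b j)) (u v : V) :
    CommAt D b m u v := by
  have key : ∀ v, (∀ i, CommAt D b m (b i) v) → ∀ u, CommAt D b m u v := by
    intro v hv
    refine basis_induction b hv ?_ ?_ ?_
    · simp [CommAt, commEnd_zero_left]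
    · intro u u' hu hu'
      simp only [CommAt] at hu hu' ⊢
      rw [vecEnd_add, vecEnd_add, map_add, commEnd_add_left, hu, hu']
      abel
    · intro c u hu
      simp only [CommAt] at hu ⊢
      rw [vecEnd_smul, vecEnd_smul, end_map_smul, commEnd_smul_left, hu, smul_add]
  exact key v (fun i => (key _ (fun j => h j i) v).symm) u

/-- Moving s past w replaces w by s w, so each s contributes its form times (s w - w) s. The
intertwining rule is assumed only at `m`, since inside the induction it is known only in small
degrees. -/
theorem commutator_apply {m : OrdMod ι Γ R}
    (hS : ∀ s w, grpEnd b D s (vecEnd b D w m) =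
      vecEnd b D ((s : V ≃ₗ[ℂ] V) w) (grpEnd b D s m)) (u v w : V) :
    commEnd b D u v (vecEnd b D w m) - vecEnd b D w (commEnd b D u v m) =
      ∑ s, D.coef s • vecEnd b D (D.form s u v • ((s : V ≃ₗ[ℂ] V) w - w)) (grpEnd b D s m) := by
  simp only [commEnd_apply, map_sum, end_map_smul, map_smul (vecEnd b D w : Module.End R _), hS,
    ← Finset.sum_sub_distrib]
  refine Finset.sum_congr rfl fun s _ => ?_
  rw [vecEnd_smul, ← smul_sub, ← smul_sub, map_sub, LinearMap.sub_apply, smul_comm]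

/-- The Jacobi identity for the operators. -/
theorem jacobi_apply {m : OrdMod ι Γ R}
    (hS : ∀ s w, grpEnd b D s (vecEnd b D w m) =
      vecEnd b D ((s : V ≃ₗ[ℂ] V) w) (grpEnd b D s m)) (u v w : V) :
    (commEnd b D u v (vecEnd b D w m) - vecEnd b D w (commEnd b D u v m)) +
      (commEnd b D v w (vecEnd b D u m) - vecEnd b D u (commEnd b D v w m)) +
      (commEnd b D w u (vecEnd b D v m) - vecEnd b D v (commEnd b D w u m)) = 0 := by
  rw [commutator_apply D hS, commutator_apply D hS, commutator_apply D hS,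
    ← Finset.sum_add_distrib, ← Finset.sum_add_distrib]
  refine Finset.sum_eq_zero fun s _ => ?_
  rw [← smul_add, ← smul_add, ← vecEnd_add, ← vecEnd_add, D.jacobi, vecEnd_zero_left, smul_zero]

theorem commAt_of_mem {k : ℕ}
    (h : ∀ (α : Multiset ι) (g : Γ), α.card < k → ∀ u v, CommAt D b (mono R α g) u v)
    {m : OrdMod ι Γ R} (hm : m ∈ filt ι Γ R k) (u v : V) : CommAt D b m u v :=
  eq_of_mem_filt (f := vecEnd b D u * vecEnd b D v)
    (f' := vecEnd b D v * vecEnd b D u + commEnd b D u v) (fun α g hα => h α g hα u v) hm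

theorem intertwine_of_mem {k : ℕ} {s : Γ} {v : V}
    (h : ∀ (α : Multiset ι) (g : Γ), α.card < k → grpEnd b D s (vecEnd b D v (mono R α g)) =
      vecEnd b D ((s : V ≃ₗ[ℂ] V) v) (grpEnd b D s (mono R α g)))
    {m : OrdMod ι Γ R} (hm : m ∈ filt ι Γ R k) : grpEnd b D s (vecEnd b D v m) =
      vecEnd b D ((s : V ≃ₗ[ℂ] V) v) (grpEnd b D s m) :=
  eq_of_mem_filt (f := grpEnd b D s * vecEnd b D v)
    (f' := vecEnd b D ((s : V ≃ₗ[ℂ] V) v) * grpEnd b D s) h hm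

theorem grpEnd_mul_of_mem {k : ℕ} {s s' : Γ}
    (h : ∀ (α : Multiset ι) (g : Γ), α.card < k → grpEnd b D s (grpEnd b D s' (mono R α g)) =
      grpEnd b D (s * s') (mono R α g))
    {m : OrdMod ι Γ R} (hm : m ∈ filt ι Γ R k) : grpEnd b D s (grpEnd b D s' m) =
      grpEnd b D (s * s') m :=
  eq_of_mem_filt (f := grpEnd b D s * grpEnd b D s') (f' := grpEnd b D (s * s')) h hm

/-- Equivariance of the commutator. -/
theorem grpEnd_commEnd (s : Γ) (u v : V) {m : OrdMod ι Γ R}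
    (hM : ∀ r r', grpEnd b D r (grpEnd b D r' m) = grpEnd b D (r * r') m) :
    grpEnd b D s (commEnd b D u v m) =
      commEnd b D ((s : V ≃ₗ[ℂ] V) u) ((s : V ≃ₗ[ℂ] V) v) (grpEnd b D s m) := by
  simp only [commEnd_apply, map_sum, end_map_smul, map_smul (grpEnd b D s), hM]
  refine Fintype.sum_equiv (MulAut.conj s).toEquiv _ _ fun r => ?_
  simp [D.form_conj, D.coef_conj]

theorem vecEnd_cons_of_lt {i j : ι} {β : Multiset ι} (g : Γ) (hj : ∀ a ∈ β, j ≤ a) (hi : j < i) :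
    vecEnd b D (b i) (mono R (j ::ₘ β) g) = vecEnd b D (b j) (vecEnd b D (b i) (mono R β g)) +
        commEnd b D (b i) (b j) (mono R β g) := by
  rw [← vecEnd_comm_of_lt D g hj hi, vecEnd_of_le D g hj]

theorem forall_cons_le {i j : ι} {β : Multiset ι} (hj : ∀ a ∈ β, j ≤ a) (hi : j ≤ i) :
    ∀ a ∈ i ::ₘ β, j ≤ a := by
  intro a ha
  rcases Multiset.mem_cons.mp ha with rfl | ha
  · exact hi
  · exact hj a ha

/-- If a relation which is linear in `m` holds for monomials of degree `< k` and for `x_i x_β g`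
with `β` of degree `k`, it holds for the product of `x_i` and `x_β g`. -/
theorem mem_vecEnd_mono {p : OrdMod ι Γ R → Prop} (hp : ∀ m m', p m → p m' → p (m + m')) {i : ι}
    {β : Multiset ι} {g : Γ} (h1 : p (mono R (i ::ₘ β) g)) (h2 : ∀ m ∈ filt ι Γ R β.card, p m) :
    p (vecEnd b D (b i) (mono R β g)) := by
  have := hp _ _ (h2 _ (vecEnd_sub_mem (b := b) D i β g)) h1
  rwa [sub_add_cancel] at this

/-- If i or j precedes all the other indices involved, the relation holds by the construction of the
action. Otherwise the least index l of α precedes both; with x_α = x_l m, both vectors are moved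
past x_l, and the difference of the two orders is the relation at m plus the Jacobi sum for i, j, l.
-/
theorem commAt_step {k : ℕ}
    (hC : ∀ (α : Multiset ι) (g : Γ), α.card < k → ∀ u v, CommAt D b (mono R α g) u v)
    (hS : ∀ (s : Γ) (v : V) (α : Multiset ι) (g : Γ), α.card < k →
      grpEnd b D s (vecEnd b D v (mono R α g)) =
      vecEnd b D ((s : V ≃ₗ[ℂ] V) v) (grpEnd b D s (mono R α g)))
    (α : Multiset ι) (g : Γ) (hα : α.card = k) (u v : V) : CommAt D b (mono R α g) u v := by
  refine commAt_of_basis D (fun i j => ?_) u v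
  rcases multiset_cases α with rfl | ⟨l, δ, rfl, hl⟩
  · rcases le_total i j with h | h
    · exact CommAt.symm D (vecEnd_comm_of_le D g (by simp) h)
    · exact vecEnd_comm_of_le D g (by simp) h
  by_cases hjl : j ≤ l ∧ j ≤ i
  · exact vecEnd_comm_of_le D g
      (forall_cons_le (fun a ha => hjl.1.trans (hl a ha)) hjl.1) hjl.2
  by_cases hil : i ≤ l ∧ i ≤ j
  · exact CommAt.symm D (vecEnd_comm_of_le D g
      (forall_cons_le (fun a ha => hil.1.trans (hl a ha)) hil.1) hil.2)
  have hli : l < i := by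
    by_contra! h
    rcases le_total i j with h' | h'
    · exact hil ⟨h, h'⟩
    · exact hjl ⟨h'.trans h, h'⟩
  have hlj : l < j := by
    by_contra! h
    rcases le_total i j with h' | h'
    · exact hil ⟨h'.trans h, h'⟩
    · exact hjl ⟨h, h'⟩
  have hδ : δ.card < k := by rw [← hα]; simp
  set m := mono R δ g with hm
  have hlm : vecEnd b D (b l) m = mono R (l ::ₘ δ) g := vecEnd_of_le D g hl
  -- Stated symmetrically in i and j, since it is used for both orders of multiplication.
  have key : ∀ i j, l < i → l < j → vecEnd b D (b i) (vecEnd b D (b j) (mono R (l ::ₘ δ) g)) =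
      vecEnd b D (b l) (vecEnd b D (b i) (vecEnd b D (b j) m)) +
        commEnd b D (b i) (b l) (vecEnd b D (b j) m) +
        vecEnd b D (b i) (commEnd b D (b j) (b l) m) := by
    intro i j hi hj
    rw [vecEnd_cons_of_lt D g hl hj, map_add]
    congr 1
    -- The element x_j m has the full degree k, out of reach of the induction hypothesis. But its
    -- leading monomial begins no earlier than l, where the relation holds by construction, and its
    -- remainder has lower degree.
    refine mem_vecEnd_mono D (p := fun m => CommAt D b m (b i) (b l)) ?_ ?_ ?_
    · intro m m' h h'
      simp only [CommAt, map_add] at h h' ⊢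
      rw [h, h']
      abel
    · exact vecEnd_comm_of_lt D g (forall_cons_le hl hj.le) hi
    · exact fun m hm => commAt_of_mem D (fun α g hα => hC α g (hα.trans hδ)) hm _ _
  have hJ := jacobi_apply D (m := m) (fun s w => hS s w δ g hδ) (b i) (b j) (b l)
  have hCm : CommAt D b m (b i) (b j) := hC δ g hδ (b i) (b j)
  rw [CommAt] at hCm ⊢
  rw [key i j hli hlj, key j i hlj hli, ← hlm, hCm, map_add]
  rw [commEnd_swap D (b l) (b i), commEnd_swap D (b l) (b i), map_neg] at hJ
  refine sub_eq_zero.mp (Eq.trans ?_ (neg_eq_zero.mpr hJ))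
  abel

/-- For an index preceding α this is the definition of the group operator. Otherwise x_i is first
moved past the least vector x_j of α; the relations for s x_i and s x_j in smaller degree, together
with the equivariance of the commutator, close the computation. -/
theorem intertwine_step {k : ℕ}
    (hC : ∀ (α : Multiset ι) (g : Γ), α.card < k → ∀ u v, CommAt D b (mono R α g) u v)
    (hS : ∀ (s : Γ) (v : V) (α : Multiset ι) (g : Γ), α.card < k →
      grpEnd b D s (vecEnd b D v (mono R α g)) =
      vecEnd b D ((s : V ≃ₗ[ℂ] V) v) (grpEnd b D s (mono R α g)))
    (hM : ∀ (s s' : Γ) (α : Multiset ι) (g : Γ), α.card < k →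
      grpEnd b D s (grpEnd b D s' (mono R α g)) = grpEnd b D (s * s') (mono R α g))
    (s : Γ) (v : V) (α : Multiset ι) (g : Γ) (hα : α.card = k) :
      grpEnd b D s (vecEnd b D v (mono R α g)) =
      vecEnd b D ((s : V ≃ₗ[ℂ] V) v) (grpEnd b D s (mono R α g)) := by
  refine basis_induction b (p := fun v => grpEnd b D s (vecEnd b D v (mono R α g)) =
    vecEnd b D ((s : V ≃ₗ[ℂ] V) v) (grpEnd b D s (mono R α g))) (fun i => ?_) ?_ ?_ ?_ v
  · have direct : ∀ {i : ι} {β : Multiset ι} (g : Γ), (∀ a ∈ β, i ≤ a) →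
        grpEnd b D s (vecEnd b D (b i) (mono R β g)) =
          vecEnd b D ((s : V ≃ₗ[ℂ] V) (b i)) (grpEnd b D s (mono R β g)) := by
      intro i β g h
      rw [vecEnd_of_le D g h, grpEnd_cons D s g h]
    rcases multiset_cases α with rfl | ⟨j, β, rfl, hj⟩
    · exact direct g (by simp)
    rcases le_or_gt i j with hij | hij
    · exact direct g (forall_cons_le (fun a ha => hij.trans (hj a ha)) hij)
    have hβ : β.card < k := by rw [← hα]; simp
    have h1 : grpEnd b D s (vecEnd b D (b j) (vecEnd b D (b i) (mono R β g))) =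
        vecEnd b D ((s : V ≃ₗ[ℂ] V) (b j)) (grpEnd b D s (vecEnd b D (b i) (mono R β g))) := by
      refine mem_vecEnd_mono D (p := fun m => grpEnd b D s (vecEnd b D (b j) m) =
        vecEnd b D ((s : V ≃ₗ[ℂ] V) (b j)) (grpEnd b D s m)) ?_ ?_ ?_
      · intro m m' h h'
        simp only [map_add, h, h']
      · exact direct g (forall_cons_le hj hij.le)
      · exact fun m hm => intertwine_of_mem D (fun α g hα => hS s _ α g (hα.trans hβ)) hm
    have h2 := commAt_of_mem D hC (m := grpEnd b D s (mono R β g))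
      (grpEnd_mem D s (mono_mem_filt hβ g)) ((s : V ≃ₗ[ℂ] V) (b i)) ((s : V ≃ₗ[ℂ] V) (b j))
    rw [CommAt] at h2
    rw [vecEnd_cons_of_lt D g hj hij, map_add, h1, hS s _ β g hβ,
      grpEnd_commEnd D s _ _ (fun r r' => hM r r' β g hβ), grpEnd_cons D s g hj, h2]
  · simp
  · intro u v hu hv
    simp only [map_add, LinearMap.add_apply, hu, hv]
  · intro c u hu
    simp only [map_smul, LinearMap.smul_apply, end_map_smul, hu]

theorem grpEnd_mul_step {k : ℕ}
    (hS : ∀ (s : Γ) (v : V) (α : Multiset ι) (g : Γ), α.card < k →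
      grpEnd b D s (vecEnd b D v (mono R α g)) =
      vecEnd b D ((s : V ≃ₗ[ℂ] V) v) (grpEnd b D s (mono R α g)))
    (hM : ∀ (s s' : Γ) (α : Multiset ι) (g : Γ), α.card < k →
      grpEnd b D s (grpEnd b D s' (mono R α g)) = grpEnd b D (s * s') (mono R α g))
    (s s' : Γ) (α : Multiset ι) (g : Γ) (hα : α.card = k) :
      grpEnd b D s (grpEnd b D s' (mono R α g)) = grpEnd b D (s * s') (mono R α g) := by
  rcases multiset_cases α with rfl | ⟨j, β, rfl, hj⟩
  · rw [grpEnd_zero, grpEnd_zero, grpEnd_zero, mul_assoc]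
  · have hβ : β.card < k := by rw [← hα]; simp
    rw [grpEnd_cons D s' g hj, grpEnd_cons D (s * s') g hj, ← hM s s' β g hβ]
    exact intertwine_of_mem D (hS s _) (grpEnd_mem D s' (mono_mem_filt hβ g))

/-- The three statements must be proved together: commutation in degree k uses intertwining below k,
intertwining uses all three below k, and multiplicativity of the group action uses intertwining. -/
theorem ordMod_relations (k : ℕ) :
    (∀ (α : Multiset ι) (g : Γ), α.card < k → ∀ u v, CommAt D b (mono R α g) u v) ∧
    (∀ (s : Γ) (v : V) (α : Multiset ι) (g : Γ), α.card < k →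
      grpEnd b D s (vecEnd b D v (mono R α g)) =
      vecEnd b D ((s : V ≃ₗ[ℂ] V) v) (grpEnd b D s (mono R α g))) ∧
    (∀ (s s' : Γ) (α : Multiset ι) (g : Γ), α.card < k →
      grpEnd b D s (grpEnd b D s' (mono R α g)) = grpEnd b D (s * s') (mono R α g)) := by
  induction k with
  | zero => simp
  | succ k ih =>
    obtain ⟨hC, hS, hM⟩ := ih
    refine ⟨fun α g hα => ?_, fun s v α g hα => ?_, fun s s' α g hα => ?_⟩
    all_goals rcases (Nat.lt_succ_iff_lt_or_eq.mp hα) with h | h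
    · exact hC α g h
    · exact commAt_step D hC hS α g h
    · exact hS s v α g h
    · exact intertwine_step D hC hS hM s v α g h
    · exact hM s s' α g h
    · exact grpEnd_mul_step D hS hM s s' α g h

theorem vecEnd_comm (u v : V) : vecEnd b D u * vecEnd b D v =
    vecEnd b D v * vecEnd b D u + commEnd b D u v := by
  refine LinearMap.ext fun m => ?_
  obtain ⟨k, hk⟩ := exists_mem_filt m
  exact commAt_of_mem D (ordMod_relations D k).1 hk u v

theorem grpEnd_vecEnd (s : Γ) (v : V) : grpEnd b D s * vecEnd b D v =
    vecEnd b D ((s : V ≃ₗ[ℂ] V) v) * grpEnd b D s := by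
  refine LinearMap.ext fun m => ?_
  obtain ⟨k, hk⟩ := exists_mem_filt m
  exact intertwine_of_mem D ((ordMod_relations D k).2.1 s v) hk

theorem grpEnd_mul (s s' : Γ) : grpEnd b D (s * s') = grpEnd b D s * grpEnd b D s' := by
  refine LinearMap.ext fun m => ?_
  obtain ⟨k, hk⟩ := exists_mem_filt m
  exact (grpEnd_mul_of_mem D ((ordMod_relations D k).2.2 s s') hk).symm

theorem grpEnd_one : grpEnd b D 1 = 1 := by
  refine LinearMap.ext fun m => ?_
  obtain ⟨k, hk⟩ := exists_mem_filt m
  refine eq_of_mem_filt (fun α g hα => ?_) hk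
  clear hα
  induction hn : α.card generalizing α with
  | zero =>
    obtain rfl := Multiset.card_eq_zero.mp hn
    simp [grpEnd_zero]
  | succ n ih =>
    rcases multiset_cases α with rfl | ⟨j, β, rfl, hj⟩
    · simp at hn
    · rw [grpEnd_cons D 1 g hj, ih β (by simpa using hn)]
      exact vecEnd_of_le D g hj

/-- The ordered product of vectors applied to the unit monomial. -/
theorem prod_vecEnd_mono (α : Multiset ι) (g : Γ) :
    (α.sort.map fun i => vecEnd b D (b i)).prod (mono R 0 g) = mono R α g := by
  induction hn : α.card generalizing α with
  | zero =>
    obtain rfl := Multiset.card_eq_zero.mp hn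
    simp
  | succ n ih =>
    rcases multiset_cases α with rfl | ⟨j, β, rfl, hj⟩
    · simp at hn
    · rw [Multiset.sort_cons j β (· ≤ ·) hj, List.map_cons, List.prod_cons, Module.End.mul_apply,
        ih β (by simpa using hn), vecEnd_of_le D g hj]

end OrderedMonomials

/-! ### Symplectic reflections -/

section Reflections

variable {V : Type*} [AddCommGroup V] [Module ℂ V] [FiniteDimensional ℂ V]
  {Γ : Subgroup (V ≃ₗ[ℂ] V)} [Finite Γ]

theorem subOne_apply (s : Γ) (v : V) : subOne s v = (s : V ≃ₗ[ℂ] V) v - v := rfl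

theorem proj_mem (s : Γ) (u : V) : proj s u ∈ LinearMap.range (subOne s) :=
  Submodule.projection_apply_mem _ u

theorem sub_proj_mem (s : Γ) (u : V) : u - proj s u ∈ LinearMap.ker (subOne s) := by
  rw [← Submodule.projection_apply_eq_zero_iff (isCompl_range_ker s), map_sub, sub_eq_zero]
  exact (Submodule.projection_eq_self_iff _ _).mpr (proj_mem s u) |>.symm

theorem proj_eq (s : Γ) {u w : V} (h1 : w ∈ LinearMap.range (subOne s))
    (h2 : u - w ∈ LinearMap.ker (subOne s)) : proj s u = w := by
  have h := (Submodule.projection_apply_eq_zero_iff (isCompl_range_ker s)).mpr h2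
  rw [map_sub, sub_eq_zero] at h
  exact h.trans ((Submodule.projection_eq_self_iff _ _).mpr h1)

theorem subOne_proj (s : Γ) (u : V) : subOne s (proj s u) = subOne s u := by
  have := sub_proj_mem s u
  rw [LinearMap.mem_ker, map_sub, sub_eq_zero] at this
  exact this.symm

theorem subOne_conj (g s : Γ) (u : V) :
    subOne (g * s * g⁻¹) ((g : V ≃ₗ[ℂ] V) u) = (g : V ≃ₗ[ℂ] V) (subOne s u) := by
  simp [subOne_apply]

theorem range_subOne_conj (g s : Γ) : LinearMap.range (subOne (g * s * g⁻¹)) =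
    (LinearMap.range (subOne s)).map ((g : V ≃ₗ[ℂ] V) : V →ₗ[ℂ] V) := by
  ext x
  simp only [LinearMap.mem_range, Submodule.mem_map]
  constructor
  · rintro ⟨y, rfl⟩
    refine ⟨_, ⟨(g : V ≃ₗ[ℂ] V).symm y, rfl⟩, ?_⟩
    rw [LinearEquiv.coe_coe, ← subOne_conj, LinearEquiv.apply_symm_apply]
  · rintro ⟨_, ⟨y, rfl⟩, rfl⟩
    exact ⟨(g : V ≃ₗ[ℂ] V) y, subOne_conj g s y⟩

theorem proj_conj (g s : Γ) (u : V) :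
    proj (g * s * g⁻¹) ((g : V ≃ₗ[ℂ] V) u) = (g : V ≃ₗ[ℂ] V) (proj s u) := by
  apply proj_eq
  · rw [range_subOne_conj]
    exact Submodule.mem_map_of_mem (proj_mem s u)
  · rw [LinearMap.mem_ker, ← map_sub, subOne_conj, LinearMap.mem_ker.mp (sub_proj_mem s u), map_zero]

theorem isSymplecticReflection_conj (g s : Γ) :
    IsSymplecticReflection (g * s * g⁻¹) ↔ IsSymplecticReflection s := by
  rw [IsSymplecticReflection, IsSymplecticReflection, range_subOne_conj,
    LinearEquiv.finrank_map_eq]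

theorem not_isSymplecticReflection_one : ¬ IsSymplecticReflection (1 : Γ) := by
  have : subOne (1 : Γ) = 0 := by ext; simp [subOne_apply]
  rw [IsSymplecticReflection, this, LinearMap.range_zero, finrank_bot]
  omega

theorem reflectionClass_conj (g s : Γ) (h : IsSymplecticReflection s)
    (h' : IsSymplecticReflection (g * s * g⁻¹)) :
    reflectionClass ⟨g * s * g⁻¹, h'⟩ = reflectionClass ⟨s, h⟩ := by
  apply Subtype.ext
  exact ConjClasses.mk_eq_mk_iff_isConj.mpr (isConj_iff.mpr ⟨g, rfl⟩).symm

/-- Three vectors in a plane satisfy the Cramer relation. -/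
theorem cramer_plane {Ω : LinearMap.BilinForm ℂ V} (hΩ : Ω.IsAlt) {W : Submodule ℂ V}
    (hW : Module.finrank ℂ W = 2) {a b c : V} (ha : a ∈ W) (hb : b ∈ W) (hc : c ∈ W) :
    Ω a b • c + Ω b c • a + Ω c a • b = 0 := by
  let B := Module.finBasisOfFinrankEq ℂ W hW
  have key : ∀ x ∈ W, ∃ p q : ℂ, x = p • (B 0 : V) + q • (B 1 : V) := by
    intro x hx
    refine ⟨B.repr ⟨x, hx⟩ 0, B.repr ⟨x, hx⟩ 1, ?_⟩
    have := congrArg Subtype.val (B.sum_repr ⟨x, hx⟩)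
    rw [Fin.sum_univ_two] at this
    exact this.symm
  obtain ⟨a0, a1, rfl⟩ := key a ha
  obtain ⟨b0, b1, rfl⟩ := key b hb
  obtain ⟨c0, c1, rfl⟩ := key c hc
  have h0 : ∀ x, Ω x x = 0 := hΩ
  have h1 : Ω (B 1 : V) (B 0 : V) = - Ω (B 0 : V) (B 1 : V) :=
    (LinearMap.IsAlt.neg hΩ (B 0 : V) (B 1 : V)).symm
  simp only [map_add, map_smul, LinearMap.add_apply, LinearMap.smul_apply, h0, h1, smul_eq_mul]
  module

open scoped Classical in
/-- The form which is the coefficient of `s` in the commutation relations of `H`. -/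
def reflForm (Ω : LinearMap.BilinForm ℂ V) (s : Γ) : LinearMap.BilinForm ℂ V :=
  if s = 1 then Ω else if IsSymplecticReflection s then Ω.comp (proj s) (proj s) else 0

open scoped Classical in
/-- The parameter which accompanies `reflForm Ω s`. -/
def reflCoef (s : Γ) : SymmetricAlgebra ℂ (Param Γ) :=
  if s = 1 then tVar Γ else if h : IsSymplecticReflection s then cVar (reflectionClass ⟨s, h⟩)
    else 0

theorem reflForm_one (Ω : LinearMap.BilinForm ℂ V) : reflForm Ω (1 : Γ) = Ω := by
  simp [reflForm]

theorem reflForm_of_refl (Ω : LinearMap.BilinForm ℂ V) {s : Γ} (h : IsSymplecticReflection s)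
    (u v : V) : reflForm Ω s u v = Ω (proj s u) (proj s v) := by
  have h1 : s ≠ 1 := by
    rintro rfl
    exact not_isSymplecticReflection_one h
  simp [reflForm, h, h1]

theorem reflCoef_one : reflCoef (1 : Γ) = tVar Γ := by simp [reflCoef]

theorem reflCoef_of_refl {s : Γ} (h : IsSymplecticReflection s) :
    reflCoef s = cVar (reflectionClass ⟨s, h⟩) := by
  have h1 : s ≠ 1 := by
    rintro rfl
    exact not_isSymplecticReflection_one h
  simp [reflCoef, h, h1]

/-- The commutation relations of the universal symplectic reflection algebra. -/
def reflDatum {Ω : LinearMap.BilinForm ℂ V} (hΩ : Ω.IsAlt) (hΓ : Γ ≤ Sp Ω) :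
    CommutatorDatum Γ (SymmetricAlgebra ℂ (Param Γ)) where
  form := reflForm Ω
  coef := reflCoef
  alt s v := by
    unfold reflForm
    split_ifs
    · exact hΩ v
    · exact hΩ (proj s v)
    · rfl
  form_conj g s u v := by
    by_cases h1 : s = 1
    · subst h1
      rw [mul_one, mul_inv_cancel, reflForm_one]
      exact hΓ g.2 u v
    · have h2 : g * s * g⁻¹ ≠ 1 := fun h => h1 (conj_eq_one_iff.mp h)
      by_cases h : IsSymplecticReflection s
      · rw [reflForm_of_refl Ω h, reflForm_of_refl Ω ((isSymplecticReflection_conj g s).mpr h),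
          proj_conj, proj_conj]
        exact hΓ g.2 _ _
      · simp [reflForm, h1, h2, h, isSymplecticReflection_conj]
  coef_conj g s := by
    by_cases h1 : s = 1
    · simp [h1]
    · have h2 : g * s * g⁻¹ ≠ 1 := fun h => h1 (conj_eq_one_iff.mp h)
      by_cases h : IsSymplecticReflection s
      · rw [reflCoef_of_refl h, reflCoef_of_refl ((isSymplecticReflection_conj g s).mpr h),
          reflectionClass_conj g s h]
      · simp [reflCoef, h1, h2, h, isSymplecticReflection_conj]
  jacobi s u v w := by
    by_cases h1 : s = 1
    · simp [h1]
    by_cases h : IsSymplecticReflection s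
    · have hd : ∀ v, (s : V ≃ₗ[ℂ] V) v - v = subOne s (proj s v) := fun v => by
        rw [subOne_proj, subOne_apply]
      -- The Jacobi identity is the image under s - 1 of Cramer's relation for the three
      -- projections, because (s - 1) v = (s - 1) π_s v.
      have := congrArg (subOne s)
        (cramer_plane hΩ h (proj_mem s u) (proj_mem s v) (proj_mem s w))
      rw [reflForm_of_refl Ω h, reflForm_of_refl Ω h, reflForm_of_refl Ω h, hd, hd, hd]
      simpa only [map_add, map_smul, map_zero] using this
    · simp [reflForm, h1, h]

/-- The double sum in the relations of `H`, as a sum over the group. -/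
theorem sum_refl {M : Type*} [AddCommGroup M] [Module ℂ M] [Fintype Γ]
    (Ω : LinearMap.BilinForm ℂ V) (F : Γ → SymmetricAlgebra ℂ (Param Γ) → M) (hF : ∀ s, F s 0 = 0)
    (u v : V) :
    ∑ s : Γ, reflForm Ω s u v • F s (reflCoef s) = Ω u v • F 1 (tVar Γ) +
      ∑ᶠ s : {s : Γ // IsSymplecticReflection s},
        Ω (proj s.1 u) (proj s.1 v) • F s.1 (cVar (reflectionClass s)) := by
  classical
  rw [← Finset.add_sum_erase Finset.univ _ (Finset.mem_univ (1 : Γ)), reflForm_one, reflCoef_one,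
    finsum_eq_sum_of_fintype]
  congr 1
  symm
  rw [← Finset.sum_subset (s₁ := Finset.univ.filter fun s : Γ => IsSymplecticReflection s)]
  · rw [Finset.sum_subtype (p := fun s : Γ => IsSymplecticReflection s) _ (by simp)]
    refine Finset.sum_congr rfl fun s _ => ?_
    rw [reflForm_of_refl Ω s.2, reflCoef_of_refl s.2]
  · intro s hs
    simp only [Finset.mem_filter, Finset.mem_univ, true_and] at hs
    simp only [Finset.mem_erase, Finset.mem_univ, and_true]
    rintro rfl
    exact not_isSymplecticReflection_one hs
  · intro s hs hs'
    simp only [Finset.mem_erase, Finset.mem_univ, and_true] at hs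
    simp only [Finset.mem_filter, Finset.mem_univ, true_and] at hs'
    simp [reflCoef, hs, hs', hF]

end Reflections

/-! ### Generators of the symplectic reflection algebra and its universal property -/

section Universal

variable {V : Type*} [AddCommGroup V] [Module ℂ V] {Ω : LinearMap.BilinForm ℂ V}
  {Γ : Subgroup (V ≃ₗ[ℂ] V)} {A : Type*} [Ring A] [Algebra ℂ A]

/-- The homomorphism from `T(V) # Γ` determined by the images of `V` and `Γ`. -/
def tensorSmashLift (x : V →ₗ[ℂ] A) (γ : Γ →* A)
    (h : ∀ g v, γ g * x v = x ((g : V ≃ₗ[ℂ] V) v) * γ g) : TensorSmash Γ →ₐ[ℂ] A :=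
  SkewMonoidAlgebra.liftNCAlgHom (TensorAlgebra.lift ℂ x) γ (by
    intro a g
    induction a using TensorAlgebra.induction with
    | algebraMap r =>
      rw [tensor_smul_def, AlgHom.commutes, AlgHom.commutes]
      exact Algebra.commutes _ _
    | ι v => simp [tensor_smul_def, h]
    | mul a a' ha ha' => rw [smul_mul', map_mul, map_mul, mul_assoc, ha', ← mul_assoc, ha, mul_assoc]
    | add a a' ha ha' => rw [smul_add, map_add, map_add, add_mul, mul_add, ha, ha'])

theorem tensorSmashLift_single (x : V →ₗ[ℂ] A) (γ : Γ →* A)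
    (h : ∀ g v, γ g * x v = x ((g : V ≃ₗ[ℂ] V) v) * γ g) (g : Γ) (a : TensorAlgebra ℂ V) :
    tensorSmashLift x γ h (SkewMonoidAlgebra.single g a) = TensorAlgebra.lift ℂ x a * γ g := by
  change SkewMonoidAlgebra.liftNC _ _ (SkewMonoidAlgebra.single g a) = _
  rw [SkewMonoidAlgebra.liftNC_single]
  rfl

theorem tensorSmashLift_vec (x : V →ₗ[ℂ] A) (γ : Γ →* A)
    (h : ∀ g v, γ g * x v = x ((g : V ≃ₗ[ℂ] V) v) * γ g) (v : V) :
    tensorSmashLift x γ h (vec Γ v) = x v := by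
  rw [vec, tensorSmashLift_single, map_one, mul_one, TensorAlgebra.lift_ι_apply]

theorem tensorSmashLift_grp (x : V →ₗ[ℂ] A) (γ : Γ →* A)
    (h : ∀ g v, γ g * x v = x ((g : V ≃ₗ[ℂ] V) v) * γ g) (g : Γ) :
    tensorSmashLift x γ h (grp g) = γ g := by
  rw [grp, tensorSmashLift_single, map_one, one_mul]

theorem grp_mul_vec (g : Γ) (v : V) :
    grp g * vec Γ v = vec Γ ((g : V ≃ₗ[ℂ] V) v) * grp g := by
  rw [grp, vec, vec, SkewMonoidAlgebra.single_mul_single, SkewMonoidAlgebra.single_mul_single]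
  simp [tensor_smul_def]

theorem grp_mul (g h : Γ) : grp (g * h) = grp g * grp h := by
  rw [grp, grp, grp, SkewMonoidAlgebra.single_mul_single]
  simp

variable [FiniteDimensional ℂ V] [Finite Γ]

/-- The homomorphism from `H` determined by the images of the parameters, of `V` and of `Γ`. -/
def sraLift (f : SymmetricAlgebra ℂ (Param Γ) →ₐ[ℂ] A) (hf : ∀ p a, Commute (f p) a)
    (x : V →ₗ[ℂ] A) (γ : Γ →* A) (h : ∀ g v, γ g * x v = x ((g : V ≃ₗ[ℂ] V) v) * γ g)
    (hrel : ∀ u v, x u * x v - x v * x u = Ω u v • f (tVar Γ) +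
      ∑ᶠ s : {s : Γ // IsSymplecticReflection s},
        Ω (proj s.1 u) (proj s.1 v) • (f (cVar (reflectionClass s)) * γ s.1)) :
    SRA Ω Γ →ₐ[ℂ] A :=
  RingQuot.liftAlgHom ℂ ⟨Algebra.TensorProduct.lift f (tensorSmashLift x γ h)
    (fun p y => hf p _), by
      rintro _ _ ⟨u, v⟩
      have hfin : Finite {s : Γ // IsSymplecticReflection s} := inferInstance
      rw [map_add, map_finsum _ (Set.toFinite _)]
      simp only [Algebra.TensorProduct.lift_tmul, map_one, one_mul, map_sub, map_mul, map_smul,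
        tensorSmashLift_vec, tensorSmashLift_grp, mul_smul_comm, mul_one]
      exact hrel u v⟩

theorem sraLift_mk (f : SymmetricAlgebra ℂ (Param Γ) →ₐ[ℂ] A) (hf : ∀ p a, Commute (f p) a)
    (x : V →ₗ[ℂ] A) (γ : Γ →* A) (h : ∀ g v, γ g * x v = x ((g : V ≃ₗ[ℂ] V) v) * γ g)
    (hrel : ∀ u v, x u * x v - x v * x u = Ω u v • f (tVar Γ) +
      ∑ᶠ s : {s : Γ // IsSymplecticReflection s},
        Ω (proj s.1 u) (proj s.1 v) • (f (cVar (reflectionClass s)) * γ s.1))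
    (p : SymmetricAlgebra ℂ (Param Γ)) (y : TensorSmash Γ) :
    sraLift f hf x γ h hrel (mkSRA Ω Γ (p ⊗ₜ y)) = f p * tensorSmashLift x γ h y := by
  unfold sraLift mkSRA
  erw [RingQuot.liftAlgHom_mkAlgHom_apply]
  rw [Algebra.TensorProduct.lift_tmul]

variable (Ω Γ) in
/-- A vector as an element of `H`. -/
def sraVec : V →ₗ[ℂ] SRA Ω Γ where
  toFun v := mkSRA Ω Γ (1 ⊗ₜ vec Γ v)
  map_add' u v := by simp [vec, TensorProduct.tmul_add]
  map_smul' c v := by simp [vec, ← SkewMonoidAlgebra.smul_single]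

variable (Ω) in
/-- A group element as an element of `H`. -/
def sraGrp : Γ →* SRA Ω Γ where
  toFun g := mkSRA Ω Γ (1 ⊗ₜ grp g)
  map_one' := map_one (mkSRA Ω Γ)
  map_mul' g h := by rw [grp_mul, ← map_mul, Algebra.TensorProduct.tmul_mul_tmul, one_mul]

/-- The quotient maps formed over S(p_univ) and over ℂ have the same underlying ring homomorphism.
-/
theorem algebraMap_sra (p : SymmetricAlgebra ℂ (Param Γ)) :
    algebraMap (SymmetricAlgebra ℂ (Param Γ)) (SRA Ω Γ) p = mkSRA Ω Γ (p ⊗ₜ 1) := by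
  change algebraMap (SymmetricAlgebra ℂ (Param Γ)) (RingQuot (Rel Ω Γ)) p =
    RingQuot.mkAlgHom ℂ (Rel Ω Γ) (p ⊗ₜ 1)
  have h := (RingQuot.mkAlgHom (SymmetricAlgebra ℂ (Param Γ)) (Rel Ω Γ)).commutes p
  have h1 := RingHom.congr_fun
    (RingQuot.mkAlgHom_coe (SymmetricAlgebra ℂ (Param Γ)) (Rel Ω Γ)) (p ⊗ₜ 1)
  have h2 := RingHom.congr_fun (RingQuot.mkAlgHom_coe ℂ (Rel Ω Γ)) (p ⊗ₜ 1)
  exact h.symm.trans (h1.trans h2.symm)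

theorem sraGrp_mul_sraVec (g : Γ) (v : V) :
    sraGrp Ω g * sraVec Ω Γ v = sraVec Ω Γ ((g : V ≃ₗ[ℂ] V) v) * sraGrp Ω g := by
  change mkSRA Ω Γ _ * mkSRA Ω Γ _ = mkSRA Ω Γ _ * mkSRA Ω Γ _
  rw [← map_mul, ← map_mul, Algebra.TensorProduct.tmul_mul_tmul,
    Algebra.TensorProduct.tmul_mul_tmul, grp_mul_vec]

theorem sraVec_comm (u v : V) :
    sraVec Ω Γ u * sraVec Ω Γ v - sraVec Ω Γ v * sraVec Ω Γ u =
      Ω u v • algebraMap _ (SRA Ω Γ) (tVar Γ) + ∑ᶠ s : {s : Γ // IsSymplecticReflection s},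
        Ω (proj s.1 u) (proj s.1 v) •
          (algebraMap _ (SRA Ω Γ) (cVar (reflectionClass s)) * sraGrp Ω s.1) := by
  have hfin : Finite {s : Γ // IsSymplecticReflection s} := inferInstance
  have h : mkSRA Ω Γ (1 ⊗ₜ[ℂ] (vec Γ u * vec Γ v - vec Γ v * vec Γ u)) =
      mkSRA Ω Γ (tVar Γ ⊗ₜ[ℂ] (Ω u v • (1 : TensorSmash Γ)) +
        ∑ᶠ s : {s : Γ // IsSymplecticReflection s},
          cVar (reflectionClass s) ⊗ₜ[ℂ] (Ω (proj s.1 u) (proj s.1 v) • grp s.1)) :=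
    RingQuot.mkAlgHom_rel ℂ (Rel.comm u v)
  rw [map_add, map_finsum _ (Set.toFinite _)] at h
  have e1 : mkSRA Ω Γ (1 ⊗ₜ[ℂ] (vec Γ u * vec Γ v - vec Γ v * vec Γ u)) =
      sraVec Ω Γ u * sraVec Ω Γ v - sraVec Ω Γ v * sraVec Ω Γ u := by
    change _ = mkSRA Ω Γ _ * mkSRA Ω Γ _ - mkSRA Ω Γ _ * mkSRA Ω Γ _
    rw [← map_mul, ← map_mul, ← map_sub, Algebra.TensorProduct.tmul_mul_tmul,
      Algebra.TensorProduct.tmul_mul_tmul, one_mul, ← TensorProduct.tmul_sub]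
  rw [← e1, h, TensorProduct.tmul_smul, map_smul, algebraMap_sra]
  congr 1
  refine finsum_congr fun s => ?_
  change _ = _ • (_ * mkSRA Ω Γ _)
  rw [TensorProduct.tmul_smul, map_smul, algebraMap_sra, ← map_mul,
    Algebra.TensorProduct.tmul_mul_tmul, one_mul, mul_one]

/-- The commutation relations of `H`, as a sum over the group. -/
theorem sraVec_comm' [Fintype Γ] (u v : V) :
    sraVec Ω Γ u * sraVec Ω Γ v = sraVec Ω Γ v * sraVec Ω Γ u +
      ∑ s : Γ, reflForm Ω s u v • (reflCoef s • sraGrp Ω s) := by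
  rw [sum_refl Ω (fun s c => c • sraGrp Ω s) (fun s => zero_smul _ _), ← sub_eq_iff_eq_add',
    sraVec_comm]
  simp only [Algebra.smul_def, map_one, mul_one]

theorem mkSRA_single (p : SymmetricAlgebra ℂ (Param Γ)) (g : Γ) (a : TensorAlgebra ℂ V) :
    mkSRA Ω Γ (p ⊗ₜ SkewMonoidAlgebra.single g a) =
      p • (TensorAlgebra.lift ℂ (sraVec Ω Γ) a * sraGrp Ω g) := by
  have h1 : TensorAlgebra.lift ℂ (sraVec Ω Γ) a =
      mkSRA Ω Γ (1 ⊗ₜ SkewMonoidAlgebra.single 1 a) := by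
    induction a using TensorAlgebra.induction with
    | algebraMap r =>
      rw [AlgHom.commutes, Algebra.algebraMap_eq_smul_one, Algebra.algebraMap_eq_smul_one,
        ← SkewMonoidAlgebra.smul_single, TensorProduct.tmul_smul, map_smul]
      congr 1
      exact (map_one (mkSRA Ω Γ)).symm
    | ι v => rw [TensorAlgebra.lift_ι_apply]; rfl
    | mul a a' ha ha' =>
      rw [map_mul, ha, ha', ← map_mul, Algebra.TensorProduct.tmul_mul_tmul,
        SkewMonoidAlgebra.single_mul_single]
      simp
    | add a a' ha ha' =>
      rw [map_add, ha, ha', SkewMonoidAlgebra.single_add, TensorProduct.tmul_add, map_add]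
  rw [Algebra.smul_def, algebraMap_sra, h1]
  change _ = _ * (_ * mkSRA Ω Γ (1 ⊗ₜ grp g))
  rw [← map_mul, ← map_mul, Algebra.TensorProduct.tmul_mul_tmul,
    Algebra.TensorProduct.tmul_mul_tmul, grp, SkewMonoidAlgebra.single_mul_single]
  simp

theorem SRA.induction {p : SRA Ω Γ → Prop}
    (param : ∀ r : SymmetricAlgebra ℂ (Param Γ), p (algebraMap _ _ r))
    (vec : ∀ v, p (sraVec Ω Γ v)) (grp : ∀ g, p (sraGrp Ω g))
    (mul : ∀ x y, p x → p y → p (x * y)) (add : ∀ x y, p x → p y → p (x + y)) (x : SRA Ω Γ) :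
    p x := by
  obtain ⟨y, rfl⟩ := RingQuot.mkAlgHom_surjective ℂ (Rel Ω Γ) x
  have hzero : p 0 := by simpa using param 0
  change p (mkSRA Ω Γ y)
  induction y using TensorProduct.induction_on with
  | zero => simpa using hzero
  | add a b ha hb => rw [map_add]; exact add _ _ ha hb
  | tmul r z =>
    induction z using SkewMonoidAlgebra.induction_on with
    | zero => simpa using hzero
    | single g a =>
      rw [mkSRA_single, Algebra.smul_def]
      refine mul _ _ (param r) (mul _ _ ?_ (grp g))
      induction a using TensorAlgebra.induction with
      | algebraMap r =>
        rw [AlgHom.commutes, IsScalarTower.algebraMap_apply ℂ (SymmetricAlgebra ℂ (Param Γ))]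
        exact param _
      | ι v => rw [TensorAlgebra.lift_ι_apply]; exact vec v
      | mul a b ha hb => rw [map_mul]; exact mul _ _ ha hb
      | add a b ha hb => rw [map_add]; exact add _ _ ha hb
    | add a b ha hb => rw [TensorProduct.tmul_add, map_add]; exact add _ _ ha hb

theorem sraLift_param (f : SymmetricAlgebra ℂ (Param Γ) →ₐ[ℂ] A) (hf : ∀ p a, Commute (f p) a)
    (x : V →ₗ[ℂ] A) (γ : Γ →* A) (h : ∀ g v, γ g * x v = x ((g : V ≃ₗ[ℂ] V) v) * γ g)
    (hrel : ∀ u v, x u * x v - x v * x u = Ω u v • f (tVar Γ) +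
      ∑ᶠ s : {s : Γ // IsSymplecticReflection s},
        Ω (proj s.1 u) (proj s.1 v) • (f (cVar (reflectionClass s)) * γ s.1))
    (p : SymmetricAlgebra ℂ (Param Γ)) :
    sraLift f hf x γ h hrel (algebraMap _ _ p) = f p := by
  rw [algebraMap_sra, sraLift_mk, map_one, mul_one]

theorem sraLift_vec (f : SymmetricAlgebra ℂ (Param Γ) →ₐ[ℂ] A) (hf : ∀ p a, Commute (f p) a)
    (x : V →ₗ[ℂ] A) (γ : Γ →* A) (h : ∀ g v, γ g * x v = x ((g : V ≃ₗ[ℂ] V) v) * γ g)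
    (hrel : ∀ u v, x u * x v - x v * x u = Ω u v • f (tVar Γ) +
      ∑ᶠ s : {s : Γ // IsSymplecticReflection s},
        Ω (proj s.1 u) (proj s.1 v) • (f (cVar (reflectionClass s)) * γ s.1)) (v : V) :
    sraLift f hf x γ h hrel (sraVec Ω Γ v) = x v := by
  change sraLift f hf x γ h hrel (mkSRA Ω Γ (1 ⊗ₜ vec Γ v)) = _
  rw [sraLift_mk, map_one, one_mul, tensorSmashLift_vec]

theorem sraLift_grp (f : SymmetricAlgebra ℂ (Param Γ) →ₐ[ℂ] A) (hf : ∀ p a, Commute (f p) a)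
    (x : V →ₗ[ℂ] A) (γ : Γ →* A) (h : ∀ g v, γ g * x v = x ((g : V ≃ₗ[ℂ] V) v) * γ g)
    (hrel : ∀ u v, x u * x v - x v * x u = Ω u v • f (tVar Γ) +
      ∑ᶠ s : {s : Γ // IsSymplecticReflection s},
        Ω (proj s.1 u) (proj s.1 v) • (f (cVar (reflectionClass s)) * γ s.1)) (g : Γ) :
    sraLift f hf x γ h hrel (sraGrp Ω g) = γ g := by
  change sraLift f hf x γ h hrel (mkSRA Ω Γ (1 ⊗ₜ grp g)) = _
  rw [sraLift_mk, map_one, one_mul, tensorSmashLift_grp]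

end Universal

/-! ### Ordered monomials -/

section Basis

variable {V : Type*} [AddCommGroup V] [Module ℂ V] [FiniteDimensional ℂ V]
  {Ω : LinearMap.BilinForm ℂ V} {Γ : Subgroup (V ≃ₗ[ℂ] V)} [Finite Γ] {ι : Type*}
  (b : Module.Basis ι ℂ V)

variable (Ω Γ) in
/-- The product of the basis vectors in a word, followed by a group element. -/
def sraWord (l : List ι) (g : Γ) : SRA Ω Γ :=
  (l.map fun i => sraVec Ω Γ (b i)).prod * sraGrp Ω g

theorem sraWord_cons (i : ι) (l : List ι) (g : Γ) :
    sraWord Ω Γ b (i :: l) g = sraVec Ω Γ (b i) * sraWord Ω Γ b l g := by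
  simp [sraWord, mul_assoc]

variable (Ω Γ) in
/-- The span of the words of length less than `k`. -/
def sraFilt (k : ℕ) : Submodule (SymmetricAlgebra ℂ (Param Γ)) (SRA Ω Γ) :=
  Submodule.span _ {x | ∃ (l : List ι) (g : Γ), l.length < k ∧ x = sraWord Ω Γ b l g}

variable {b}

theorem sraWord_mem {k : ℕ} {l : List ι} (h : l.length < k) (g : Γ) :
    sraWord Ω Γ b l g ∈ sraFilt Ω Γ b k :=
  Submodule.subset_span ⟨l, g, h, rfl⟩

theorem sraFilt_mono {k l : ℕ} (h : k ≤ l) : sraFilt Ω Γ b k ≤ sraFilt Ω Γ b l := by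
  apply Submodule.span_mono
  rintro _ ⟨w, g, hw, rfl⟩
  exact ⟨w, g, hw.trans_le h, rfl⟩

theorem complex_smul_mem (W : Submodule (SymmetricAlgebra ℂ (Param Γ)) (SRA Ω Γ)) (c : ℂ)
    {x : SRA Ω Γ} (h : x ∈ W) : c • x ∈ W := by
  rw [← algebraMap_smul (SymmetricAlgebra ℂ (Param Γ)) c x]
  exact W.smul_mem _ h

theorem mul_mem_sraFilt {k l : ℕ} {x : SRA Ω Γ}
    (h : ∀ (w : List ι) (g : Γ), w.length < k → x * sraWord Ω Γ b w g ∈ sraFilt Ω Γ b l)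
    {m : SRA Ω Γ} (hm : m ∈ sraFilt Ω Γ b k) : x * m ∈ sraFilt Ω Γ b l := by
  have : sraFilt Ω Γ b k ≤ (sraFilt Ω Γ b l).comap
      (LinearMap.mulLeft (SymmetricAlgebra ℂ (Param Γ)) x) := by
    refine Submodule.span_le.mpr ?_
    rintro _ ⟨w, g, hw, rfl⟩
    exact h w g hw
  exact this hm

theorem sraVec_mul_mem {k : ℕ} (v : V) {m : SRA Ω Γ} (hm : m ∈ sraFilt Ω Γ b k) :
    sraVec Ω Γ v * m ∈ sraFilt Ω Γ b (k + 1) := by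
  refine mul_mem_sraFilt (fun w g hw => ?_) hm
  refine basis_induction b (p := fun v => sraVec Ω Γ v * sraWord Ω Γ b w g ∈ sraFilt Ω Γ b (k + 1))
    (fun i => ?_) ?_ ?_ ?_ v
  · rw [← sraWord_cons]
    exact sraWord_mem (by simpa using hw) g
  · simp
  · intro u v hu hv
    rw [map_add, add_mul]
    exact add_mem hu hv
  · intro c u hu
    rw [map_smul, smul_mul_assoc]
    exact complex_smul_mem _ c hu

theorem sraGrp_mul_word (s : Γ) (l : List ι) (g : Γ) :
    sraGrp Ω s * sraWord Ω Γ b l g ∈ sraFilt Ω Γ b (l.length + 1) := by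
  induction l with
  | nil =>
    have : sraGrp Ω s * sraWord Ω Γ b [] g = sraWord Ω Γ b [] (s * g) := by simp [sraWord]
    rw [this]
    exact sraWord_mem (by simp) _
  | cons i l ih =>
    rw [sraWord_cons, ← mul_assoc, sraGrp_mul_sraVec, mul_assoc]
    exact sraVec_mul_mem _ ih

theorem sraGrp_mul_mem {k : ℕ} (s : Γ) {m : SRA Ω Γ} (hm : m ∈ sraFilt Ω Γ b k) :
    sraGrp Ω s * m ∈ sraFilt Ω Γ b k :=
  mul_mem_sraFilt (fun w g hw => sraFilt_mono (by omega) (sraGrp_mul_word s w g)) hm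

theorem exists_mem_sraFilt (x : SRA Ω Γ) : ∃ k, x ∈ sraFilt Ω Γ b k := by
  -- Left multiplication by x is followed on the whole filtration, so that the property passes to
  -- products; it is applied to the unit word at the end.
  have key : ∀ k m, m ∈ sraFilt Ω Γ b k → ∃ l, x * m ∈ sraFilt Ω Γ b l := by
    induction x using SRA.induction with
    | param r =>
      intro k m hm
      refine ⟨k, ?_⟩
      rw [← Algebra.smul_def]
      exact Submodule.smul_mem _ _ hm
    | vec v => exact fun k m hm => ⟨k + 1, sraVec_mul_mem v hm⟩
    | grp g => exact fun k m hm => ⟨k, sraGrp_mul_mem g hm⟩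
    | mul x y hx hy =>
      intro k m hm
      obtain ⟨l, hl⟩ := hy k m hm
      obtain ⟨l', hl'⟩ := hx l _ hl
      exact ⟨l', by rwa [mul_assoc]⟩
    | add x y hx hy =>
      intro k m hm
      obtain ⟨l, hl⟩ := hy k m hm
      obtain ⟨l', hl'⟩ := hx k m hm
      refine ⟨max l' l, ?_⟩
      rw [add_mul]
      exact add_mem (sraFilt_mono (le_max_left _ _) hl') (sraFilt_mono (le_max_right _ _) hl)
  have h1 : (1 : SRA Ω Γ) = sraWord Ω Γ b [] 1 := by simp [sraWord]
  simpa using key 1 1 (h1 ▸ sraWord_mem (by simp) _)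

/-- Exchanging adjacent letters produces a commutator, which lies in the span of Γ over the
parameters and so shortens the word by two; moving group elements to the right does not lengthen it.
-/
theorem sraWord_perm {l l' : List ι} (h : l.Perm l') (g : Γ) :
    sraWord Ω Γ b l g - sraWord Ω Γ b l' g ∈ sraFilt Ω Γ b l.length := by
  have := Fintype.ofFinite Γ
  induction h with
  | nil => simp
  | cons x h ih =>
    rw [sraWord_cons, sraWord_cons, ← mul_sub]
    exact sraVec_mul_mem _ ih
  | swap x y l =>
    rw [sraWord_cons, sraWord_cons, sraWord_cons, sraWord_cons, ← mul_assoc, ← mul_assoc,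
      ← sub_mul, sub_eq_iff_eq_add'.mpr (sraVec_comm' (b y) (b x)), Finset.sum_mul]
    refine Submodule.sum_mem _ fun s _ => ?_
    rw [smul_mul_assoc, smul_mul_assoc]
    exact complex_smul_mem _ _ (Submodule.smul_mem _ _
      (sraFilt_mono (by simp) (sraGrp_mul_word s l g)))
  | trans h1 _ ih1 ih2 =>
    rw [← h1.length_eq] at ih2
    simpa using add_mem ih1 ih2

variable [LinearOrder ι]

variable (Ω Γ b) in
/-- The ordered monomials in `H`. -/
def sraMono (p : Multiset ι × Γ) : SRA Ω Γ := sraWord Ω Γ b p.1.sort p.2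

/-- Induction on the word length: a word differs from its sorted version by shorter words. -/
theorem span_sraMono :
    Submodule.span (SymmetricAlgebra ℂ (Param Γ)) (Set.range (sraMono Ω Γ b)) = ⊤ := by
  have key : ∀ k, sraFilt Ω Γ b k ≤
      Submodule.span (SymmetricAlgebra ℂ (Param Γ)) (Set.range (sraMono Ω Γ b)) := by
    intro k
    induction k with
    | zero => exact Submodule.span_le.mpr (by rintro _ ⟨l, g, h, -⟩; simp at h)
    | succ k ih =>
      refine Submodule.span_le.mpr ?_
      rintro _ ⟨l, g, h, rfl⟩
      have hl : l.Perm (l : Multiset ι).sort := by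
        rw [← Multiset.coe_eq_coe, Multiset.sort_eq]
      have h1 := ih (sraFilt_mono (Nat.lt_succ_iff.mp h) (sraWord_perm (Ω := Ω) (b := b) hl g))
      have h2 : sraWord Ω Γ b (l : Multiset ι).sort g ∈
          Submodule.span (SymmetricAlgebra ℂ (Param Γ)) (Set.range (sraMono Ω Γ b)) :=
        Submodule.subset_span ⟨(l, g), rfl⟩
      simpa using add_mem h1 h2
  rw [eq_top_iff]
  intro x _
  obtain ⟨k, hk⟩ := exists_mem_sraFilt (b := b) x
  exact key k hk

theorem vecEnd_rel [Fintype Γ] (hΩ : Ω.IsAlt) (hΓ : Γ ≤ Sp Ω) (u v : V) :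
    vecEnd b (reflDatum hΩ hΓ) u * vecEnd b (reflDatum hΩ hΓ) v -
      vecEnd b (reflDatum hΩ hΓ) v * vecEnd b (reflDatum hΩ hΓ) u =
    Ω u v • algebraMap _ (Module.End (SymmetricAlgebra ℂ (Param Γ))
      (OrdMod ι Γ (SymmetricAlgebra ℂ (Param Γ)))) (tVar Γ) +
      ∑ᶠ s : {s : Γ // IsSymplecticReflection s}, Ω (proj s.1 u) (proj s.1 v) •
        (algebraMap _ (Module.End (SymmetricAlgebra ℂ (Param Γ))
      (OrdMod ι Γ (SymmetricAlgebra ℂ (Param Γ))))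
          (cVar (reflectionClass s)) * grpEnd b (reflDatum hΩ hΓ) s.1) := by
  have h := sum_refl (M := Module.End (SymmetricAlgebra ℂ (Param Γ))
      (OrdMod ι Γ (SymmetricAlgebra ℂ (Param Γ)))) Ω
    (fun s c => c • grpEnd b (reflDatum hΩ hΓ) s) (fun s => zero_smul _ _) u v
  rw [grpEnd_one] at h
  simp only [Algebra.smul_def (R := SymmetricAlgebra ℂ (Param Γ)), mul_one] at h
  refine sub_eq_of_eq_add' (G := Module.End (SymmetricAlgebra ℂ (Param Γ))
    (OrdMod ι Γ (SymmetricAlgebra ℂ (Param Γ)))) ?_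
  rw [← h]
  refine (vecEnd_comm (reflDatum hΩ hΓ) u v).trans ?_
  simp only [commEnd, Algebra.smul_def (R := SymmetricAlgebra ℂ (Param Γ))]
  rfl

variable (b) in
/-- The action of the group on the free module on the ordered monomials. -/
def grpHom [Fintype Γ] {R : Type*} [CommRing R] [Algebra ℂ R] (D : CommutatorDatum Γ R) :
    Γ →* Module.End R (OrdMod ι Γ R) where
  toFun := grpEnd b D
  map_one' := grpEnd_one D
  map_mul' := grpEnd_mul D

variable (b) in
/-- The action of `H` on the free module on the ordered monomials. -/
def ordRep [Fintype Γ] (hΩ : Ω.IsAlt) (hΓ : Γ ≤ Sp Ω) :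
    SRA Ω Γ →ₐ[ℂ] Module.End (SymmetricAlgebra ℂ (Param Γ))
      (OrdMod ι Γ (SymmetricAlgebra ℂ (Param Γ))) :=
  sraLift (A := Module.End (SymmetricAlgebra ℂ (Param Γ))
      (OrdMod ι Γ (SymmetricAlgebra ℂ (Param Γ)))) ((Algebra.ofId (SymmetricAlgebra ℂ (Param Γ)) _).restrictScalars ℂ)
    (fun p a => Algebra.commutes p a) (vecEnd b (reflDatum hΩ hΓ)) (grpHom b (reflDatum hΩ hΓ))
    (grpEnd_vecEnd (reflDatum hΩ hΓ)) (vecEnd_rel hΩ hΓ)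

theorem ordRep_param [Fintype Γ] (hΩ : Ω.IsAlt) (hΓ : Γ ≤ Sp Ω)
    (r : SymmetricAlgebra ℂ (Param Γ)) :
    ordRep b hΩ hΓ (algebraMap _ _ r) = algebraMap _ _ r :=
  sraLift_param _ _ _ _ _ _ r

theorem ordRep_vec [Fintype Γ] (hΩ : Ω.IsAlt) (hΓ : Γ ≤ Sp Ω) (v : V) :
    ordRep b hΩ hΓ (sraVec Ω Γ v) = vecEnd b (reflDatum hΩ hΓ) v :=
  sraLift_vec _ _ _ _ _ _ v

theorem ordRep_grp [Fintype Γ] (hΩ : Ω.IsAlt) (hΓ : Γ ≤ Sp Ω) (g : Γ) :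
    ordRep b hΩ hΓ (sraGrp Ω g) = grpEnd b (reflDatum hΩ hΓ) g :=
  sraLift_grp _ _ _ _ _ _ g

theorem ordRep_mono [Fintype Γ] (hΩ : Ω.IsAlt) (hΓ : Γ ≤ Sp Ω) (p : Multiset ι × Γ) :
    ordRep b hΩ hΓ (sraMono Ω Γ b p) (mono _ 0 1) = Finsupp.single p 1 := by
  have h : ∀ l : List ι, ordRep b hΩ hΓ (l.map fun i => sraVec Ω Γ (b i)).prod =
      (l.map fun i => vecEnd b (reflDatum hΩ hΓ) (b i)).prod := by
    intro l
    rw [map_list_prod, List.map_map]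
    congr 1
    exact List.map_congr_left fun i _ => ordRep_vec hΩ hΓ (b i)
  rw [sraMono, sraWord, map_mul, h, ordRep_grp, Module.End.mul_apply, grpEnd_zero, mul_one]
  exact prod_vecEnd_mono (reflDatum hΩ hΓ) p.1 p.2

/-- Evaluating the representation at the unit monomial is S(p_univ)-linear and carries the ordered
monomials of H to the basis vectors of the free module. -/
theorem linearIndependent_sraMono (hΩ : Ω.IsAlt) (hΓ : Γ ≤ Sp Ω) :
    LinearIndependent (SymmetricAlgebra ℂ (Param Γ)) (sraMono Ω Γ b) := by
  have := Fintype.ofFinite Γ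
  let T : SRA Ω Γ →ₗ[SymmetricAlgebra ℂ (Param Γ)]
      OrdMod ι Γ (SymmetricAlgebra ℂ (Param Γ)) :=
    { toFun := fun h => ordRep b hΩ hΓ h (mono _ 0 1)
      map_add' := fun x y => by rw [map_add, LinearMap.add_apply]
      map_smul' := fun r x => by
        rw [Algebra.smul_def, map_mul, Module.End.mul_apply, ordRep_param]
        rfl }
  apply LinearIndependent.of_comp T
  have : T ∘ sraMono Ω Γ b = fun p => Finsupp.single p 1 := funext (ordRep_mono hΩ hΓ)
  rw [this]
  exact Finsupp.linearIndependent_single_one _ _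

end Basis

/-! ### The reduction modulo the parameters -/

section Reduction

variable {V : Type*} [AddCommGroup V] [Module ℂ V] {Γ : Subgroup (V ≃ₗ[ℂ] V)}

theorem tensorToSym_single (g : Γ) (a : TensorAlgebra ℂ V) :
    tensorToSym Γ (SkewMonoidAlgebra.single g a) =
      SkewMonoidAlgebra.single g (SymmetricAlgebra.algHom ℂ V a) := by
  change SkewMonoidAlgebra.liftNC _ _ (SkewMonoidAlgebra.single g a) = _
  rw [SkewMonoidAlgebra.liftNC_single]
  change SkewMonoidAlgebra.single 1 (SymmetricAlgebra.algHom ℂ V a) *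
    SkewMonoidAlgebra.single g 1 = _
  rw [SkewMonoidAlgebra.single_mul_single]
  simp

variable [FiniteDimensional ℂ V] {Ω : LinearMap.BilinForm ℂ V} [Finite Γ]

theorem sraToSmash_mk (y : SymmetricAlgebra ℂ (Param Γ) ⊗[ℂ] TensorSmash Γ) :
    sraToSmash Ω Γ (mkSRA Ω Γ y) = preToSmash Γ y := by
  unfold sraToSmash mkSRA
  erw [RingQuot.liftAlgHom_mkAlgHom_apply]

theorem sraToSmash_single (p : SymmetricAlgebra ℂ (Param Γ)) (g : Γ) (a : TensorAlgebra ℂ V) :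
    sraToSmash Ω Γ (mkSRA Ω Γ (p ⊗ₜ SkewMonoidAlgebra.single g a)) =
      (SymmetricAlgebra.algebraMapInv p : ℂ) •
        SkewMonoidAlgebra.single g (SymmetricAlgebra.algHom ℂ V a) := by
  rw [sraToSmash_mk, preToSmash_tmul, tensorToSym_single, Algebra.smul_def]
  rfl

theorem sraToSmash_vec (v : V) : sraToSmash Ω Γ (sraVec Ω Γ v) =
    SkewMonoidAlgebra.single 1 (SymmetricAlgebra.ι ℂ V v) := by
  change sraToSmash Ω Γ (mkSRA Ω Γ _) = _
  rw [vec, sraToSmash_single, map_one, one_smul]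
  rfl

theorem sraToSmash_grp (g : Γ) : sraToSmash Ω Γ (sraGrp Ω g) = SkewMonoidAlgebra.single g 1 := by
  change sraToSmash Ω Γ (mkSRA Ω Γ _) = _
  rw [grp, sraToSmash_single, map_one, map_one, one_smul]

theorem sraToSmash_smul (p : SymmetricAlgebra ℂ (Param Γ)) (x : SRA Ω Γ) :
    sraToSmash Ω Γ (p • x) = (SymmetricAlgebra.algebraMapInv p : ℂ) • sraToSmash Ω Γ x := by
  rw [Algebra.smul_def, map_mul, Algebra.smul_def, algebraMap_sra, sraToSmash_mk, preToSmash_tmul,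
    map_one, mul_one]
  rfl

variable {ι : Type*} [LinearOrder ι] (b : Module.Basis ι ℂ V)

theorem prod_map_ι (α : Multiset ι) :
    (α.map fun i => SymmetricAlgebra.ι ℂ V (b i)).prod =
      b.symmetricAlgebra (Multiset.toFinsupp α) := by
  rw [Module.Basis.symmetricAlgebra, Module.Basis.map_apply, MvPolynomial.coe_basisMonomials]
  have h : MvPolynomial.monomial (Multiset.toFinsupp α) (1 : ℂ) =
      (α.map fun i => MvPolynomial.X i).prod := by
    induction α using Multiset.induction_on with
    | empty => simp
    | cons a s ih =>
      rw [Multiset.map_cons, Multiset.prod_cons, ← ih, MvPolynomial.X, MvPolynomial.monomial_mul,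
        ← Multiset.singleton_add, map_add, Multiset.toFinsupp_singleton, one_mul]
  change _ = (SymmetricAlgebra.equivMvPolynomial b).symm (MvPolynomial.monomial _ (1 : ℂ))
  rw [h, map_multiset_prod, Multiset.map_map]
  simp

theorem sraToSmash_mono (p : Multiset ι × Γ) :
    sraToSmash Ω Γ (sraMono Ω Γ b p) =
      SkewMonoidAlgebra.single p.2 (b.symmetricAlgebra (Multiset.toFinsupp p.1)) := by
  have h : ∀ l : List ι, sraToSmash Ω Γ ((l.map fun i => sraVec Ω Γ (b i)).prod) =
      symIncl Γ ((l.map fun i => SymmetricAlgebra.ι ℂ V (b i)).prod) := by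
    intro l
    rw [map_list_prod, map_list_prod, List.map_map, List.map_map]
    congr 1
    refine List.map_congr_left fun i _ => sraToSmash_vec (b i)
  rw [sraMono, sraWord, map_mul, h, sraToSmash_grp, ← prod_map_ι, ← Multiset.prod_coe,
    ← Multiset.map_coe, Multiset.sort_eq]
  change SkewMonoidAlgebra.single 1 _ * _ = _
  rw [SkewMonoidAlgebra.single_mul_single]
  simp

/-- Modulo the parameters the ordered monomials become the usual monomial basis of S(V)#Γ. This
serves both to compute the kernel of `sraToSmash` and, later, to prove injectivity of the comparison
with an arbitrary deformation. -/
theorem linearIndependent_sraToSmash_mono :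
    LinearIndependent ℂ fun p : Multiset ι × Γ => sraToSmash Ω Γ (sraMono Ω Γ b p) := by
  have h1 : LinearIndependent ℂ fun α : Multiset ι =>
      b.symmetricAlgebra (Multiset.toFinsupp α) :=
    b.symmetricAlgebra.linearIndependent.comp _ Multiset.toFinsupp.injective
  have h2 := Finsupp.linearIndependent_single (ι := Γ) (fun _ => _) (fun _ => h1)
  let e : Multiset ι × Γ → Σ _ : Γ, Multiset ι := fun p => ⟨p.2, p.1⟩
  have he : Function.Injective e := by
    rintro ⟨α, g⟩ ⟨β, h⟩ hh
    simp only [e, Sigma.mk.injEq, heq_eq_eq] at hh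
    rw [hh.1, hh.2]
  have h3 := (h2.comp e he).map' (SkewMonoidAlgebra.coeffLinearEquiv (S := ℂ)).symm.toLinearMap
    (LinearEquiv.ker _)
  have h4 : (fun p : Multiset ι × Γ => sraToSmash Ω Γ (sraMono Ω Γ b p)) =
      (SkewMonoidAlgebra.coeffLinearEquiv (S := ℂ)).symm.toLinearMap ∘ (fun ix : Σ _ : Γ, Multiset ι =>
        Finsupp.single ix.1 (b.symmetricAlgebra (Multiset.toFinsupp ix.2))) ∘ e :=
    funext fun p => sraToSmash_mono b p
  rw [h4]
  exact h3

end Reduction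

/-! ### Gradings -/

section Gradings

/-- Degrees are detected by scaling the generators, which reduces independence of graded pieces to
independence of eigenspaces. -/
theorem lift_smul_of_mem_pow {V A : Type*} [AddCommGroup V] [Module ℂ V] [Ring A] [Algebra ℂ A]
    (c : ℂ) (x : V →ₗ[ℂ] A) {k : ℕ} {a : TensorAlgebra ℂ V} (ha : a ∈ tensorPow V k) :
    TensorAlgebra.lift ℂ (c • x) a = c ^ k • TensorAlgebra.lift ℂ x a := by
  refine Submodule.pow_induction_on_left' (M := LinearMap.range (TensorAlgebra.ι ℂ (M := V)))
    (C := fun k a _ => TensorAlgebra.lift ℂ (c • x) a = c ^ k • TensorAlgebra.lift ℂ x a)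
    ?_ ?_ ?_ ha
  · intro r
    simp
  · intro a b i _ _ h h'
    rw [map_add, map_add, h, h', smul_add]
  · rintro _ ⟨v, rfl⟩ i a _ h
    rw [map_mul, map_mul, h, TensorAlgebra.lift_ι_apply, TensorAlgebra.lift_ι_apply,
      LinearMap.smul_apply, smul_mul_smul_comm, pow_succ']

theorem symLift_smul_of_mem_pow {P A : Type*} [AddCommGroup P] [Module ℂ P] [CommRing A]
    [Algebra ℂ A] (c : ℂ) (x : P →ₗ[ℂ] A) {k : ℕ} {a : SymmetricAlgebra ℂ P} (ha : a ∈ symPow P k) :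
    SymmetricAlgebra.lift (c • x) a = c ^ k • SymmetricAlgebra.lift x a := by
  refine Submodule.pow_induction_on_left' (M := LinearMap.range (SymmetricAlgebra.ι ℂ P))
    (C := fun k a _ => SymmetricAlgebra.lift (c • x) a = c ^ k • SymmetricAlgebra.lift x a)
    ?_ ?_ ?_ ha
  · intro r
    simp
  · intro a b i _ _ h h'
    rw [map_add, map_add, h, h', smul_add]
  · rintro _ ⟨v, rfl⟩ i a _ h
    rw [map_mul, map_mul, h, SymmetricAlgebra.lift_ι_apply, SymmetricAlgebra.lift_ι_apply,
      LinearMap.smul_apply, smul_mul_smul_comm, pow_succ']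

theorem algebraMapInv_of_mem_pow {P : Type*} [AddCommGroup P] [Module ℂ P] {k : ℕ} (hk : k ≠ 0)
    {a : SymmetricAlgebra ℂ P} (ha : a ∈ symPow P k) :
    (SymmetricAlgebra.algebraMapInv a : ℂ) = 0 := by
  -- The augmentation is the lift of the zero map, and scaling by c = 0 multiplies degree k by 0^k,
  -- which vanishes for k ≠ 0.
  have h := symLift_smul_of_mem_pow (0 : ℂ) (0 : P →ₗ[ℂ] ℂ) ha
  rw [smul_zero, zero_pow hk, zero_smul] at h
  exact h

theorem algHom_mem_symPow {V : Type*} [AddCommGroup V] [Module ℂ V] {k : ℕ} {a : TensorAlgebra ℂ V}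
    (ha : a ∈ tensorPow V k) : SymmetricAlgebra.algHom ℂ V a ∈ symPow V k := by
  have : (tensorPow V k).map (SymmetricAlgebra.algHom ℂ V).toLinearMap = symPow V k := by
    rw [tensorPow, symPow, Submodule.map_pow, ← LinearMap.range_comp]
    rfl
  rw [← this]
  exact Submodule.mem_map_of_mem ha

theorem smul_mem_tensorPow {V : Type*} [AddCommGroup V] [Module ℂ V]
    {Γ : Subgroup (V ≃ₗ[ℂ] V)} (g : Γ) {k : ℕ} {a : TensorAlgebra ℂ V} (ha : a ∈ tensorPow V k) :
    g • a ∈ tensorPow V k := by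
  have : (tensorPow V k).map (TensorAlgebra.lift ℂ
      (TensorAlgebra.ι ℂ ∘ₗ ((g : V ≃ₗ[ℂ] V) : V →ₗ[ℂ] V))).toLinearMap ≤ tensorPow V k := by
    rw [tensorPow, Submodule.map_pow, ← LinearMap.range_comp]
    refine pow_le_pow_left' ?_ k
    rintro _ ⟨v, rfl⟩
    simp
  exact this (Submodule.mem_map_of_mem ha)

/-- A family of subspaces on which an operator acts by distinct powers of `2` is independent. -/
theorem iSupIndep_of_scaling {M : Type*} [AddCommGroup M] [Module ℂ M] (𝒜 : ℤ → Submodule ℂ M)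
    (φ : Module.End ℂ M) (h : ∀ n, ∀ x ∈ 𝒜 n, φ x = (2 : ℂ) ^ n • x) : iSupIndep 𝒜 := by
  have hinj : Function.Injective fun n : ℤ => (2 : ℂ) ^ n := by
    intro m n hmn
    have h' : ((2 : ℝ) ^ m : ℝ) = 2 ^ n := by
      have : (((2 : ℝ) ^ m : ℝ) : ℂ) = ((2 ^ n : ℝ) : ℂ) := by push_cast; exact hmn
      exact_mod_cast this
    exact zpow_right_injective₀ (by norm_num) (by norm_num) h'
  exact ((Module.End.eigenspaces_iSupIndep φ).comp hinj).mono fun n x hx =>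
    Module.End.mem_eigenspace_iff.mpr (h n x hx)

/-- The degrees of a graded algebra span it if they span a set of generators. -/
theorem iSup_mul_mem {A : Type*} [Ring A] [Algebra ℂ A] (𝒜 : ℤ → Submodule ℂ A)
    [SetLike.GradedMonoid 𝒜] {x y : A} (hx : x ∈ ⨆ n, 𝒜 n) (hy : y ∈ ⨆ n, 𝒜 n) :
    x * y ∈ ⨆ n, 𝒜 n := by
  induction hx using Submodule.iSup_induction' with
  | mem i x hx =>
    induction hy using Submodule.iSup_induction' with
    | mem j y hy => exact Submodule.mem_iSup_of_mem (i + j) (SetLike.mul_mem_graded hx hy)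
    | zero => simp
    | add y y' _ _ h h' => rw [mul_add]; exact add_mem h h'
  | zero => simp
  | add x x' _ _ h h' => rw [add_mul]; exact add_mem h h'

variable {V : Type*} [AddCommGroup V] [Module ℂ V] (Γ : Subgroup (V ≃ₗ[ℂ] V))

theorem smashGrading_of_neg {n : ℤ} (hn : n < 0) : smashGrading Γ n = ⊥ := by
  rw [smashGrading, Submodule.span_eq_bot]
  rintro _ ⟨k, a, g, -, hk, -⟩
  omega

/-- Doubling V inside each coefficient in S(V) acts on degree n by 2^n. -/
theorem iSupIndep_smashGrading : iSupIndep (smashGrading Γ) := by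
  let e := SkewMonoidAlgebra.coeffLinearEquiv (S := ℂ) (k := SymmetricAlgebra ℂ V) (G := Γ)
  let σ : SymmetricAlgebra ℂ V →ₗ[ℂ] SymmetricAlgebra ℂ V :=
    (SymmetricAlgebra.lift ((2 : ℂ) • SymmetricAlgebra.ι ℂ V)).toLinearMap
  let φ : Module.End ℂ (SymSmash Γ) :=
    e.symm.toLinearMap ∘ₗ Finsupp.mapRange.linearMap σ ∘ₗ e.toLinearMap
  refine iSupIndep_of_scaling _ φ fun n x hx => ?_
  have hle : smashGrading Γ n ≤ φ.eigenspace ((2 : ℂ) ^ n) := by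
    refine Submodule.span_le.mpr ?_
    rintro _ ⟨k, a, g, ha, rfl, rfl⟩
    refine Module.End.mem_eigenspace_iff.mpr ?_
    have h1 : φ (SkewMonoidAlgebra.single g a) = SkewMonoidAlgebra.single g (σ a) := by
      change e.symm (Finsupp.mapRange.linearMap σ (Finsupp.single g a)) = _
      rw [Finsupp.mapRange.linearMap_apply, Finsupp.mapRange_single]
      rfl
    have h2 : σ a = (2 : ℂ) ^ k • a := by
      have := symLift_smul_of_mem_pow (2 : ℂ) (SymmetricAlgebra.ι ℂ V) ha
      rwa [SymmetricAlgebra.lift_ι] at this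
    rw [h1, h2, ← SkewMonoidAlgebra.smul_single, zpow_natCast]
  exact Module.End.mem_eigenspace_iff.mp (hle hx)

end Gradings

/-! ### The grading of H and the proof of flatness. -/

section Flat

variable {V : Type*} [AddCommGroup V] [Module ℂ V] [FiniteDimensional ℂ V]
  {Ω : LinearMap.BilinForm ℂ V} {Γ : Subgroup (V ≃ₗ[ℂ] V)} [Finite Γ]

theorem mk_mem_sraGrading {j k : ℕ} {p : SymmetricAlgebra ℂ (Param Γ)} {a : TensorAlgebra ℂ V}
    (hp : p ∈ symPow (Param Γ) j) (ha : a ∈ tensorPow V k) (g : Γ) :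
    mkSRA Ω Γ (p ⊗ₜ[ℂ] SkewMonoidAlgebra.single g a) ∈ sraGrading Ω Γ (2 * j + k) :=
  Submodule.subset_span ⟨j, k, p, a, g, hp, ha, rfl, rfl⟩

theorem one_mem_symPow {P : Type*} [AddCommGroup P] [Module ℂ P] : 1 ∈ symPow P 0 := by
  rw [symPow, pow_zero]
  exact Submodule.one_le.mp le_rfl

theorem ι_mem_symPow {P : Type*} [AddCommGroup P] [Module ℂ P] (p : P) :
    SymmetricAlgebra.ι ℂ P p ∈ symPow P 1 := by
  rw [symPow, pow_one]
  exact ⟨p, rfl⟩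

theorem one_mem_tensorPow : 1 ∈ tensorPow V 0 := by
  rw [tensorPow, pow_zero]
  exact Submodule.one_le.mp le_rfl

theorem ι_mem_tensorPow (v : V) : TensorAlgebra.ι ℂ v ∈ tensorPow V 1 := by
  rw [tensorPow, pow_one]
  exact ⟨v, rfl⟩

theorem sraVec_mem (v : V) : sraVec Ω Γ v ∈ sraGrading Ω Γ 1 := by
  have h := mk_mem_sraGrading (Ω := Ω) one_mem_symPow (ι_mem_tensorPow v) (1 : Γ)
  rwa [Nat.cast_zero, mul_zero, zero_add, Nat.cast_one] at h

theorem sraGrp_mem (g : Γ) : sraGrp Ω g ∈ sraGrading Ω Γ 0 := by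
  have h := mk_mem_sraGrading (Ω := Ω) one_mem_symPow one_mem_tensorPow g
  rwa [Nat.cast_zero, mul_zero, zero_add] at h

theorem sraParam_mem (p : Param Γ) : algebraMap (SymmetricAlgebra ℂ (Param Γ)) (SRA Ω Γ)
    (SymmetricAlgebra.ι ℂ (Param Γ) p) ∈ sraGrading Ω Γ 2 := by
  rw [algebraMap_sra]
  simpa using mk_mem_sraGrading (Ω := Ω) (ι_mem_symPow p) one_mem_tensorPow (1 : Γ)

instance : SetLike.GradedMonoid (sraGrading Ω Γ) where
  one_mem := by
    simpa using sraGrp_mem (Ω := Ω) (1 : Γ)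
  mul_mem m n x y hx hy := by
    refine Submodule.span_induction₂ (p := fun x y _ _ => x * y ∈ sraGrading Ω Γ (m + n))
      ?_ ?_ ?_ ?_ ?_ ?_ ?_ hx hy
    · rintro _ _ ⟨j, k, p, a, g, hp, ha, rfl, rfl⟩ ⟨j', k', p', a', g', hp', ha', rfl, rfl⟩
      rw [← map_mul, Algebra.TensorProduct.tmul_mul_tmul, SkewMonoidAlgebra.single_mul_single]
      have h1 : p * p' ∈ symPow (Param Γ) (j + j') := by
        rw [symPow, pow_add]
        exact Submodule.mul_mem_mul hp hp'
      have h2 : a * g • a' ∈ tensorPow V (k + k') := by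
        rw [tensorPow, pow_add]
        exact Submodule.mul_mem_mul ha (smul_mem_tensorPow g ha')
      convert mk_mem_sraGrading (Ω := Ω) h1 h2 (g * g') using 2
      push_cast
      ring
    · intro y _; simp
    · intro x _; simp
    · intro x x' y _ _ _ h h'
      rw [add_mul]; exact add_mem h h'
    · intro x y y' _ _ _ h h'
      rw [mul_add]; exact add_mem h h'
    · intro c x y _ _ h
      rw [smul_mul_assoc]; exact Submodule.smul_mem _ c h
    · intro c x y _ _ h
      rw [mul_smul_comm]; exact Submodule.smul_mem _ c h

theorem iSup_sraGrading : ⨆ n, sraGrading Ω Γ n = ⊤ := by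
  rw [eq_top_iff]
  rintro x -
  induction x using SRA.induction with
  | param r =>
    induction r using SymmetricAlgebra.induction with
    | algebraMap c =>
      rw [← IsScalarTower.algebraMap_apply, Algebra.algebraMap_eq_smul_one]
      exact Submodule.smul_mem _ _
        (Submodule.mem_iSup_of_mem 0 (SetLike.GradedOne.one_mem (A := sraGrading Ω Γ)))
    | ι p => exact Submodule.mem_iSup_of_mem 2 (sraParam_mem p)
    | mul p q hp hq => rw [map_mul]; exact iSup_mul_mem _ hp hq
    | add p q hp hq => rw [map_add]; exact add_mem hp hq
  | vec v => exact Submodule.mem_iSup_of_mem 1 (sraVec_mem v)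
  | grp g => exact Submodule.mem_iSup_of_mem 0 (sraGrp_mem g)
  | mul x y hx hy => exact iSup_mul_mem _ hx hy
  | add x y hx hy => exact add_mem hx hy

variable (Ω Γ) in
/-- The automorphism of `H` which acts on degree `n` by `2 ^ n`. -/
def sraScale : SRA Ω Γ →ₐ[ℂ] SRA Ω Γ :=
  sraLift (((Algebra.ofId (SymmetricAlgebra ℂ (Param Γ)) (SRA Ω Γ)).restrictScalars ℂ).comp
      -- Parameters have degree 2 and are therefore scaled by 4 = 2²; with V scaled by 2, both sides
      -- of the defining relation are multiplied by 4.
      (SymmetricAlgebra.lift ((4 : ℂ) • SymmetricAlgebra.ι ℂ (Param Γ))))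
    (fun p a => Algebra.commutes
      (SymmetricAlgebra.lift ((4 : ℂ) • SymmetricAlgebra.ι ℂ (Param Γ)) p) a) ((2 : ℂ) • sraVec Ω Γ) (sraGrp Ω)
    (fun g v => by
      rw [LinearMap.smul_apply, LinearMap.smul_apply, mul_smul_comm, sraGrp_mul_sraVec,
        smul_mul_assoc])
    (fun u v => by
      have hfin : Finite {s : Γ // IsSymplecticReflection s} := inferInstance
      have h4 : ∀ p, (((Algebra.ofId (SymmetricAlgebra ℂ (Param Γ)) (SRA Ω Γ)).restrictScalars
          ℂ).comp (SymmetricAlgebra.lift ((4 : ℂ) • SymmetricAlgebra.ι ℂ (Param Γ))))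
            (SymmetricAlgebra.ι ℂ (Param Γ) p) = (4 : ℂ) • algebraMap _ (SRA Ω Γ)
              (SymmetricAlgebra.ι ℂ (Param Γ) p) := by
        intro p
        rw [AlgHom.comp_apply, SymmetricAlgebra.lift_ι_apply, LinearMap.smul_apply, map_smul]
        rfl
      simp only [LinearMap.smul_apply, smul_mul_smul_comm, tVar, cVar, h4]
      rw [← smul_sub, sraVec_comm, smul_add, smul_finsum' _ (Set.toFinite _), smul_comm]
      norm_num only [tVar, cVar]
      congr 1
      refine finsum_congr fun s => ?_
      rw [smul_mul_assoc, smul_comm])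

theorem algebraMap_smul_param {P A : Type*} [AddCommGroup P] [Module ℂ P] [Ring A] [Algebra ℂ A]
    [Algebra (SymmetricAlgebra ℂ P) A] [IsScalarTower ℂ (SymmetricAlgebra ℂ P) A] (c : ℂ)
    (p : SymmetricAlgebra ℂ P) : algebraMap (SymmetricAlgebra ℂ P) A (c • p) =
      c • algebraMap (SymmetricAlgebra ℂ P) A p := by
  rw [Algebra.smul_def, map_mul, ← IsScalarTower.algebraMap_apply, ← Algebra.smul_def]

theorem sraScale_single (p : SymmetricAlgebra ℂ (Param Γ)) (g : Γ) (a : TensorAlgebra ℂ V) :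
    sraScale Ω Γ (mkSRA Ω Γ (p ⊗ₜ SkewMonoidAlgebra.single g a)) =
      algebraMap _ (SRA Ω Γ) (SymmetricAlgebra.lift ((4 : ℂ) • SymmetricAlgebra.ι ℂ (Param Γ)) p) *
        (TensorAlgebra.lift ℂ ((2 : ℂ) • sraVec Ω Γ) a * sraGrp Ω g) :=
  (sraLift_mk _ _ _ _ _ _ p _).trans (congrArg _ (tensorSmashLift_single _ _ _ g a))

theorem sraScale_of_mem {n : ℤ} {x : SRA Ω Γ} (hx : x ∈ sraGrading Ω Γ n) :
    sraScale Ω Γ x = (2 : ℂ) ^ n • x := by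
  have hle : sraGrading Ω Γ n ≤
      Module.End.eigenspace (sraScale Ω Γ).toLinearMap ((2 : ℂ) ^ n) := by
    refine Submodule.span_le.mpr ?_
    rintro _ ⟨j, k, p, a, g, hp, ha, rfl, rfl⟩
    refine Module.End.mem_eigenspace_iff.mpr ?_
    rw [AlgHom.toLinearMap_apply]
    rw [sraScale_single, lift_smul_of_mem_pow _ _ ha, symLift_smul_of_mem_pow _ _ hp,
      SymmetricAlgebra.lift_ι, AlgHom.id_apply, algebraMap_smul_param]
    rw [mkSRA_single, Algebra.smul_def p, smul_mul_assoc, smul_mul_assoc, mul_smul_comm, smul_smul]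
    congr 1
    rw [show (4 : ℂ) = 2 ^ 2 by norm_num, ← pow_mul, ← pow_add]
    norm_cast
  exact Module.End.mem_eigenspace_iff.mp (hle hx)

theorem isInternal_sraGrading : DirectSum.IsInternal (sraGrading Ω Γ) := by
  rw [DirectSum.isInternal_submodule_iff_iSupIndep_and_iSup_eq_top]
  exact ⟨iSupIndep_of_scaling _ (sraScale Ω Γ).toLinearMap fun n x hx => sraScale_of_mem hx,
    iSup_sraGrading⟩

theorem sraToSmash_mem {n : ℤ} {x : SRA Ω Γ} (hx : x ∈ sraGrading Ω Γ n) :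
    sraToSmash Ω Γ x ∈ smashGrading Γ n := by
  have hle : sraGrading Ω Γ n ≤ (smashGrading Γ n).comap (sraToSmash Ω Γ).toLinearMap := by
    refine Submodule.span_le.mpr ?_
    rintro _ ⟨j, k, p, a, g, hp, ha, rfl, rfl⟩
    change sraToSmash Ω Γ _ ∈ smashGrading Γ _
    rw [sraToSmash_single]
    by_cases hj : j = 0
    · subst hj
      refine Submodule.smul_mem _ _ (Submodule.subset_span ⟨k, _, g, algHom_mem_symPow ha, ?_, rfl⟩)
      simp
    · rw [algebraMapInv_of_mem_pow hj hp]
      have h0 : (0 : ℂ) • SkewMonoidAlgebra.single g (SymmetricAlgebra.algHom ℂ V a) = 0 :=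
        zero_smul ℂ (SkewMonoidAlgebra.single g (SymmetricAlgebra.algHom ℂ V a))
      rw [h0]
      exact zero_mem _
  exact hle hx

/-- An element of `S(P)` without constant term lies in the ideal generated by `P`. -/
theorem mem_span_of_algebraMapInv {P : Type*} [AddCommGroup P] [Module ℂ P]
    {p : SymmetricAlgebra ℂ P} (hp : (SymmetricAlgebra.algebraMapInv p : ℂ) = 0) :
    p ∈ Ideal.span (Set.range (SymmetricAlgebra.ι ℂ P)) := by
  have key : ∀ p : SymmetricAlgebra ℂ P,
      p - algebraMap ℂ _ (SymmetricAlgebra.algebraMapInv p : ℂ) ∈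
        Ideal.span (Set.range (SymmetricAlgebra.ι ℂ P)) := by
    intro p
    induction p using SymmetricAlgebra.induction with
    | algebraMap r => simp
    | ι x =>
      rw [SymmetricAlgebra.algebraMapInv_ι, map_zero, sub_zero]
      exact Ideal.subset_span ⟨x, rfl⟩
    | mul a b ha hb =>
      rw [map_mul, map_mul]
      have := add_mem (Ideal.mul_mem_right b _ ha)
        (Ideal.mul_mem_left _ (algebraMap ℂ _ (SymmetricAlgebra.algebraMapInv a : ℂ)) hb)
      convert this using 1
      ring
    | add a b ha hb =>
      rw [map_add, map_add]
      convert add_mem ha hb using 1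
      ring
  simpa [hp] using key p

theorem algebraMap_mul_mem_span {P A : Type*} [AddCommGroup P] [Module ℂ P] [Ring A]
    [Algebra (SymmetricAlgebra ℂ P) A] {p : SymmetricAlgebra ℂ P}
    (hp : (SymmetricAlgebra.algebraMapInv p : ℂ) = 0) (x : A) :
    p • x ∈ Ideal.span (Set.range fun p : P =>
      algebraMap (SymmetricAlgebra ℂ P) A (SymmetricAlgebra.ι ℂ P p)) := by
  rw [Algebra.smul_def, Algebra.commutes]
  refine Ideal.mul_mem_left _ x ?_
  have h := mem_span_of_algebraMapInv hp
  clear hp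
  induction h using Submodule.span_induction with
  | mem y hy =>
    obtain ⟨q, rfl⟩ := hy
    exact Ideal.subset_span ⟨q, rfl⟩
  | zero => simp
  | add a b _ _ ha hb => rw [map_add]; exact add_mem ha hb
  | smul a b _ hb => rw [smul_eq_mul, map_mul]; exact Ideal.mul_mem_left _ _ hb

theorem exists_basis_repr {S M κ : Type*} [CommRing S] [AddCommGroup M] [Module S M] {x : κ → M}
    (h : Submodule.span S (Set.range x) = ⊤) (m : M) :
    ∃ c : κ →₀ S, m = c.sum fun i r => r • x i := by
  have : m ∈ Submodule.span S (Set.range x) := h ▸ Submodule.mem_top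
  obtain ⟨c, hc⟩ := Finsupp.mem_span_range_iff_exists_finsupp.mp this
  exact ⟨c, hc.symm⟩

/-- The ordered monomials form the homogeneous basis. Since they remain independent modulo the
parameters, an element killed by `sraToSmash` has all its coefficients in the augmentation ideal of
S(p_univ). -/
theorem sra_isGradedFlatDeformation (hΩ : Ω.IsAlt) (hΓ : Γ ≤ Sp Ω) :
    IsGradedFlatDeformation Γ (P := Param Γ) (A := SRA Ω Γ)
      (sraGrading Ω Γ) (sraToSmash Ω Γ) where
  gradedMonoid := inferInstance
  isInternal := isInternal_sraGrading
  param_mem := sraParam_mem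
  free := by
    let b := Module.finBasis ℂ V
    refine ⟨Set.range (sraMono Ω Γ b), ?_, (linearIndependent_sraMono hΩ hΓ).linearIndepOn_id,
      span_sraMono⟩
    rintro _ ⟨p, rfl⟩
    have h : ∀ l : List (Fin (Module.finrank ℂ V)),
        (l.map fun i => sraVec Ω Γ (b i)).prod ∈ sraGrading Ω Γ l.length := by
      intro l
      induction l with
      | nil => exact SetLike.GradedOne.one_mem (A := sraGrading Ω Γ)
      | cons i l ih =>
        rw [List.map_cons, List.prod_cons, List.length_cons, Nat.cast_succ, add_comm]
        exact SetLike.mul_mem_graded (sraVec_mem _) ih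
    exact ⟨_, SetLike.mul_mem_graded (h _) (sraGrp_mem _)⟩
  surjective y := by
    induction y using SkewMonoidAlgebra.induction_on with
    | zero => exact ⟨0, map_zero _⟩
    | single g a =>
      obtain ⟨a', rfl⟩ := SymmetricAlgebra.algHom_surjective ℂ V a
      refine ⟨mkSRA Ω Γ (1 ⊗ₜ SkewMonoidAlgebra.single g a'), ?_⟩
      rw [sraToSmash_single, map_one, one_smul]
    | add a b ha hb =>
      obtain ⟨x, rfl⟩ := ha
      obtain ⟨y, rfl⟩ := hb
      exact ⟨x + y, map_add _ _ _⟩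
  map_mem n a ha := sraToSmash_mem ha
  ker_eq := by
    let b := Module.finBasis ℂ V
    apply le_antisymm
    · intro x hx
      obtain ⟨c, hc⟩ := exists_basis_repr (span_sraMono (Ω := Ω) (b := b)) x
      have h1 : c.sum (fun p r => (SymmetricAlgebra.algebraMapInv r : ℂ) •
          sraToSmash Ω Γ (sraMono Ω Γ b p)) = 0 := by
        rw [← RingHom.mem_ker.mp hx, hc, Finsupp.sum, Finsupp.sum, map_sum]
        exact Finset.sum_congr rfl fun p _ => (sraToSmash_smul _ _).symm
      -- The constant terms of the coefficients give a relation among the basis elements of S(V)#Γ,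
      -- so they all vanish.
      have h2 := linearIndependent_iff'.mp (linearIndependent_sraToSmash_mono (Ω := Ω) b)
        c.support (fun p => SymmetricAlgebra.algebraMapInv (c p)) h1
      rw [hc]
      exact Submodule.sum_mem _ fun p hp => algebraMap_mul_mem_span (h2 p hp) _
    · refine Ideal.span_le.mpr ?_
      rintro _ ⟨p, rfl⟩
      change sraToSmash Ω Γ (algebraMap _ _ (SymmetricAlgebra.ι ℂ (Param Γ) p)) = 0
      rw [← mul_one (algebraMap _ _ _), ← Algebra.smul_def, sraToSmash_smul,
        SymmetricAlgebra.algebraMapInv_ι]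
      exact zero_smul ℂ (sraToSmash Ω Γ 1)

end Flat

/-! ### Homogeneous components of elements of the symmetric algebra -/

section Components

variable {P : Type*} [AddCommGroup P] [Module ℂ P]

variable (P) in
/-- The homomorphism `S(P) → S(P)[X]` with `p ↦ p X` for `p ∈ P`: the coefficient of `X ^ m` is the
homogeneous component of degree `m`. -/
def symComponents : SymmetricAlgebra ℂ P →ₐ[ℂ] Polynomial (SymmetricAlgebra ℂ P) :=
  SymmetricAlgebra.lift
    ((Polynomial.monomial (R := SymmetricAlgebra ℂ P) 1).restrictScalars ℂ ∘ₗ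
      SymmetricAlgebra.ι ℂ P)

theorem symComponents_ι (p : P) : symComponents P (SymmetricAlgebra.ι ℂ P p) =
    Polynomial.monomial 1 (SymmetricAlgebra.ι ℂ P p) := by
  rw [symComponents, SymmetricAlgebra.lift_ι_apply]
  rfl

theorem eval_symComponents (q : SymmetricAlgebra ℂ P) : (symComponents P q).eval 1 = q := by
  induction q using SymmetricAlgebra.induction with
  | algebraMap r => simp [Polynomial.algebraMap_apply]
  | ι p => simp [symComponents_ι]
  | mul a b ha hb => rw [map_mul, Polynomial.eval_mul, ha, hb]
  | add a b ha hb => rw [map_add, Polynomial.eval_add, ha, hb]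

theorem eq_zero_of_symComponents {q : SymmetricAlgebra ℂ P}
    (h : ∀ m, (symComponents P q).coeff m = 0) : q = 0 := by
  have : symComponents P q = 0 := Polynomial.ext (by simpa using h)
  rw [← eval_symComponents q, this, Polynomial.eval_zero]

theorem coeff_zero_symComponents (q : SymmetricAlgebra ℂ P) :
    (symComponents P q).coeff 0 = algebraMap ℂ _ (SymmetricAlgebra.algebraMapInv q : ℂ) := by
  induction q using SymmetricAlgebra.induction with
  | algebraMap r => simp [Polynomial.algebraMap_apply]
  | ι p => simp [symComponents_ι, SymmetricAlgebra.algebraMapInv_ι, Polynomial.coeff_monomial]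
  | mul a b ha hb => rw [map_mul, Polynomial.mul_coeff_zero, ha, hb, map_mul, map_mul]
  | add a b ha hb => rw [map_add, Polynomial.coeff_add, ha, hb, map_add, map_add]

/-- The leading component of a product. -/
theorem coeff_symComponents_mul {q : SymmetricAlgebra ℂ P} {m : ℕ}
    (hq : ∀ a < m, (symComponents P q).coeff a = 0) (r : SymmetricAlgebra ℂ P) :
    (symComponents P (q * r)).coeff m =
      (SymmetricAlgebra.algebraMapInv r : ℂ) • (symComponents P q).coeff m := by
  rw [map_mul, Polynomial.coeff_mul, Finset.sum_eq_single (m, 0)]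
  · rw [coeff_zero_symComponents, mul_comm, ← Algebra.smul_def]
  · rintro ⟨i, j⟩ hij hne
    have h := Finset.HasAntidiagonal.mem_antidiagonal.mp hij
    simp only at h
    have : i < m := by
      rcases Nat.eq_zero_or_pos j with rfl | hj
      · exact absurd (by rw [← h, add_zero]) hne
      · omega
    rw [hq i this, zero_mul]
  · intro h
    simp at h

end Components

/-! ### Independent families of subspaces -/

/-- Membership in a sum of graded subspaces can be localized to one degree; the remaining components
of x lie both in degree n and in the sum of the other degrees, hence vanish. -/
theorem mem_of_mem_iSup {M : Type*} [AddCommGroup M] [Module ℂ M] {𝒜 ℳ : ℤ → Submodule ℂ M}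
    (hind : iSupIndep 𝒜) (hle : ∀ n, ℳ n ≤ 𝒜 n) {n : ℤ} {x : M} (hx : x ∈ 𝒜 n)
    (hx' : x ∈ ⨆ n, ℳ n) : x ∈ ℳ n := by
  rw [iSup_split_single ℳ n] at hx'
  obtain ⟨u, hu, v, hv, rfl⟩ := Submodule.mem_sup.mp hx'
  have h1 : v ∈ 𝒜 n := by
    have := sub_mem hx (hle n hu)
    rwa [add_sub_cancel_left] at this
  have h2 : v ∈ ⨆ (j) (_ : j ≠ n), 𝒜 j :=
    (iSup_mono fun j => iSup_mono fun _ => hle j) hv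
  rw [Submodule.disjoint_def.mp (hind n) v h1 h2, add_zero]
  exact hu

/-! ### Properties of graded flat deformations -/

namespace IsGradedFlatDeformation

variable {V : Type*} [AddCommGroup V] [Module ℂ V] {Γ : Subgroup (V ≃ₗ[ℂ] V)}
  {P A : Type*} [AddCommGroup P] [Module ℂ P] [Ring A]
  [Algebra ℂ A] [Algebra (SymmetricAlgebra ℂ P) A] [IsScalarTower ℂ (SymmetricAlgebra ℂ P) A]
  {𝒜 : ℤ → Submodule ℂ A} {π : A →ₐ[ℂ] SymSmash Γ} (F : IsGradedFlatDeformation Γ (P := P) 𝒜 π)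

include F

theorem map_param (p : P) :
    π (algebraMap (SymmetricAlgebra ℂ P) A (SymmetricAlgebra.ι ℂ P p)) = 0 := by
  rw [← RingHom.mem_ker, F.ker_eq]
  exact Ideal.subset_span ⟨p, rfl⟩

theorem map_smul (q : SymmetricAlgebra ℂ P) (x : A) :
    π (q • x) = (SymmetricAlgebra.algebraMapInv q : ℂ) • π x := by
  have h : π (algebraMap _ A q) = algebraMap ℂ _ (SymmetricAlgebra.algebraMapInv q : ℂ) := by
    induction q using SymmetricAlgebra.induction with
    | algebraMap r =>
      rw [← IsScalarTower.algebraMap_apply, AlgHom.commutes, AlgHom.commutes]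
      rfl
    | ι p => rw [F.map_param, SymmetricAlgebra.algebraMapInv_ι, map_zero]
    | mul a b ha hb => rw [map_mul, map_mul, map_mul, map_mul, ha, hb]
    | add a b ha hb => rw [map_add, map_add, map_add, map_add, ha, hb]
  rw [Algebra.smul_def, map_mul, h, ← Algebra.smul_def]

theorem exists_basis : ∃ (B : Set A) (e : Module.Basis B (SymmetricAlgebra ℂ P) A),
    (∀ b ∈ B, ∃ n, b ∈ 𝒜 n) ∧ ∀ b : B, e b = b := by
  obtain ⟨B, hB, hind, hspan⟩ := F.free
  refine ⟨B, Module.Basis.mk hind ?_, hB, fun b => Module.Basis.mk_apply _ _ b⟩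
  rw [Subtype.range_coe, hspan]

/-- The `m`-th symbol, composed with a functional on `S(P)`. -/
theorem exists_symbol (φ : SymmetricAlgebra ℂ P →ₗ[ℂ] ℂ) (m : ℕ) :
    ∃ D : A →ₗ[ℂ] SymSmash Γ, ∀ (q : SymmetricAlgebra ℂ P) (x : A),
      (∀ a < m, (symComponents P q).coeff a = 0) →
        D (q • x) = φ ((symComponents P q).coeff m) • π x := by
  obtain ⟨B, e, -, he⟩ := F.exists_basis
  -- On each coordinate in a chosen basis, the component of degree m is extracted and paired with φ.
  -- The map depends on the basis, but on q • x with q starting in degree m only the constant terms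
  -- of the coordinates of x matter, and these are recorded by π x.
  let ψ : SymmetricAlgebra ℂ P →ₗ[ℂ] ℂ := φ ∘ₗ
    (Polynomial.lcoeff (SymmetricAlgebra ℂ P) m).restrictScalars ℂ ∘ₗ (symComponents P).toLinearMap
  let D : A →ₗ[ℂ] SymSmash Γ := Finsupp.linearCombination ℂ (fun b : B => π b) ∘ₗ
    Finsupp.mapRange.linearMap ψ ∘ₗ e.repr.toLinearMap.restrictScalars ℂ
  have hD : ∀ x, D x = (e.repr x).sum fun b r => ψ r • π b := by
    intro x
    change Finsupp.linearCombination ℂ (fun b : B => π b) (Finsupp.mapRange.linearMap ψ (e.repr x)) = _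
    rw [Finsupp.linearCombination_apply, Finsupp.mapRange.linearMap_apply]
    exact Finsupp.sum_mapRange_index (h := fun (b : B) (r : ℂ) => r • π (b : A))
      fun b => zero_smul ℂ (π (b : A))
  refine ⟨D, fun q x hq => ?_⟩
  have hx : π x = (e.repr x).sum fun b r => (SymmetricAlgebra.algebraMapInv r : ℂ) • π b := by
    conv_lhs => rw [← e.linearCombination_repr x, Finsupp.linearCombination_apply, Finsupp.sum,
      map_sum]
    exact Finset.sum_congr rfl fun b _ => by rw [F.map_smul, he]
  rw [hD, _root_.map_smul, Finsupp.sum_smul_index (fun b => by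
    rw [map_zero]; exact zero_smul ℂ (π b)), hx, Finsupp.smul_sum]
  refine Finsupp.sum_congr fun b _ => ?_
  change φ ((symComponents P (q * _)).coeff m) • _ = _
  rw [coeff_symComponents_mul hq, _root_.map_smul, smul_smul, smul_eq_mul, mul_comm]

/-- The symbol of the products with elements of `P`. -/
theorem exists_param_symbol (φ : P →ₗ[ℂ] ℂ) : ∃ D : A →ₗ[ℂ] SymSmash Γ, ∀ (p : P) (x : A),
    D (SymmetricAlgebra.ι ℂ P p • x) = φ p • π x := by
  obtain ⟨D, hD⟩ := F.exists_symbol (SymmetricAlgebra.lift φ).toLinearMap 1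
  refine ⟨D, fun p x => ?_⟩
  rw [hD, symComponents_ι, Polynomial.coeff_monomial_same, AlgHom.toLinearMap_apply,
    SymmetricAlgebra.lift_ι_apply]
  intro a ha
  rw [symComponents_ι, Polynomial.coeff_monomial, if_neg (by omega)]

/-- Lifts of linearly independent elements are linearly independent. -/
theorem linearIndependent_of_map {κ : Type*} {y : κ → A} (h : LinearIndependent ℂ fun i => π (y i)) :
    LinearIndependent (SymmetricAlgebra ℂ P) y := by
  rw [linearIndependent_iff']
  intro s g hg i hi
  refine eq_zero_of_symComponents fun m => ?_
  -- The coefficients are killed degree by degree: once all components below m vanish for every i,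
  -- the m-th symbol turns the relation into one among the independent reductions.
  induction m using Nat.strong_induction_on generalizing i with
  | _ m ih =>
  rw [← Module.forall_dual_apply_eq_zero_iff ℂ]
  intro φ
  obtain ⟨D, hD⟩ := F.exists_symbol φ m
  have h1 := congrArg D hg
  rw [map_sum, map_zero, Finset.sum_congr rfl fun i hi => hD (g i) (y i) fun a ha => ih a ha i hi]
    at h1
  exact linearIndependent_iff'.mp h s _ h1 i hi

theorem iSupIndep : iSupIndep 𝒜 :=
  ((DirectSum.isInternal_submodule_iff_iSupIndep_and_iSup_eq_top _).mp F.isInternal).1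

theorem iSup_eq_top : ⨆ n, 𝒜 n = ⊤ :=
  ((DirectSum.isInternal_submodule_iff_iSupIndep_and_iSup_eq_top _).mp F.isInternal).2

theorem param_smul_mem (p : P) {n : ℤ} {x : A} (hx : x ∈ 𝒜 n) :
    SymmetricAlgebra.ι ℂ P p • x ∈ 𝒜 (n + 2) := by
  have := F.gradedMonoid
  rw [Algebra.smul_def, add_comm]
  exact SetLike.mul_mem_graded (F.param_mem p) hx

/-- The constant term of the coordinate at b vanishes on the ideal generated by P but equals 1 at
the basis vector itself. -/
theorem map_basis_ne_zero {B : Set A} (e : Module.Basis B (SymmetricAlgebra ℂ P) A) (b : B) :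
    π (e b) ≠ 0 := by
  intro h
  rw [← RingHom.mem_ker, F.ker_eq] at h
  have key : ∀ x ∈ Ideal.span (Set.range fun p : P =>
      algebraMap (SymmetricAlgebra ℂ P) A (SymmetricAlgebra.ι ℂ P p)),
      (SymmetricAlgebra.algebraMapInv (e.repr x b) : ℂ) = 0 := by
    intro x hx
    -- An ideal of the noncommutative ring A is a left ideal, so the induction carries an arbitrary
    -- left factor; the generators are central and can be moved to the front.
    refine Submodule.span_induction (p := fun x _ =>
      ∀ a : A, (SymmetricAlgebra.algebraMapInv (e.repr (a * x) b) : ℂ) = 0) ?_ ?_ ?_ ?_ hx 1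
      |> (by rwa [one_mul] at ·)
    · rintro _ ⟨p, rfl⟩ a
      simp only
      rw [← Algebra.commutes, ← Algebra.smul_def, _root_.map_smul, Finsupp.smul_apply, smul_eq_mul,
        map_mul, SymmetricAlgebra.algebraMapInv_ι, zero_mul]
    · intro a
      simp
    · intro x y _ _ hx hy a
      rw [mul_add, map_add, Finsupp.add_apply, map_add, hx, hy, add_zero]
    · intro c x _ hx a
      rw [smul_eq_mul, ← mul_assoc]
      exact hx _
  have := key _ h
  rw [e.repr_self, Finsupp.single_eq_same, map_one] at this
  exact one_ne_zero this

/-- A homogeneous basis element has nonzero image in S(V)#Γ, which lives in nonnegative degrees, and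
multiplication by P only raises the degree. -/
theorem iSup_nat_eq_top : ⨆ n : ℕ, 𝒜 n = ⊤ := by
  obtain ⟨B, e, hB, he⟩ := F.exists_basis
  have hsmul : ∀ (q : SymmetricAlgebra ℂ P) (x : A), x ∈ ⨆ n : ℕ, 𝒜 n → q • x ∈ ⨆ n : ℕ, 𝒜 n := by
    intro q
    induction q using SymmetricAlgebra.induction with
    | algebraMap r =>
      intro x hx
      rw [algebraMap_smul]
      exact Submodule.smul_mem _ _ hx
    | ι p =>
      intro x hx
      induction hx using Submodule.iSup_induction' with
      | mem n x hx => exact Submodule.mem_iSup_of_mem (n + 2) (F.param_smul_mem p hx)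
      | zero => rw [smul_zero]; exact zero_mem _
      | add x y _ _ hx hy => rw [smul_add]; exact add_mem hx hy
    | mul a b ha hb => intro x hx; rw [mul_smul]; exact ha _ (hb _ hx)
    | add a b ha hb => intro x hx; rw [add_smul]; exact add_mem (ha _ hx) (hb _ hx)
  rw [eq_top_iff]
  rintro x -
  rw [← e.linearCombination_repr x, Finsupp.linearCombination_apply]
  refine Submodule.sum_mem _ fun b _ => hsmul _ _ ?_
  obtain ⟨n, hn⟩ := hB b b.2
  rw [he]
  rcases lt_or_ge n 0 with h | h
  · have h1 := F.map_mem n _ hn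
    rw [smashGrading_of_neg Γ h, Submodule.mem_bot] at h1
    exact absurd (he b ▸ h1) (F.map_basis_ne_zero e b)
  · obtain ⟨k, rfl⟩ := Int.eq_ofNat_of_zero_le h
    exact Submodule.mem_iSup_of_mem k hn

theorem eq_bot_of_neg {n : ℤ} (hn : n < 0) : 𝒜 n = ⊥ := by
  rw [eq_bot_iff]
  intro x hx
  have h1 : x ∈ ⨆ n : ℕ, 𝒜 n := F.iSup_nat_eq_top ▸ Submodule.mem_top
  have h2 : ⨆ n : ℕ, 𝒜 n ≤ ⨆ (j) (_ : j ≠ n), 𝒜 j :=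
    iSup_le fun k => le_iSup₂_of_le (k : ℤ) (by omega) le_rfl
  exact Submodule.disjoint_def.mp (F.iSupIndep n) x hx (h2 h1)

/-- The kernel of `π` in degree `n`. -/
theorem mem_span_of_map_eq_zero {n : ℤ} {x : A} (hx : x ∈ 𝒜 n) (h : π x = 0) :
    x ∈ Submodule.span ℂ {y | ∃ (p : P) (a : A), a ∈ 𝒜 (n - 2) ∧
      y = SymmetricAlgebra.ι ℂ P p • a} := by
  refine mem_of_mem_iSup (ℳ := fun n => Submodule.span ℂ {y | ∃ (p : P) (a : A), a ∈ 𝒜 (n - 2) ∧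
      y = SymmetricAlgebra.ι ℂ P p • a}) F.iSupIndep ?_ hx ?_
  · intro n
    refine Submodule.span_le.mpr ?_
    rintro _ ⟨p, a, ha, rfl⟩
    have := F.param_smul_mem p ha
    rwa [sub_add_cancel] at this
  · rw [← RingHom.mem_ker, F.ker_eq] at h
    refine Submodule.span_induction (p := fun x _ => ∀ a : A, a * x ∈ ⨆ n, Submodule.span ℂ
      {y | ∃ (p : P) (a : A), a ∈ 𝒜 (n - 2) ∧ y = SymmetricAlgebra.ι ℂ P p • a})
      ?_ ?_ ?_ ?_ h 1 |> (by rwa [one_mul] at ·)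
    · rintro _ ⟨p, rfl⟩ a
      simp only
      rw [← Algebra.commutes, ← Algebra.smul_def]
      have ha : a ∈ ⨆ n, 𝒜 n := F.iSup_eq_top ▸ Submodule.mem_top
      induction ha using Submodule.iSup_induction' with
      | mem n a ha =>
        exact Submodule.mem_iSup_of_mem (n + 2)
          (Submodule.subset_span ⟨p, a, by rwa [add_sub_cancel_right], rfl⟩)
      | zero => rw [smul_zero]; exact zero_mem _
      | add x y _ _ hx hy => rw [smul_add]; exact add_mem hx hy
    · intro a
      simp
    · intro x y _ _ hx hy a
      rw [mul_add]
      exact add_mem (hx a) (hy a)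
    · intro c x _ hx a
      rw [smul_eq_mul, ← mul_assoc]
      exact hx _

/-- In degree n the kernel is spanned by P times degree n - 2, which is zero for n < 2. This
rigidity makes the lifts of Γ and V unique. -/
theorem eq_zero_of_map_eq_zero {n : ℤ} (hn : n < 2) {x : A} (hx : x ∈ 𝒜 n) (h : π x = 0) :
    x = 0 := by
  have h1 := F.mem_span_of_map_eq_zero hx h
  refine (Submodule.mem_bot ℂ).mp (Submodule.span_le.mpr ?_ h1)
  rintro _ ⟨p, a, ha, rfl⟩
  rw [F.eq_bot_of_neg (by omega), Submodule.mem_bot] at ha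
  rw [ha, smul_zero]
  exact zero_mem _

theorem eq_of_map_eq {n : ℤ} (hn : n < 2) {x y : A} (hx : x ∈ 𝒜 n) (hy : y ∈ 𝒜 n)
    (h : π x = π y) : x = y :=
  sub_eq_zero.mp (F.eq_zero_of_map_eq_zero hn (sub_mem hx hy) (by rw [map_sub, h, sub_self]))

/-- `π` is surjective in each degree. -/
theorem exists_lift {n : ℤ} {y : SymSmash Γ} (hy : y ∈ smashGrading Γ n) :
    ∃ x ∈ 𝒜 n, π x = y := by
  have := mem_of_mem_iSup (ℳ := fun n => (𝒜 n).map π.toLinearMap) (iSupIndep_smashGrading Γ) ?_ hy ?_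
  · exact this
  · intro n
    rintro _ ⟨x, hx, rfl⟩
    exact F.map_mem n x hx
  · rw [← Submodule.map_iSup, F.iSup_eq_top, Submodule.map_top]
    exact F.surjective y

/-- Graded Nakayama lemma: a submodule which surjects in each degree onto the reduction is
everything. -/
theorem eq_top_of_forall_exists (U : Submodule (SymmetricAlgebra ℂ P) A)
    (h : ∀ n, ∀ y ∈ smashGrading Γ n, ∃ u ∈ U, u ∈ 𝒜 n ∧ π u = y) : U = ⊤ := by
  -- Induction on an upper bound for the degree: after subtracting a lift from U, what remains is P
  -- times degree n - 2. Negative degrees vanish, so the induction starts.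
  have key : ∀ (k : ℕ) (n : ℤ), n < k → ∀ x ∈ 𝒜 n, x ∈ U := by
    intro k
    induction k with
    | zero =>
      intro n hn x hx
      rw [F.eq_bot_of_neg (by simpa using hn), Submodule.mem_bot] at hx
      rw [hx]
      exact zero_mem _
    | succ k ih =>
      intro n hn x hx
      obtain ⟨u, hu, hu', hπ⟩ := h n (π x) (F.map_mem n x hx)
      have h1 := F.mem_span_of_map_eq_zero (sub_mem hx hu') (by rw [map_sub, hπ, sub_self])
      have h2 : x - u ∈ U.restrictScalars ℂ := by
        refine Submodule.span_le.mpr ?_ h1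
        rintro _ ⟨p, a, ha, rfl⟩
        exact U.smul_mem _ (ih (n - 2) (by push_cast at hn; omega) a ha)
      have h3 := U.add_mem h2 hu
      rwa [sub_add_cancel] at h3
  rw [eq_top_iff]
  rintro x -
  have hx : x ∈ ⨆ n, 𝒜 n := F.iSup_eq_top ▸ Submodule.mem_top
  have hle : ⨆ n, 𝒜 n ≤ U.restrictScalars ℂ :=
    iSup_le fun n => fun x hx => key (n.toNat + 1) n (by push_cast; omega) x hx
  exact hle hx

end IsGradedFlatDeformation

/-! ### Invariant alternating forms -/

section InvariantForms

variable {V : Type*} [AddCommGroup V] [Module ℂ V]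

theorem restrict_nondegenerate {Ω : LinearMap.BilinForm ℂ V} (hΩ : Ω.IsAlt) {W : Submodule ℂ V}
    (h : ∀ w ∈ W, (∀ w' ∈ W, Ω w w' = 0) → w = 0) : (Ω.restrict W).Nondegenerate := by
  have hr : (Ω.restrict W).IsRefl := fun x y hxy => hΩ.isRefl x y hxy
  refine hr.nondegenerate_iff_separatingLeft.mpr fun w hw => Subtype.ext ?_
  exact h w w.2 fun w' hw' => hw ⟨w', hw'⟩

/-- Maschke's theorem: stable subspaces have stable complements. -/
theorem exists_stable_isCompl (Γ : Subgroup (V ≃ₗ[ℂ] V)) [Finite Γ] (K : Submodule ℂ V)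
    (hK : ∀ g ∈ Γ, ∀ w ∈ K, g w ∈ K) :
    ∃ W : Submodule ℂ V, (∀ g ∈ Γ, ∀ w ∈ W, g w ∈ W) ∧ IsCompl K W := by
  have := Fintype.ofFinite Γ
  obtain ⟨f, hf⟩ := K.subtype.exists_leftInverse_of_injective K.ker_subtype
  have hf' : ∀ w (hw : w ∈ K), (f w : V) = w := fun w hw =>
    congrArg Subtype.val (LinearMap.congr_fun hf ⟨w, hw⟩)
  let F : V →ₗ[ℂ] V := (Fintype.card Γ : ℂ)⁻¹ • ∑ g : Γ,
    ((g : V ≃ₗ[ℂ] V) : V →ₗ[ℂ] V) ∘ₗ K.subtype ∘ₗ f ∘ₗ (((g⁻¹ : Γ) : V ≃ₗ[ℂ] V) : V →ₗ[ℂ] V)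
  have hF : ∀ v, F v = (Fintype.card Γ : ℂ)⁻¹ • ∑ g : Γ,
      (g : V ≃ₗ[ℂ] V) (f (((g⁻¹ : Γ) : V ≃ₗ[ℂ] V) v)) := fun v => by
    simp only [F, LinearMap.smul_apply, LinearMap.sum_apply]
    rfl
  have h1 : ∀ v, F v ∈ K := fun v => by
    rw [hF]
    exact K.smul_mem _ (K.sum_mem fun g _ => hK g g.2 _ (f _).2)
  have h2 : ∀ w ∈ K, F w = w := fun w hw => by
    rw [hF, Finset.sum_congr rfl fun g _ => by
      rw [hf' _ (hK _ (g⁻¹).2 _ hw), ← LinearEquiv.mul_apply, ← Subgroup.coe_mul, mul_inv_cancel,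
        Subgroup.coe_one, LinearEquiv.coe_one, id], Finset.sum_const, Finset.card_univ,
      ← Nat.cast_smul_eq_nsmul ℂ, smul_smul, inv_mul_cancel₀, one_smul]
    exact Nat.cast_ne_zero.mpr Fintype.card_ne_zero
  refine ⟨LinearMap.ker F, ?_, ?_⟩
  · intro g hg w hw
    rw [LinearMap.mem_ker] at hw ⊢
    have : F (g w) = g (F w) := by
      rw [hF, hF, map_smul, map_sum]
      congr 1
      refine Fintype.sum_equiv (Equiv.mulLeft (⟨g, hg⟩ : Γ)⁻¹) _ _ fun h => ?_
      simp only [Equiv.coe_mulLeft, mul_inv_rev, inv_inv, Subgroup.coe_mul, LinearEquiv.mul_apply,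
        Subgroup.coe_inv]
      rw [← LinearEquiv.mul_apply g, mul_inv_cancel, LinearEquiv.coe_one, id]
    rw [this, hw, map_zero]
  · have hc : IsCompl (LinearMap.range F) (LinearMap.ker F) :=
      LinearMap.IsIdempotentElem.isCompl (f := F) (LinearMap.ext fun v => h2 _ (h1 v))
    have : LinearMap.range F = K := le_antisymm (by rintro _ ⟨v, rfl⟩; exact h1 v)
      fun w hw => ⟨w, h2 w hw⟩
    rwa [this] at hc

variable [FiniteDimensional ℂ V] {Ω : LinearMap.BilinForm ℂ V} {Γ : Subgroup (V ≃ₗ[ℂ] V)}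

/-- A self-adjoint equivariant endomorphism of square zero vanishes. -/
theorem eq_zero_of_selfAdjoint_of_sq_eq_zero [Finite Γ] (hΩ : Ω.IsAlt) (hΩ' : Ω.Nondegenerate)
    (hirr : SymplecticallyIrreducible Ω Γ) (M : Module.End ℂ V)
    (hM : ∀ g ∈ Γ, ∀ v, M (g v) = g (M v)) (hadj : ∀ u v, Ω (M u) v = Ω u (M v))
    (hsq : ∀ v, M (M v) = 0) : M = 0 := by
  obtain ⟨W, hW, hc⟩ := exists_stable_isCompl Γ (LinearMap.ker M) fun g hg w hw => by
    rw [LinearMap.mem_ker] at hw ⊢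
    rw [hM g hg, hw, map_zero]
  -- On a stable complement W of ker M the form Ω(Mw, w') is skew and nondegenerate. Deforming W to
  -- its image under 1 + dM adds 2d times this form to Ω restricted to W.
  let ω : LinearMap.BilinForm ℂ W := (Ω ∘ₗ M).compl₁₂ W.subtype W.subtype
  have hω : ∀ w w' : W, ω w w' = Ω (M w) w' := fun _ _ => rfl
  have hskew : ∀ u v, Ω (M u) v = - Ω (M v) u := fun u v => by
    rw [hadj, ← hΩ.neg_eq u (M v), neg_neg]
  have hωr : ω.IsRefl := fun x y hxy => by
    rw [hω] at hxy ⊢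
    rw [hskew, hxy, neg_zero]
  have hωn : ω.Nondegenerate := by
    refine hωr.nondegenerate_iff_separatingLeft.mpr fun w hw => ?_
    have h1 : M w = 0 := by
      refine hΩ'.1 _ fun v => ?_
      obtain ⟨k, hk, x, hx, rfl⟩ := Submodule.mem_sup.mp
        (hc.sup_eq_top ▸ Submodule.mem_top : v ∈ LinearMap.ker M ⊔ W)
      rw [map_add, hadj _ k, LinearMap.mem_ker.mp hk, map_zero, zero_add]
      exact hw ⟨x, hx⟩
    exact Subtype.ext (Submodule.disjoint_def.mp hc.disjoint _ h1 w.2)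
  let T : Module.End ℂ W := (Ω.restrict W).symmCompOfNondegenerate ω hωn
  have hT : ∀ w w' : W, ω (T w) w' = Ω w w' := fun w w' =>
    LinearMap.BilinForm.symmCompOfNondegenerate_left_apply _ hωn w' w
  -- T has finitely many eigenvalues, while ℂ is infinite.
  obtain ⟨c, hcT⟩ : ∃ c : ℂ, ¬ T.HasEigenvalue c := by
    have := (Module.End.finite_hasEigenvalue T).infinite_compl.nonempty
    exact this
  -- With 2d = -c the form on (1 + dM)W becomes ω((T - c)w, w'), which is nondegenerate as c is not
  -- an eigenvalue.
  let d : ℂ := -c / 2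
  let E : Module.End ℂ V := 1 + d • M
  have hE : ∀ v, E v = v + d • M v := fun v => rfl
  have hEinj : ∀ v, E v = 0 → v = 0 := fun v hv => by
    have h1 : M v = 0 := by
      have := congrArg M hv
      rwa [hE, map_add, map_smul, hsq, smul_zero, add_zero, map_zero] at this
    rwa [hE, h1, smul_zero, add_zero] at hv
  have hEform : ∀ w w', Ω (E w) (E w') = Ω w w' + 2 * d * Ω (M w) w' := fun w w' => by
    rw [hE, hE]
    simp only [map_add, LinearMap.add_apply, map_smul, LinearMap.smul_apply, smul_eq_mul]
    rw [hadj w (M w'), hsq, map_zero, ← hadj w w']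
    ring
  have key : W.map E = ⊥ ∨ W.map E = ⊤ := by
    refine hirr.2 (W.map E) ?_ (restrict_nondegenerate hΩ ?_)
    · rintro g hg _ ⟨w, hw, rfl⟩
      refine ⟨g w, hW g hg w hw, ?_⟩
      rw [hE, hE, hM g hg, map_add, map_smul]
    · rintro _ ⟨w, hw, rfl⟩ hw'
      have h1 : T ⟨w, hw⟩ = c • ⟨w, hw⟩ := by
        rw [← sub_eq_zero]
        refine hωn.1 _ fun w' => ?_
        have := hw' _ ⟨w', w'.2, rfl⟩
        rw [hEform] at this
        rw [map_sub, map_smul, LinearMap.sub_apply, LinearMap.smul_apply, hT, hω, smul_eq_mul]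
        rw [← this]
        simp only [d]
        ring
      have h2 : w = 0 := by
        by_contra hne
        exact hcT (Module.End.hasEigenvalue_of_hasEigenvector
          ⟨Module.End.mem_eigenspace_iff.mpr h1, fun h => hne (congrArg Subtype.val h)⟩)
      rw [h2, map_zero]
  rcases key with h | h
  · have hWbot : W = ⊥ := by
      rw [eq_bot_iff]
      intro w hw
      have : E w ∈ W.map E := Submodule.mem_map_of_mem hw
      rw [h, Submodule.mem_bot] at this
      exact hEinj w this
    rw [hWbot] at hc
    exact LinearMap.ker_eq_top.mp (by simpa using hc.sup_eq_top)
  -- If the deformed subspace is all of V, then so is W for dimension reasons; M is then injective,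
  -- and M² = 0 gives M = 0.
  · have hWtop : W = ⊤ := by
      refine Submodule.eq_top_of_finrank_eq (le_antisymm (Submodule.finrank_le W) ?_)
      rw [← finrank_top ℂ V, ← h]
      exact Submodule.finrank_map_le E W
    rw [hWtop] at hc
    have hker : LinearMap.ker M = ⊥ := by simpa using hc.inf_eq_bot
    refine LinearMap.ext fun v => ?_
    have : M v ∈ LinearMap.ker M := hsq v
    rw [hker, Submodule.mem_bot] at this
    rw [this, LinearMap.zero_apply]

/-- Powers of N are again self-adjoint and equivariant, and N^(2^k) is the square of the preceding
such power, so the square-zero case descends to N. Exponents are powers of 2 for this reason. -/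
theorem eq_zero_of_selfAdjoint_of_isNilpotent [Finite Γ] (hΩ : Ω.IsAlt) (hΩ' : Ω.Nondegenerate)
    (hirr : SymplecticallyIrreducible Ω Γ) (N : Module.End ℂ V)
    (hN : ∀ g ∈ Γ, ∀ v, N (g v) = g (N v)) (hadj : ∀ u v, Ω (N u) v = Ω u (N v)) (k : ℕ)
    (hk : N ^ 2 ^ k = 0) : N = 0 := by
  have hpow : ∀ n : ℕ, (∀ g ∈ Γ, ∀ v, (N ^ n) (g v) = g ((N ^ n) v)) ∧
      ∀ u v, Ω ((N ^ n) u) v = Ω u ((N ^ n) v) := by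
    intro n
    induction n with
    | zero => exact ⟨fun _ _ _ => rfl, fun _ _ => rfl⟩
    | succ n ih =>
      refine ⟨fun g hg v => ?_, fun u v => ?_⟩
      · rw [pow_succ, Module.End.mul_apply, Module.End.mul_apply, hN g hg, ih.1 g hg]
      · conv_lhs => rw [pow_succ', Module.End.mul_apply, hadj, ih.2]
        rw [pow_succ, Module.End.mul_apply]
  induction k with
  | zero => simpa using hk
  | succ k ih =>
    refine ih (eq_zero_of_selfAdjoint_of_sq_eq_zero hΩ hΩ' hirr _ (hpow _).1 (hpow _).2 fun v => ?_)
    rw [← Module.End.mul_apply, ← pow_add, ← two_mul, ← pow_succ', hk, LinearMap.zero_apply]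

/-- On a symplectically irreducible representation the invariant alternating forms are the
multiples of the symplectic form. -/
theorem exists_eq_smul_of_invariant [Finite Γ] (hΩ : Ω.IsAlt) (hΩ' : Ω.Nondegenerate)
    (hΓ : Γ ≤ Sp Ω) (hirr : SymplecticallyIrreducible Ω Γ) (ω : LinearMap.BilinForm ℂ V)
    (hω : ω.IsAlt) (hinv : ∀ g ∈ Γ, ∀ u v, ω (g u) (g v) = ω u v) : ∃ c : ℂ, ω = c • Ω := by
  have := hirr.1
  let A : Module.End ℂ V := ω.symmCompOfNondegenerate Ω hΩ'
  have hA : ∀ u v, Ω (A u) v = ω u v := fun u v =>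
    LinearMap.BilinForm.symmCompOfNondegenerate_left_apply _ hΩ' v u
  obtain ⟨c, hc⟩ := Module.End.exists_eigenvalue A
  obtain ⟨x, hx⟩ := hc.exists_hasEigenvector
  -- A is the operator comparing ω with Ω and is self-adjoint since both forms are alternating. It
  -- remains to show that A equals one of its eigenvalues c.
  let N : Module.End ℂ V := A - c • 1
  have hNv : ∀ v, N v = A v - c • v := fun v => rfl
  have hN : ∀ g ∈ Γ, ∀ v, N (g v) = g (N v) := fun g hg v => by
    have : A (g v) = g (A v) := by
      rw [← sub_eq_zero]
      refine hΩ'.1 _ fun w => ?_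
      have h1 := hΓ hg (A v) (g⁻¹ w)
      have h2 := hinv g hg v (g⁻¹ w)
      have h3 : g (g⁻¹ w) = w := by rw [← LinearEquiv.mul_apply, mul_inv_cancel]; rfl
      rw [h3] at h1 h2
      rw [map_sub, LinearMap.sub_apply, hA, h1, h2, hA, sub_self]
    rw [hNv, hNv, this, map_sub, map_smul]
  have hadj : ∀ u v, Ω (N u) v = Ω u (N v) := fun u v => by
    rw [hNv, hNv, map_sub, LinearMap.sub_apply, map_sub, hA, map_smul, map_smul,
      LinearMap.smul_apply, ← hΩ.neg_eq (A v) u, hA, hω.neg_eq]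
  have hpadj : ∀ (n : ℕ) u v, Ω ((N ^ n) u) v = Ω u ((N ^ n) v) := by
    intro n
    induction n with
    | zero => exact fun _ _ => rfl
    | succ n ih =>
      intro u v
      conv_lhs => rw [pow_succ', Module.End.mul_apply, hadj, ih]
      rw [pow_succ, Module.End.mul_apply]
  have hpN : ∀ (n : ℕ), ∀ g ∈ Γ, ∀ v, (N ^ n) (g v) = g ((N ^ n) v) := by
    intro n
    induction n with
    | zero => exact fun _ _ _ => rfl
    | succ n ih =>
      intro g hg v
      rw [pow_succ, Module.End.mul_apply, Module.End.mul_apply, hN g hg, ih g hg]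
  let n := Module.finrank ℂ V
  have hn : 0 < n := Module.finrank_pos
  have hxN : (N ^ n) x = 0 := by
    obtain ⟨m, hm⟩ := Nat.exists_eq_succ_of_ne_zero hn.ne'
    rw [hm, Nat.succ_eq_add_one, pow_succ, Module.End.mul_apply, hNv, hx.apply_eq_smul, sub_self,
      map_zero]
  -- Fitting's lemma: the kernels of N^n and N^(2n) agree for n = dim V, so Ω is nondegenerate on
  -- the stable subspace im N^n. It is not all of V, because N^n kills an eigenvector.
  have hNn : N ^ n = 0 := by
    have key : LinearMap.range (N ^ n) = ⊥ ∨ LinearMap.range (N ^ n) = ⊤ := by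
      refine hirr.2 _ ?_ (restrict_nondegenerate hΩ ?_)
      · rintro g hg _ ⟨v, rfl⟩
        exact ⟨g v, hpN n g hg v⟩
      · rintro _ ⟨v, rfl⟩ hv
        have h1 : (N ^ n) ((N ^ n) v) = 0 := by
          refine hΩ'.1 _ fun w => ?_
          rw [hpadj]
          exact hv _ ⟨w, rfl⟩
        have h2 : v ∈ LinearMap.ker (N ^ (n + n)) := by
          rw [LinearMap.mem_ker, pow_add, Module.End.mul_apply, h1]
        rwa [Module.End.ker_pow_eq_ker_pow_finrank_of_le (Nat.le_add_left _ _)] at h2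
    rcases key with h | h
    · exact LinearMap.range_eq_bot.mp h
    · have hker : LinearMap.ker (N ^ n) = ⊥ :=
        LinearMap.ker_eq_bot_iff_range_eq_top.mpr h
      have : x ∈ LinearMap.ker (N ^ n) := hxN
      rw [hker, Submodule.mem_bot] at this
      exact absurd this hx.2
  -- The exponent n is enlarged to 2^n to have the form required by the nilpotent case.
  have hN0 := eq_zero_of_selfAdjoint_of_isNilpotent hΩ hΩ' hirr N hN hadj n
    (pow_eq_zero_of_le (Nat.lt_two_pow_self).le hNn)
  refine ⟨c, LinearMap.ext fun u => LinearMap.ext fun v => ?_⟩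
  have h1 : A u = c • u := sub_eq_zero.mp ((hNv u).symm.trans (by rw [hN0, LinearMap.zero_apply]))
  rw [← hA, h1, map_smul]
  rfl

end InvariantForms

/-! ### Alternating forms satisfying the Jacobi identity -/

section JacobiForms

variable {V : Type*} [AddCommGroup V] [Module ℂ V] [FiniteDimensional ℂ V]
  {Ω : LinearMap.BilinForm ℂ V} {Γ : Subgroup (V ≃ₗ[ℂ] V)} [Finite Γ]

/-- `im (s - 1)` is orthogonal to `ker (s - 1)`. -/
theorem form_subOne_of_mem_ker (hΓ : Γ ≤ Sp Ω) (s : Γ) (u : V) {w : V}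
    (hw : w ∈ LinearMap.ker (subOne s)) : Ω (subOne s u) w = 0 := by
  rw [LinearMap.mem_ker, subOne_apply, sub_eq_zero] at hw
  rw [subOne_apply, map_sub, LinearMap.sub_apply, sub_eq_zero]
  conv_lhs => rw [← hw]
  exact hΓ s.2 u w

/-- V is the orthogonal sum of im(s - 1) and ker(s - 1), so Ω is nondegenerate on im(s - 1). -/
theorem exists_form_ne_zero (hΩ' : Ω.Nondegenerate) (hΓ : Γ ≤ Sp Ω) (s : Γ) {u : V}
    (hu : subOne s u ≠ 0) : ∃ v, Ω (subOne s u) (subOne s v) ≠ 0 := by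
  by_contra! h
  refine hu (hΩ'.1 _ fun w => ?_)
  obtain ⟨v, hv⟩ := proj_mem s w
  rw [← add_sub_cancel (proj s w) w, map_add, form_subOne_of_mem_ker hΓ s u (sub_proj_mem s w),
    ← hv, h, add_zero]

/-- Coordinates on the plane attached to a symplectic reflection. -/
theorem exists_form_proj_eq_one (hΩ' : Ω.Nondegenerate) (hΓ : Γ ≤ Sp Ω) {s : Γ}
    (hs : IsSymplecticReflection s) : ∃ u v, Ω (proj s u) (proj s v) = 1 := by
  have h0 : ∃ u, subOne s u ≠ 0 := by
    by_contra! h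
    have : subOne s = 0 := LinearMap.ext h
    rw [IsSymplecticReflection, this, LinearMap.range_zero, finrank_bot] at hs
    exact absurd hs (by norm_num)
  obtain ⟨u, hu⟩ := h0
  obtain ⟨v, hv⟩ := exists_form_ne_zero hΩ' hΓ s hu
  have hp : ∀ w, proj s (subOne s w) = subOne s w := fun w =>
    proj_eq s ⟨w, rfl⟩ (by rw [sub_self]; exact zero_mem _)
  refine ⟨(Ω (subOne s u) (subOne s v))⁻¹ • subOne s u, subOne s v, ?_⟩
  rw [map_smul, hp, hp, map_smul, LinearMap.smul_apply, smul_eq_mul, inv_mul_cancel₀ hv]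

/-- The identity satisfied by the `s`-component of a commutator. -/
def IsJacobiForm (s : Γ) (κ : LinearMap.BilinForm ℂ V) : Prop :=
  κ.IsAlt ∧ ∀ u v w, κ u v • subOne s w + κ v w • subOne s u + κ w u • subOne s v = 0

theorem finrank_range_le_one {s : Γ} {v : V}
    (h : ∀ u, subOne s u ∈ Submodule.span ℂ {subOne s v}) :
    Module.finrank ℂ (LinearMap.range (subOne s)) ≤ 1 := by
  refine (Submodule.finrank_mono (t := Submodule.span ℂ {subOne s v}) ?_).trans ?_
  · rintro _ ⟨u, rfl⟩
    exact h u
  · have := finrank_span_finset_le_card (R := ℂ) ({subOne s v} : Finset V)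
    rwa [Finset.coe_singleton, Finset.card_singleton] at this

/-- Were im(s - 1) at most a line, the alternating form would vanish on it, against nondegeneracy.
-/
theorem two_le_finrank (hΩ : Ω.IsAlt) (hΩ' : Ω.Nondegenerate) (hΓ : Γ ≤ Sp Ω) {s : Γ}
    (hs : s ≠ 1) : 2 ≤ Module.finrank ℂ (LinearMap.range (subOne s)) := by
  by_contra! hlt
  obtain ⟨a, ha⟩ := finrank_le_one_iff.mp (Nat.lt_succ_iff.mp hlt)
  have h0 : ∃ u, subOne s u ≠ 0 := by
    by_contra! h
    refine hs (Subtype.ext (LinearEquiv.ext fun v => ?_))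
    exact sub_eq_zero.mp (h v)
  obtain ⟨u, hu⟩ := h0
  obtain ⟨v, hv⟩ := exists_form_ne_zero hΩ' hΓ s hu
  obtain ⟨c, hc⟩ := ha ⟨_, u, rfl⟩
  obtain ⟨d, hd⟩ := ha ⟨_, v, rfl⟩
  have hc' : c • (a : V) = subOne s u := congrArg Subtype.val hc
  have hd' : d • (a : V) = subOne s v := congrArg Subtype.val hd
  refine hv ?_
  rw [← hc', ← hd', map_smul, map_smul, LinearMap.smul_apply, hΩ a, smul_zero, smul_zero]

/-- Choose u with (s - 1)u not proportional to (s - 1)v, which is possible in rank at least 2. As (s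
- 1)w = 0, the Jacobi identity becomes a relation between these two vectors in which κ(v, w) is the
coefficient of (s - 1)u. -/
theorem IsJacobiForm.apply_of_mem_ker (hΩ : Ω.IsAlt) (hΩ' : Ω.Nondegenerate) (hΓ : Γ ≤ Sp Ω)
    {s : Γ} (hs : s ≠ 1) {κ : LinearMap.BilinForm ℂ V} (hκ : IsJacobiForm s κ) {w : V}
    (hw : w ∈ LinearMap.ker (subOne s)) (v : V) : κ v w = 0 := by
  have h2 := two_le_finrank hΩ hΩ' hΓ hs
  obtain ⟨u, hu⟩ : ∃ u, subOne s u ∉ Submodule.span ℂ {subOne s v} := by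
    by_contra! h
    exact absurd (finrank_range_le_one h) (by omega)
  by_contra hne
  have h := hκ.2 u v w
  rw [LinearMap.mem_ker.mp hw, smul_zero, zero_add] at h
  refine hu ?_
  rw [← Submodule.smul_mem_iff _ hne, eq_neg_of_add_eq_zero_left h]
  exact neg_mem (Submodule.smul_mem _ _ (Submodule.mem_span_singleton_self _))

/-- The rank is then at least 3, so for given u, v some (s - 1)w lies outside the span of (s - 1)u
and (s - 1)v; its coefficient κ(u, v) in the Jacobi identity must vanish. -/
theorem IsJacobiForm.eq_zero (hΩ : Ω.IsAlt) (hΩ' : Ω.Nondegenerate) (hΓ : Γ ≤ Sp Ω)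
    {s : Γ} (hs : s ≠ 1) (hs' : ¬ IsSymplecticReflection s) {κ : LinearMap.BilinForm ℂ V}
    (hκ : IsJacobiForm s κ) : κ = 0 := by
  have h2 := two_le_finrank hΩ hΩ' hΓ hs
  refine LinearMap.ext fun u => LinearMap.ext fun v => ?_
  obtain ⟨w, hw⟩ : ∃ w, subOne s w ∉ Submodule.span ℂ {subOne s u, subOne s v} := by
    by_contra! h
    refine hs' (le_antisymm ?_ h2)
    refine (Submodule.finrank_mono (t := Submodule.span ℂ {subOne s u, subOne s v}) ?_).trans ?_
    · rintro _ ⟨x, rfl⟩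
      exact h x
    · classical
      have := finrank_span_finset_le_card (R := ℂ) ({subOne s u, subOne s v} : Finset V)
      rw [Finset.coe_pair] at this
      exact this.trans Finset.card_le_two
  by_contra hne
  refine hw ?_
  rw [← Submodule.smul_mem_iff _ hne, eq_neg_of_add_eq_zero_left
    ((add_assoc _ _ _).symm.trans (hκ.2 u v w))]
  exact neg_mem (add_mem (Submodule.smul_mem _ _ (Submodule.subset_span (by simp)))
    (Submodule.smul_mem _ _ (Submodule.subset_span (by simp))))

/-- Since κ kills ker(s - 1), it is determined on the plane im(s - 1), where alternating forms are
proportional. The vectors a, b normalize Ω to 1 and identify the factor as κ(a, b). -/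
theorem IsJacobiForm.eq_mul (hΩ : Ω.IsAlt) (hΩ' : Ω.Nondegenerate) (hΓ : Γ ≤ Sp Ω)
    {s : Γ} (hs : IsSymplecticReflection s) {κ : LinearMap.BilinForm ℂ V} (hκ : IsJacobiForm s κ)
    {a b : V} (hab : Ω (proj s a) (proj s b) = 1) (u v : V) :
    κ u v = Ω (proj s u) (proj s v) * κ a b := by
  have hs1 : s ≠ 1 := by rintro rfl; exact not_isSymplecticReflection_one hs
  have hskew : ∀ u v, κ u v = - κ v u := fun u v => (hκ.1.neg_eq v u).symm
  have h1 : ∀ u v, κ u v = κ (proj s u) (proj s v) := fun u v => by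
    have e1 := hκ.apply_of_mem_ker hΩ hΩ' hΓ hs1 (sub_proj_mem s v) u
    have e2 := hκ.apply_of_mem_ker hΩ hΩ' hΓ hs1 (sub_proj_mem s u) (proj s v)
    rw [map_sub, sub_eq_zero] at e1 e2
    rw [e1, hskew, e2, ← hskew]
  have h2 : ∀ x, proj s x = Ω (proj s x) (proj s b) • proj s a + Ω (proj s a) (proj s x) • proj s b :=
    fun x => by
      have := cramer_plane hΩ hs (proj_mem s a) (proj_mem s b) (proj_mem s x)
      rw [hab, one_smul, ← hΩ.neg_eq (proj s x) (proj s b), ← hΩ.neg_eq (proj s a) (proj s x),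
        add_assoc] at this
      refine (eq_neg_of_add_eq_zero_left this).trans ?_
      rw [neg_add, neg_smul, neg_smul, neg_neg, neg_neg]
  rw [h1 u v, h1 a b]
  have hvv : κ (proj s u) (proj s v) = _ := congrArg₂ (fun x y => κ x y) (h2 u) (h2 v)
  have hΩv : Ω (proj s u) (proj s v) = _ := congrArg₂ (fun x y => Ω x y) (h2 u) (h2 v)
  rw [hvv, hΩv]
  simp only [map_add, map_smul, LinearMap.add_apply, LinearMap.smul_apply, smul_eq_mul, hab,
    hκ.1.self_eq_zero, hΩ.self_eq_zero]
  rw [hskew (proj s b) (proj s a), ← hΩ.neg_eq (proj s a) (proj s b), hab]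
  ring

end JacobiForms

theorem symmetricAlgebra_ι_injective {P : Type*} [AddCommGroup P] [Module ℂ P] :
    Function.Injective (SymmetricAlgebra.ι ℂ P) := by
  refine (injective_iff_map_eq_zero _).mpr fun p hp => ?_
  rw [← Module.forall_dual_apply_eq_zero_iff ℂ]
  intro φ
  rw [← SymmetricAlgebra.lift_ι_apply (f := φ), hp, map_zero]

theorem symIncl_ι_mem {V : Type*} [AddCommGroup V] [Module ℂ V] (Γ : Subgroup (V ≃ₗ[ℂ] V)) (v : V) :
    SkewMonoidAlgebra.single 1 (SymmetricAlgebra.ι ℂ V v) ∈ smashGrading Γ 1 :=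
  Submodule.subset_span ⟨1, _, 1, ι_mem_symPow v, rfl, rfl⟩

theorem single_one_mem {V : Type*} [AddCommGroup V] [Module ℂ V] {Γ : Subgroup (V ≃ₗ[ℂ] V)} (g : Γ) :
    SkewMonoidAlgebra.single g 1 ∈ smashGrading Γ 0 :=
  Submodule.subset_span ⟨0, 1, g, one_mem_symPow, rfl, rfl⟩

namespace IsGradedFlatDeformation

/-! ### Lifting `V` and `Γ` to a graded flat deformation -/

section Lifts

variable {V : Type*} [AddCommGroup V] [Module ℂ V] {Γ : Subgroup (V ≃ₗ[ℂ] V)}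
  {P A : Type*} [AddCommGroup P] [Module ℂ P] [Ring A]
  [Algebra ℂ A] [Algebra (SymmetricAlgebra ℂ P) A] [IsScalarTower ℂ (SymmetricAlgebra ℂ P) A]
  {𝒜 : ℤ → Submodule ℂ A} {π : A →ₐ[ℂ] SymSmash Γ} (F : IsGradedFlatDeformation Γ (P := P) 𝒜 π)

include F

theorem mul_mem {m n : ℤ} {x y : A} (hx : x ∈ 𝒜 m) (hy : y ∈ 𝒜 n) : x * y ∈ 𝒜 (m + n) :=
  have := F.gradedMonoid
  SetLike.mul_mem_graded hx hy

theorem one_mem : (1 : A) ∈ 𝒜 0 :=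
  F.gradedMonoid.one_mem

/-- Lifts to degree 0 exist and are unique, so the lifted elements multiply as in Γ. The same
argument in degree 1 makes the lift of V linear. -/
theorem exists_grp : ∃ γ : Γ →* A, ∀ g, γ g ∈ 𝒜 0 ∧ π (γ g) = SkewMonoidAlgebra.single g 1 := by
  choose γ hγ hπ using fun g : Γ => F.exists_lift (single_one_mem g)
  refine ⟨⟨⟨γ, F.eq_of_map_eq (n := 0) (by norm_num) (hγ 1) F.one_mem ?_⟩, fun g h =>
    F.eq_of_map_eq (n := 0) (by norm_num) (hγ _) ?_ ?_⟩, fun g => ⟨hγ g, hπ g⟩⟩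
  · rw [hπ, map_one]
    rfl
  · simpa using F.mul_mem (hγ g) (hγ h)
  · rw [map_mul, hπ, hπ, hπ, SkewMonoidAlgebra.single_mul_single, smul_one, mul_one]

theorem exists_vec : ∃ x : V →ₗ[ℂ] A, ∀ v, x v ∈ 𝒜 1 ∧
    π (x v) = SkewMonoidAlgebra.single 1 (SymmetricAlgebra.ι ℂ V v) := by
  choose x hx hπ using fun v : V => F.exists_lift (symIncl_ι_mem Γ v)
  refine ⟨⟨⟨x, fun u v => F.eq_of_map_eq (n := 1) (by norm_num) (hx _) (add_mem (hx u) (hx v)) ?_⟩,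
    fun c v => F.eq_of_map_eq (n := 1) (by norm_num) (hx _) (Submodule.smul_mem _ c (hx v)) ?_⟩,
    fun v => ⟨hx v, hπ v⟩⟩
  · rw [map_add, hπ, hπ, hπ, map_add, SkewMonoidAlgebra.single_add]
  · rw [RingHom.id_apply, _root_.map_smul, hπ, hπ, _root_.map_smul, SkewMonoidAlgebra.smul_single]

/-- Separates the g-component of a sum of parameters times elements: take the first symbol paired
with φ, then the coefficient at g in S(V)#Γ. This is how identities in A yield identities between
individual parameters. -/
theorem exists_coeff_symbol (φ : P →ₗ[ℂ] ℂ) (g : Γ) [Fintype Γ] :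
    ∃ D : A →ₗ[ℂ] SymmetricAlgebra ℂ V, ∀ (p : Γ → P) (y : Γ → A) (a : Γ → SymmetricAlgebra ℂ V),
      (∀ h, π (y h) = SkewMonoidAlgebra.single h (a h)) →
        D (∑ h, SymmetricAlgebra.ι ℂ P (p h) • y h) = φ (p g) • a g := by
  classical
  obtain ⟨D, hD⟩ := F.exists_param_symbol φ
  refine ⟨Finsupp.lapply g ∘ₗ (SkewMonoidAlgebra.coeffLinearEquiv (S := ℂ)
    (k := SymmetricAlgebra ℂ V) (G := Γ)).toLinearMap ∘ₗ D, fun p y a h => ?_⟩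
  rw [map_sum, Finset.sum_eq_single g]
  · change (D _).coeff g = _
    rw [hD, h, SkewMonoidAlgebra.coeff_smul, SkewMonoidAlgebra.coeff_single, Finsupp.smul_apply,
      Finsupp.single_eq_same]
  · intro k _ hk
    change (D _).coeff g = _
    rw [hD, h, SkewMonoidAlgebra.coeff_smul, SkewMonoidAlgebra.coeff_single, Finsupp.smul_apply,
      Finsupp.single_eq_of_ne hk.symm, smul_zero]
  · intro h
    exact absurd (Finset.mem_univ g) h

end Lifts

/-! ### The commutators of lifted vectors and the constraints on them. -/

section Commutators

variable {V : Type*} [AddCommGroup V] [Module ℂ V] {Γ : Subgroup (V ≃ₗ[ℂ] V)} [Fintype Γ]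
  {P A : Type*} [AddCommGroup P] [Module ℂ P] [Ring A]
  [Algebra ℂ A] [Algebra (SymmetricAlgebra ℂ P) A] [IsScalarTower ℂ (SymmetricAlgebra ℂ P) A]
  {𝒜 : ℤ → Submodule ℂ A} {π : A →ₐ[ℂ] SymSmash Γ} (F : IsGradedFlatDeformation Γ (P := P) 𝒜 π)
  {γ : Γ →* A} (hγ : ∀ g, γ g ∈ 𝒜 0 ∧ π (γ g) = SkewMonoidAlgebra.single g 1)
  {x : V →ₗ[ℂ] A} (hx : ∀ v, x v ∈ 𝒜 1 ∧
    π (x v) = SkewMonoidAlgebra.single 1 (SymmetricAlgebra.ι ℂ V v))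

include F hγ

/-- Freeness enters here through the first symbol: an element of A determines its coefficients in P
along Γ. Linearity, invariance and uniqueness of these coefficients all follow by comparing elements
of A. -/
theorem param_grp_injective {p q : Γ → P}
    (h : ∑ g, SymmetricAlgebra.ι ℂ P (p g) • γ g = ∑ g, SymmetricAlgebra.ι ℂ P (q g) • γ g) :
    p = q := by
  funext g
  rw [← sub_eq_zero, ← Module.forall_dual_apply_eq_zero_iff ℂ]
  intro φ
  obtain ⟨D, hD⟩ := F.exists_coeff_symbol φ g
  have h1 := congrArg D h
  rw [hD p γ (fun _ => 1) fun k => (hγ k).2, hD q γ (fun _ => 1) fun k => (hγ k).2,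
    ← sub_eq_zero, ← sub_smul, smul_eq_zero] at h1
  rw [map_sub]
  exact h1.resolve_right one_ne_zero

/-- In degree 2 the kernel of π is spanned by P times degree 0, and degree 0 is spanned by the lifts
of Γ. -/
theorem exists_eq_sum_grp {y : A} (hy : y ∈ 𝒜 2) (hπ : π y = 0) :
    ∃ p : Γ → P, ∑ g, SymmetricAlgebra.ι ℂ P (p g) • γ g = y := by
  classical
  let U : Submodule ℂ A :=
    { carrier := {y | ∃ p : Γ → P, ∑ g, SymmetricAlgebra.ι ℂ P (p g) • γ g = y}
      zero_mem' := ⟨0, by simp⟩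
      add_mem' := by
        rintro _ _ ⟨p, rfl⟩ ⟨q, rfl⟩
        exact ⟨p + q, by simp [add_smul, Finset.sum_add_distrib]⟩
      smul_mem' := by
        rintro c _ ⟨p, rfl⟩
        exact ⟨c • p, by simp [Finset.smul_sum]⟩ }
  have hU : ∀ y, y ∈ U ↔ ∃ p : Γ → P, ∑ g, SymmetricAlgebra.ι ℂ P (p g) • γ g = y := fun _ => Iff.rfl
  rw [← hU]
  refine Submodule.span_le.mpr ?_ (F.mem_span_of_map_eq_zero hy hπ)
  rintro _ ⟨p, a, ha, rfl⟩
  have ha0 : a ∈ 𝒜 0 := ha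
  have key : smashGrading Γ 0 ≤ (Submodule.span ℂ (Set.range γ)).map π.toLinearMap := by
    refine Submodule.span_le.mpr ?_
    rintro _ ⟨k, s, g, hs, hk, rfl⟩
    obtain rfl : k = 0 := by exact_mod_cast hk
    rw [symPow, pow_zero] at hs
    obtain ⟨c, rfl⟩ := Submodule.mem_one.mp hs
    refine ⟨c • γ g, Submodule.smul_mem _ _ (Submodule.subset_span ⟨g, rfl⟩), ?_⟩
    rw [_root_.map_smul, AlgHom.toLinearMap_apply, (hγ g).2, SkewMonoidAlgebra.smul_single,
      Algebra.algebraMap_eq_smul_one]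
  obtain ⟨b, hb, hba⟩ := key (F.map_mem 0 a ha0)
  have hb0 : b ∈ 𝒜 0 := by
    refine Submodule.span_le.mpr ?_ hb
    rintro _ ⟨g, rfl⟩
    exact (hγ g).1
  rw [F.eq_of_map_eq (n := 0) (by norm_num) ha0 hb0 hba.symm]
  refine Submodule.span_induction (p := fun b _ => SymmetricAlgebra.ι ℂ P p • b ∈ U) ?_ ?_ ?_ ?_ hb
  · rintro _ ⟨g, rfl⟩
    refine (hU _).mpr ⟨Pi.single g p, ?_⟩
    rw [Finset.sum_eq_single g]
    · rw [Pi.single_eq_same]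
    · intro h _ hne
      rw [Pi.single_eq_of_ne hne, map_zero, zero_smul]
    · simp
  · rw [smul_zero]
    exact zero_mem _
  · intro a b _ _ ha hb
    rw [smul_add]
    exact add_mem ha hb
  · intro c a _ ha
    rw [smul_comm]
    exact Submodule.smul_mem _ _ ha

include hx

theorem grp_mul_vec (g : Γ) (v : V) : γ g * x v = x ((g : V ≃ₗ[ℂ] V) v) * γ g := by
  refine F.eq_of_map_eq (n := 1) (by norm_num) ?_ ?_ ?_
  · simpa using F.mul_mem (hγ g).1 (hx v).1
  · simpa using F.mul_mem (hx _).1 (hγ g).1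
  · rw [map_mul, map_mul, (hγ g).2, (hx _).2, (hx _).2, SkewMonoidAlgebra.single_mul_single,
      SkewMonoidAlgebra.single_mul_single, sym_smul_def, SymmetricAlgebra.lift_ι_apply]
    simp

/-- The commutators of vectors are given by bilinear forms with values in the parameters. -/
theorem exists_commutator : ∃ κ : V →ₗ[ℂ] V →ₗ[ℂ] (Γ → P), ∀ u v,
    ∑ g, SymmetricAlgebra.ι ℂ P (κ u v g) • γ g = x u * x v - x v * x u := by
  have hk : ∀ u v, ∃ p : Γ → P, ∑ g, SymmetricAlgebra.ι ℂ P (p g) • γ g = x u * x v - x v * x u :=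
    fun u v => by
      refine F.exists_eq_sum_grp hγ (sub_mem ?_ ?_) ?_
      · exact F.mul_mem (hx u).1 (hx v).1
      · exact F.mul_mem (hx v).1 (hx u).1
      · rw [map_sub, map_mul, map_mul, (hx u).2, (hx v).2, SkewMonoidAlgebra.single_mul_single,
          SkewMonoidAlgebra.single_mul_single, one_smul, one_smul, mul_comm (SymmetricAlgebra.ι ℂ V u),
          sub_self]
  choose k hk using hk
  have hadd : ∀ p q : Γ → P, ∑ g, SymmetricAlgebra.ι ℂ P ((p + q) g) • γ g =
      ∑ g, SymmetricAlgebra.ι ℂ P (p g) • γ g + ∑ g, SymmetricAlgebra.ι ℂ P (q g) • γ g :=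
    fun p q => by simp [add_smul, Finset.sum_add_distrib]
  have hsmul : ∀ (c : ℂ) (p : Γ → P), ∑ g, SymmetricAlgebra.ι ℂ P ((c • p) g) • γ g =
      c • ∑ g, SymmetricAlgebra.ι ℂ P (p g) • γ g := fun c p => by simp [Finset.smul_sum]
  -- Bilinearity of the chosen coefficients follows from that of the commutator, because the
  -- coefficients are unique.
  refine ⟨LinearMap.mk₂ ℂ k ?_ ?_ ?_ ?_, hk⟩
  · intro u v w
    refine F.param_grp_injective hγ ?_
    rw [hadd, hk, hk, hk, map_add]
    noncomm_ring
  · intro c u v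
    refine F.param_grp_injective hγ ?_
    rw [hsmul, hk, hk, _root_.map_smul, smul_mul_assoc, mul_smul_comm, smul_sub]
  · intro u v w
    refine F.param_grp_injective hγ ?_
    rw [hadd, hk, hk, hk, map_add]
    noncomm_ring
  · intro c u v
    refine F.param_grp_injective hγ ?_
    rw [hsmul, hk, hk, _root_.map_smul, smul_mul_assoc, mul_smul_comm, smul_sub]

variable {κ : V →ₗ[ℂ] V →ₗ[ℂ] (Γ → P)} (hκ : ∀ u v,
    ∑ g, SymmetricAlgebra.ι ℂ P (κ u v g) • γ g = x u * x v - x v * x u)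

include hκ

/-- Conjugating the commutator by the lift of h moves u and v by h and permutes the group elements
by conjugation; coefficients are then compared. -/
theorem commutator_conj (h g : Γ) (u v : V) :
    κ ((h : V ≃ₗ[ℂ] V) u) ((h : V ≃ₗ[ℂ] V) v) (h * g * h⁻¹) = κ u v g := by
  have key : κ ((h : V ≃ₗ[ℂ] V) u) ((h : V ≃ₗ[ℂ] V) v) = fun g => κ u v (h⁻¹ * g * h) := by
    refine F.param_grp_injective hγ ?_
    have hunit : γ h * γ h⁻¹ = 1 := by rw [← map_mul, mul_inv_cancel, map_one]
    have hv : ∀ v, x ((h : V ≃ₗ[ℂ] V) v) = γ h * x v * γ h⁻¹ := fun v => by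
      rw [F.grp_mul_vec hγ hx, mul_assoc, hunit, mul_one]
    have hunit' : γ h⁻¹ * γ h = 1 := by rw [← map_mul, inv_mul_cancel, map_one]
    have hm : ∀ a b : A, γ h * a * γ h⁻¹ * (γ h * b * γ h⁻¹) = γ h * (a * b) * γ h⁻¹ := fun a b => by
      rw [mul_assoc (γ h * a), mul_assoc (γ h) b, ← mul_assoc (γ h⁻¹) (γ h), hunit', one_mul]
      simp only [mul_assoc]
    rw [hκ, hv, hv, hm, hm, ← sub_mul, ← mul_sub, ← hκ, Finset.mul_sum, Finset.sum_mul]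
    refine Fintype.sum_equiv (MulAut.conj h).toEquiv _ _ fun k => ?_
    rw [mul_smul_comm, smul_mul_assoc, ← map_mul, ← map_mul]
    congr 3
    change κ u v k = κ u v (h⁻¹ * (h * k * h⁻¹) * h)
    group
  rw [key]
  group

variable [FiniteDimensional ℂ V]

/-- The Jacobi identity for commutators in A, read through the symbol at s: the commutator of the
lift of g with w is ((g - 1)w) g, so the double commutator of u, v, w has s-component κ_s(u, v)(s -
1)w. -/
theorem isJacobiForm (φ : P →ₗ[ℂ] ℂ) (s : Γ) :
    IsJacobiForm s (κ.compr₂ (φ ∘ₗ LinearMap.proj s)) := by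
  refine ⟨fun u => ?_, fun u v w => ?_⟩
  · have h : κ u u = 0 := by
      refine F.param_grp_injective hγ ?_
      rw [hκ, sub_self]
      simp
    change φ (κ u u s) = 0
    rw [h, Pi.zero_apply, map_zero]
  · obtain ⟨D, hD⟩ := F.exists_coeff_symbol φ s
    have h1 : ∀ u v w, D ((x u * x v - x v * x u) * x w - x w * (x u * x v - x v * x u)) =
        φ (κ u v s) • SymmetricAlgebra.ι ℂ V (subOne s w) := fun u v w => by
      rw [← hD (κ u v) (fun g => γ g * x w - x w * γ g)
        (fun g => SymmetricAlgebra.ι ℂ V (subOne g w)) fun g => ?_]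
      · rw [← hκ, Finset.sum_mul, Finset.mul_sum, ← Finset.sum_sub_distrib]
        congr 1
        exact Finset.sum_congr rfl fun g _ => by rw [smul_sub, smul_mul_assoc, mul_smul_comm]
      · rw [F.grp_mul_vec hγ hx, ← sub_mul, ← map_sub, map_mul, (hx _).2, (hγ g).2,
          SkewMonoidAlgebra.single_mul_single, one_smul, one_mul, mul_one]
        rfl
    have h2 := congrArg₂ (· + ·) (congrArg₂ (· + ·) (h1 u v w) (h1 v w u)) (h1 w u v)
    refine symmetricAlgebra_ι_injective (P := V) ?_
    rw [map_add, map_add, _root_.map_smul, _root_.map_smul, _root_.map_smul, map_zero]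
    refine h2.symm.trans ?_
    rw [← map_add, ← map_add, ← map_zero D]
    congr 1
    noncomm_ring

/-- On a symplectically irreducible representation the commutators are those of a symplectic
reflection algebra. -/
theorem exists_param {Ω : LinearMap.BilinForm ℂ V} (hΩ : Ω.IsAlt) (hΩ' : Ω.Nondegenerate)
    (hΓ : Γ ≤ Sp Ω) (hirr : SymplecticallyIrreducible Ω Γ) :
    ∃ ν : Param Γ →ₗ[ℂ] P, ∀ u v s,
      SymmetricAlgebra.ι ℂ P (κ u v s) = reflForm Ω s u v • symMap ν (reflCoef s) := by
  -- The results on forms concern scalar-valued forms, so equalities in P are tested against linear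
  -- functionals.
  have hdual : ∀ {p q : P}, (∀ φ : P →ₗ[ℂ] ℂ, φ p = φ q) → p = q := fun {p q} h => by
    rw [← sub_eq_zero, ← Module.forall_dual_apply_eq_zero_iff ℂ]
    intro φ
    rw [map_sub, h, sub_self]
  have hJ := F.isJacobiForm hγ hx hκ
  -- The image of t: for each functional the identity component is an invariant alternating form,
  -- hence a multiple of Ω. Normalizing at one pair with Ω(a, b) ≠ 0 gives a vector p independent of
  -- the functional.
  obtain ⟨p, hp⟩ : ∃ p : P, ∀ u v, κ u v 1 = Ω u v • p := by
    have := hirr.1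
    obtain ⟨a, ha⟩ := exists_ne (0 : V)
    obtain ⟨b, hb⟩ : ∃ b, Ω a b ≠ 0 := by
      by_contra! h
      exact ha (hΩ'.1 a h)
    refine ⟨(Ω a b)⁻¹ • κ a b 1, fun u v => hdual fun φ => ?_⟩
    obtain ⟨c, hc⟩ := exists_eq_smul_of_invariant hΩ hΩ' hΓ hirr _ (hJ φ 1).1 fun g hg u v => by
      change φ (κ (g u) (g v) 1) = φ (κ u v 1)
      rw [← F.commutator_conj hγ hx hκ ⟨g, hg⟩ 1 u v, mul_one, mul_inv_cancel]
    have hc' : ∀ u v, φ (κ u v 1) = c * Ω u v := fun u v =>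
      LinearMap.congr_fun (LinearMap.congr_fun hc u) v
    rw [_root_.map_smul, _root_.map_smul, hc', hc', smul_eq_mul, smul_eq_mul]
    field_simp
  -- The image of c_C: computed at one representative r of the class and carried to the others by
  -- conjugation.
  have hq : ∀ C : ReflectionClass Γ, ∃ q : P, ∀ (s : Γ) (hs : IsSymplecticReflection s),
      reflectionClass ⟨s, hs⟩ = C → ∀ u v, κ u v s = Ω (proj s u) (proj s v) • q := by
    rintro ⟨_, r, hr, rfl⟩
    obtain ⟨a, b, hab⟩ := exists_form_proj_eq_one hΩ' hΓ hr
    refine ⟨κ a b r, fun s hs h u v => ?_⟩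
    obtain ⟨g, hg⟩ := isConj_iff.mp (ConjClasses.mk_eq_mk_iff_isConj.mp
      (congrArg Subtype.val h).symm : IsConj r s)
    subst hg
    have hg' : ∀ w, (g : V ≃ₗ[ℂ] V) (((g⁻¹ : Γ) : V ≃ₗ[ℂ] V) w) = w := fun w => by
      rw [← LinearEquiv.mul_apply, ← Subgroup.coe_mul, mul_inv_cancel]
      rfl
    rw [← hg' u, ← hg' v, F.commutator_conj hγ hx hκ, proj_conj, proj_conj, hΓ g.2]
    refine hdual fun φ => ?_
    rw [_root_.map_smul]
    exact (hJ φ r).eq_mul hΩ hΩ' hΓ hr hab _ _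
  choose q hq using hq
  refine ⟨Finsupp.linearCombination ℂ fun o => o.elim p q, fun u v s => ?_⟩
  have hν : ∀ o, symMap (Finsupp.linearCombination ℂ fun o : Option (ReflectionClass Γ) =>
      o.elim p q) (SymmetricAlgebra.ι ℂ _ (Finsupp.single o 1)) =
        SymmetricAlgebra.ι ℂ P (o.elim p q) := fun o => by
    rw [symMap, SymmetricAlgebra.lift_ι_apply, LinearMap.comp_apply,
      Finsupp.linearCombination_single, one_smul]
  by_cases h1 : s = 1
  · subst h1
    rw [reflForm_one, reflCoef_one, tVar, hν, hp, _root_.map_smul]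
    rfl
  by_cases hs : IsSymplecticReflection s
  · rw [reflForm_of_refl Ω hs, reflCoef_of_refl hs, cVar, hν, hq _ s hs rfl, _root_.map_smul]
    rfl
  · have h0 : κ u v s = 0 := hdual fun φ => by
      rw [map_zero]
      exact LinearMap.congr_fun (LinearMap.congr_fun ((hJ φ s).eq_zero hΩ hΩ' hΓ h1 hs) u) v
    rw [h0, map_zero, reflForm]
    simp [h1, hs]

end Commutators

end IsGradedFlatDeformation

/-! ### Base change -/

section BaseChange

theorem symMap_ι {P P' : Type*} [AddCommGroup P] [Module ℂ P] [AddCommGroup P'] [Module ℂ P']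
    (ν : P →ₗ[ℂ] P') (p : P) :
    symMap ν (SymmetricAlgebra.ι ℂ P p) = SymmetricAlgebra.ι ℂ P' (ν p) :=
  SymmetricAlgebra.lift_ι_apply _ _

namespace BaseChange

variable {P P' B A : Type*} [AddCommGroup P] [Module ℂ P] [AddCommGroup P'] [Module ℂ P']
  (ν : P →ₗ[ℂ] P') [Ring B] [Algebra (SymmetricAlgebra ℂ P) B]
  [Ring A] [Algebra (SymmetricAlgebra ℂ P') A]

theorem smul_tmul (s r : SymmetricAlgebra ℂ P') (b : B) : s • tmul ν r b = tmul ν (s * r) b :=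
  TensorProduct.smul_tmul' s (show SymVia ν from r) b

theorem tmul_smul (s : SymmetricAlgebra ℂ P') (p : SymmetricAlgebra ℂ P) (b : B) :
    tmul ν s (p • b) = tmul ν (s * symMap ν p) b := by
  change (show SymVia ν from s) ⊗ₜ[SymmetricAlgebra ℂ P] (p • b) = _
  rw [← TensorProduct.smul_tmul, Algebra.smul_def, mul_comm]
  rfl

theorem tmul_add (s : SymmetricAlgebra ℂ P') (a b : B) :
    tmul ν s (a + b) = tmul ν s a + tmul ν s b :=
  TensorProduct.tmul_add _ _ _

theorem add_tmul (s r : SymmetricAlgebra ℂ P') (b : B) :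
    tmul ν (s + r) b = tmul ν s b + tmul ν r b :=
  TensorProduct.add_tmul _ _ _

theorem tmul_mul_tmul (s r : SymmetricAlgebra ℂ P') (a b : B) :
    tmul ν s a * tmul ν r b = tmul ν (s * r) (a * b) :=
  Algebra.TensorProduct.tmul_mul_tmul _ _ _ _

theorem one_def : (1 : BaseChange ν B) = tmul ν 1 1 := rfl

variable {ν} in
theorem induction {p : BaseChange ν B → Prop} (zero : p 0) (tmul : ∀ s b, p (tmul ν s b))
    (add : ∀ x y, p x → p y → p (x + y)) (x : BaseChange ν B) : p x :=
  TensorProduct.induction_on x zero tmul add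

instance : IsScalarTower ℂ (SymmetricAlgebra ℂ P') (BaseChange ν B) where
  smul_assoc c s x := by
    induction x using BaseChange.induction with
    | zero => rw [smul_zero, smul_zero, smul_zero]
    | tmul r b =>
      rw [smul_tmul, smul_tmul, smul_mul_assoc]
      rfl
    | add x y hx hy => rw [smul_add, smul_add, smul_add, hx, hy]

/-- The map from the base change induced by a homomorphism of algebras. -/
theorem exists_lift (Θ : B →+* A)
    (h : ∀ p, Θ (algebraMap _ B p) = algebraMap (SymmetricAlgebra ℂ P') A (symMap ν p)) :
    ∃ Φ : BaseChange ν B →ₐ[SymmetricAlgebra ℂ P'] A, ∀ s b, Φ (tmul ν s b) = s • Θ b := by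
  let : Algebra (SymmetricAlgebra ℂ P) A :=
    ((algebraMap (SymmetricAlgebra ℂ P') A).comp (symMap ν).toRingHom).toAlgebra'
      fun p a => Algebra.commutes (symMap ν p) a
  let f : SymVia ν →ₐ[SymmetricAlgebra ℂ P] A :=
    { toRingHom := (algebraMap (SymmetricAlgebra ℂ P') A : SymmetricAlgebra ℂ P' →+* A)
      commutes' := fun p => rfl }
  let g : B →ₐ[SymmetricAlgebra ℂ P] A := { toRingHom := Θ, commutes' := h }
  let Φ : BaseChange ν B →ₐ[SymmetricAlgebra ℂ P] A :=
    Algebra.TensorProduct.lift f g fun s b => Algebra.commutes (A := A) (show SymmetricAlgebra ℂ P' from s) _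
  have hΦ : ∀ s b, Φ (tmul ν s b) = s • Θ b := fun s b => by
    rw [Algebra.smul_def]
    exact Algebra.TensorProduct.lift_tmul _ _ _ _ _
  refine ⟨{ toRingHom := Φ.toRingHom, commutes' := fun s => ?_ }, hΦ⟩
  refine (hΦ s 1).trans ?_
  rw [map_one, Algebra.smul_def, mul_one]

theorem exists_sum_of_span {κ : Type*} {y : κ → B}
    (hy : Submodule.span (SymmetricAlgebra ℂ P) (Set.range y) = ⊤) (x : BaseChange ν B) :
    ∃ c : κ →₀ SymmetricAlgebra ℂ P', x = c.sum fun i r => r • tmul ν 1 (y i) := by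
  refine exists_basis_repr ?_ x
  rw [eq_top_iff]
  rintro x -
  induction x using BaseChange.induction with
  | zero => exact zero_mem _
  | add x y hx hy => exact add_mem hx hy
  | tmul s b =>
    have hb : b ∈ Submodule.span (SymmetricAlgebra ℂ P) (Set.range y) := hy ▸ Submodule.mem_top
    induction hb using Submodule.span_induction generalizing s with
    | mem b hb =>
      obtain ⟨i, rfl⟩ := hb
      rw [← mul_one s, ← smul_tmul]
      exact Submodule.smul_mem _ _ (Submodule.subset_span ⟨i, rfl⟩)
    | zero =>
      have : tmul ν s (0 : B) = 0 := TensorProduct.tmul_zero _ _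
      rw [this]
      exact zero_mem _
    | add a b _ _ ha hb =>
      rw [tmul_add]
      exact add_mem (ha s) (hb s)
    | smul p b _ hb =>
      rw [tmul_smul]
      exact hb _

end BaseChange

theorem symMap_mem_symPow {P P' : Type*} [AddCommGroup P] [Module ℂ P] [AddCommGroup P'] [Module ℂ P']
    (ν : P →ₗ[ℂ] P') {j : ℕ} {p : SymmetricAlgebra ℂ P} (hp : p ∈ symPow P j) :
    symMap ν p ∈ symPow P' j := by
  have : (symPow P j).map (symMap ν).toLinearMap ≤ symPow P' j := by
    rw [symPow, symPow, Submodule.map_pow]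
    refine pow_le_pow_left' ?_ j
    rintro _ ⟨_, ⟨p, rfl⟩, rfl⟩
    exact ⟨ν p, (symMap_ι ν p).symm⟩
  exact this (Submodule.mem_map_of_mem hp)

theorem iSup_symPow {P : Type*} [AddCommGroup P] [Module ℂ P] : ⨆ j, symPow P j = ⊤ := by
  rw [eq_top_iff]
  rintro p -
  induction p using SymmetricAlgebra.induction with
  | algebraMap r =>
    rw [Algebra.algebraMap_eq_smul_one]
    exact Submodule.smul_mem _ _ (Submodule.mem_iSup_of_mem 0 one_mem_symPow)
  | ι p => exact Submodule.mem_iSup_of_mem 1 (ι_mem_symPow p)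
  | add a b ha hb => exact add_mem ha hb
  | mul a b ha hb =>
    induction ha using Submodule.iSup_induction' with
    | mem i a ha =>
      induction hb using Submodule.iSup_induction' with
      | mem j b hb =>
        refine Submodule.mem_iSup_of_mem (i + j) ?_
        rw [symPow, pow_add]
        exact Submodule.mul_mem_mul ha hb
      | zero => rw [mul_zero]; exact zero_mem _
      | add x y _ _ hx hy => rw [mul_add]; exact add_mem hx hy
    | zero => rw [zero_mul]; exact zero_mem _
    | add x y _ _ hx hy => rw [add_mul]; exact add_mem hx hy

/-- Independence of the graded pieces of the base change is not required; it follows from the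
comparison with a graded algebra. -/
theorem BaseChange.iSup_grading {P P' B : Type*} [AddCommGroup P] [Module ℂ P] [AddCommGroup P']
    [Module ℂ P'] (ν : P →ₗ[ℂ] P') [Ring B] [Algebra ℂ B] [Algebra (SymmetricAlgebra ℂ P) B]
    (ℬ : ℤ → Submodule ℂ B) (h : ⨆ n, ℬ n = ⊤) : ⨆ n, BaseChange.grading ν ℬ n = ⊤ := by
  rw [eq_top_iff]
  rintro x -
  induction x using BaseChange.induction with
  | zero => exact zero_mem _
  | add x y hx hy => exact add_mem hx hy
  | tmul s b =>
    have hs : s ∈ ⨆ j, symPow P' j := iSup_symPow (P := P') ▸ Submodule.mem_top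
    have hb : b ∈ ⨆ n, ℬ n := h ▸ Submodule.mem_top
    induction hs using Submodule.iSup_induction' with
    | mem j s hs =>
      induction hb using Submodule.iSup_induction' with
      | mem m b hb =>
        exact Submodule.mem_iSup_of_mem (2 * j + m)
          (Submodule.subset_span ⟨j, m, s, b, hs, hb, rfl, rfl⟩)
      | zero =>
        have : BaseChange.tmul ν s (0 : B) = 0 := TensorProduct.tmul_zero _ _
        rw [this]
        exact zero_mem _
      | add x y _ _ hx hy => rw [BaseChange.tmul_add]; exact add_mem hx hy
    | zero =>
      have : BaseChange.tmul ν 0 b = 0 := TensorProduct.zero_tmul _ _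
      rw [this]
      exact zero_mem _
    | add x y _ _ hx hy => rw [BaseChange.add_tmul]; exact add_mem hx hy

end BaseChange

/-! ### Degrees in graded flat deformations -/

namespace IsGradedFlatDeformation

variable {V : Type*} [AddCommGroup V] [Module ℂ V] {Γ : Subgroup (V ≃ₗ[ℂ] V)}
  {P A : Type*} [AddCommGroup P] [Module ℂ P] [Ring A]
  [Algebra ℂ A] [Algebra (SymmetricAlgebra ℂ P) A] [IsScalarTower ℂ (SymmetricAlgebra ℂ P) A]
  {𝒜 : ℤ → Submodule ℂ A} {π : A →ₐ[ℂ] SymSmash Γ} (F : IsGradedFlatDeformation Γ (P := P) 𝒜 π)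

include F

theorem smul_mem {j : ℕ} {s : SymmetricAlgebra ℂ P} (hs : s ∈ symPow P j) {n : ℤ} {x : A}
    (hx : x ∈ 𝒜 n) : s • x ∈ 𝒜 (2 * j + n) := by
  have key : ∀ (n : ℤ) (x : A), x ∈ 𝒜 n → s • x ∈ 𝒜 (2 * j + n) := by
    refine Submodule.pow_induction_on_left' (M := LinearMap.range (SymmetricAlgebra.ι ℂ P))
      (C := fun j s _ => ∀ (n : ℤ) (x : A), x ∈ 𝒜 n → s • x ∈ 𝒜 (2 * j + n)) ?_ ?_ ?_ hs
    · intro r n x hx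
      rw [algebraMap_smul, Nat.cast_zero, mul_zero, zero_add]
      exact Submodule.smul_mem _ _ hx
    · intro s r i _ _ hs hr n x hx
      rw [add_smul]
      exact add_mem (hs n x hx) (hr n x hx)
    · rintro _ ⟨p, rfl⟩ i s _ hs n x hx
      rw [mul_smul]
      have := F.param_smul_mem p (hs n x hx)
      convert this using 2
      push_cast
      ring
  exact key n x hx

theorem lift_mem {x : V →ₗ[ℂ] A} (hx : ∀ v, x v ∈ 𝒜 1) {k : ℕ} {a : TensorAlgebra ℂ V}
    (ha : a ∈ tensorPow V k) : TensorAlgebra.lift ℂ x a ∈ 𝒜 k := by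
  refine Submodule.pow_induction_on_left' (M := LinearMap.range (TensorAlgebra.ι ℂ (M := V)))
    (C := fun k a _ => TensorAlgebra.lift ℂ x a ∈ 𝒜 k) ?_ ?_ ?_ ha
  · intro r
    rw [AlgHom.commutes, Algebra.algebraMap_eq_smul_one]
    exact Submodule.smul_mem _ _ F.one_mem
  · intro a b i _ _ ha hb
    rw [map_add]
    exact add_mem ha hb
  · rintro _ ⟨v, rfl⟩ i a _ ha
    rw [map_mul, TensorAlgebra.lift_ι_apply, Nat.cast_succ, add_comm]
    exact F.mul_mem (hx v) ha

end IsGradedFlatDeformation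

/-! ### Universality -/

namespace IsGradedFlatDeformation

variable {V : Type*} [AddCommGroup V] [Module ℂ V] [FiniteDimensional ℂ V]
  {Ω : LinearMap.BilinForm ℂ V} {Γ : Subgroup (V ≃ₗ[ℂ] V)} [Fintype Γ]
  {P A : Type*} [AddCommGroup P] [Module ℂ P] [Ring A]
  [Algebra ℂ A] [Algebra (SymmetricAlgebra ℂ P) A] [IsScalarTower ℂ (SymmetricAlgebra ℂ P) A]
  {𝒜 : ℤ → Submodule ℂ A} {π : A →ₐ[ℂ] SymSmash Γ} (F : IsGradedFlatDeformation Γ (P := P) 𝒜 π)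
  {γ : Γ →* A} (hγ : ∀ g, γ g ∈ 𝒜 0 ∧ π (γ g) = SkewMonoidAlgebra.single g 1)
  {x : V →ₗ[ℂ] A} (hx : ∀ v, x v ∈ 𝒜 1 ∧
    π (x v) = SkewMonoidAlgebra.single 1 (SymmetricAlgebra.ι ℂ V v))
  {ν : Param Γ →ₗ[ℂ] P}

include F hγ hx

/-- The homomorphism from the symplectic reflection algebra determined by the commutators. -/
theorem exists_algHom (hν : ∀ u v, x u * x v - x v * x u =
      ∑ s, reflForm Ω s u v • (symMap ν (reflCoef s) • γ s)) :
    ∃ Θ : SRA Ω Γ →ₐ[ℂ] A,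
      (∀ p, Θ (algebraMap _ _ p) = algebraMap (SymmetricAlgebra ℂ P) A (symMap ν p)) ∧
      (∀ v, Θ (sraVec Ω Γ v) = x v) ∧ ∀ g, Θ (sraGrp Ω g) = γ g := by
  have hrel : ∀ u v, x u * x v - x v * x u =
      Ω u v • ((IsScalarTower.toAlgHom ℂ (SymmetricAlgebra ℂ P) A).comp (symMap ν)) (tVar Γ) +
      ∑ᶠ s : {s : Γ // IsSymplecticReflection s}, Ω (proj s.1 u) (proj s.1 v) •
        (((IsScalarTower.toAlgHom ℂ (SymmetricAlgebra ℂ P) A).comp (symMap ν))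
          (cVar (reflectionClass s)) * γ s.1) := fun u v => by
    rw [hν, sum_refl Ω (fun s c => symMap ν c • γ s) (fun s => by rw [map_zero, zero_smul])]
    simp only [Algebra.smul_def (A := A) (R := SymmetricAlgebra ℂ P), map_one, mul_one]
    rfl
  exact ⟨sraLift ((IsScalarTower.toAlgHom ℂ (SymmetricAlgebra ℂ P) A).comp (symMap ν))
    (fun p a => Algebra.commutes (symMap ν p) a) x γ (F.grp_mul_vec hγ hx) hrel,
    fun p => sraLift_param _ _ _ _ _ _ p, fun v => sraLift_vec _ _ _ _ _ _ v,
    fun g => sraLift_grp _ _ _ _ _ _ g⟩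

/-! ### The comparison homomorphism is a graded isomorphism after base change. -/

section AlgHom

variable {Θ : SRA Ω Γ →ₐ[ℂ] A}
  (hp : ∀ p, Θ (algebraMap _ _ p) = algebraMap (SymmetricAlgebra ℂ P) A (symMap ν p))
  (hv : ∀ v, Θ (sraVec Ω Γ v) = x v) (hg : ∀ g, Θ (sraGrp Ω g) = γ g)

include hp hv hg

theorem map_algHom (h : SRA Ω Γ) : π (Θ h) = sraToSmash Ω Γ h := by
  induction h using SRA.induction with
  | param r =>
    rw [hp, Algebra.algebraMap_eq_smul_one, Algebra.algebraMap_eq_smul_one, F.map_smul,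
      sraToSmash_smul, map_one, map_one]
    congr 1
    induction r using SymmetricAlgebra.induction with
    | algebraMap r => rw [AlgHom.commutes, AlgHom.commutes, AlgHom.commutes]
    | ι p => rw [symMap_ι, SymmetricAlgebra.algebraMapInv_ι, SymmetricAlgebra.algebraMapInv_ι]
    | mul a b ha hb => rw [map_mul, map_mul, map_mul, ha, hb]
    | add a b ha hb => rw [map_add, map_add, map_add, ha, hb]
  | vec v => rw [hv, (hx v).2, sraToSmash_vec]
  | grp g => rw [hg, (hγ g).2, sraToSmash_grp]
  | mul a b ha hb => rw [map_mul, map_mul, map_mul, ha, hb]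
  | add a b ha hb => rw [map_add, map_add, map_add, ha, hb]

theorem algHom_mem {n : ℤ} {h : SRA Ω Γ} (hh : h ∈ sraGrading Ω Γ n) : Θ h ∈ 𝒜 n := by
  have hle : sraGrading Ω Γ n ≤ (𝒜 n).comap Θ.toLinearMap := by
    refine Submodule.span_le.mpr ?_
    rintro _ ⟨j, k, p, a, g, hpj, ha, rfl, rfl⟩
    change Θ _ ∈ 𝒜 _
    have hlift : Θ (TensorAlgebra.lift ℂ (sraVec Ω Γ) a) = TensorAlgebra.lift ℂ x a := by
      have : Θ.comp (TensorAlgebra.lift ℂ (sraVec Ω Γ)) = TensorAlgebra.lift ℂ x :=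
        TensorAlgebra.hom_ext (LinearMap.ext fun v => by simp [hv])
      exact AlgHom.congr_fun this a
    rw [mkSRA_single, Algebra.smul_def, map_mul, hp, map_mul, hlift, hg, ← Algebra.smul_def]
    refine F.smul_mem (symMap_mem_symPow ν hpj) ?_
    simpa using F.mul_mem (F.lift_mem (fun v => (hx v).1) ha) (hγ g).1
  exact hle hh

/-- The base change of the symplectic reflection algebra is isomorphic to the deformation. -/
theorem exists_algEquiv (hΩ : Ω.IsAlt) (hΓ : Γ ≤ Sp Ω) :
    ∃ E : BaseChange ν (SRA Ω Γ) ≃ₐ[SymmetricAlgebra ℂ P] A,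
      (∀ s h, E (BaseChange.tmul ν s h) = s • Θ h) ∧
      ∀ n y, y ∈ BaseChange.grading ν (sraGrading Ω Γ) n ↔ E y ∈ 𝒜 n := by
  obtain ⟨Φ, hΦ⟩ := BaseChange.exists_lift (A := A) ν (Θ : SRA Ω Γ →+* A) hp
  have hπ := F.map_algHom hγ hx hp hv hg
  have hmem : ∀ n, ∀ y ∈ BaseChange.grading ν (sraGrading Ω Γ) n, Φ y ∈ 𝒜 n := by
    intro n y hy
    have hle : BaseChange.grading ν (sraGrading Ω Γ) n ≤
        (𝒜 n).comap (Φ.toLinearMap.restrictScalars ℂ) := by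
      refine Submodule.span_le.mpr ?_
      rintro _ ⟨j, m, s, a, hs, ha, rfl, rfl⟩
      change Φ _ ∈ 𝒜 _
      rw [hΦ]
      exact F.smul_mem hs (F.algHom_mem hγ hx hp hv hg ha)
    exact hle hy
  -- An element of the base change is a combination of ordered monomials, whose images in A reduce
  -- to independent elements of S(V)#Γ and are therefore independent over S(P).
  have hinj : Function.Injective Φ := by
    refine (injective_iff_map_eq_zero Φ).mpr fun y hy => ?_
    let b := Module.finBasis ℂ V
    obtain ⟨c, rfl⟩ := BaseChange.exists_sum_of_span ν (span_sraMono (Ω := Ω) (Γ := Γ) (b := b)) y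
    have hind : LinearIndependent (SymmetricAlgebra ℂ P) fun i => Θ (sraMono Ω Γ b i) := by
      refine F.linearIndependent_of_map ?_
      simp only [hπ]
      exact linearIndependent_sraToSmash_mono b
    have hc : c = 0 := by
      refine linearIndependent_iff.mp hind c ?_
      rw [Finsupp.linearCombination_apply, ← hy, Finsupp.sum, Finsupp.sum, map_sum]
      refine Finset.sum_congr rfl fun i _ => ?_
      rw [_root_.map_smul, hΦ, one_smul]
      rfl
    rw [hc, Finsupp.sum_zero_index]
  -- Graded Nakayama: every homogeneous element of S(V)#Γ lifts to H in the same degree, and its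
  -- image in A is the required lift.
  have hsurj : Function.Surjective Φ := by
    have := F.eq_top_of_forall_exists (LinearMap.range Φ.toLinearMap) fun n y hy => by
      obtain ⟨h, hh, rfl⟩ := (sra_isGradedFlatDeformation hΩ hΓ).exists_lift hy
      refine ⟨Θ h, ⟨BaseChange.tmul ν 1 h, ?_⟩, F.algHom_mem hγ hx hp hv hg hh, hπ h⟩
      exact (hΦ 1 h).trans (one_smul _ _)
    exact LinearMap.range_eq_top.mp this
  refine ⟨AlgEquiv.ofBijective Φ ⟨hinj, hsurj⟩, hΦ, fun n y => ⟨hmem n y, fun hy => ?_⟩⟩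
  -- The images of the graded pieces lie in the pieces of A and together fill A. By independence
  -- each fills its own, so degrees are reflected as well as preserved.
  let L : BaseChange ν (SRA Ω Γ) →ₗ[ℂ] A := Φ.toLinearMap.restrictScalars ℂ
  have hy' : L y ∈ ⨆ n, (BaseChange.grading ν (sraGrading Ω Γ) n).map L := by
    rw [← Submodule.map_iSup, BaseChange.iSup_grading ν _ iSup_sraGrading]
    exact ⟨y, trivial, rfl⟩
  obtain ⟨z, hz, hzy⟩ := mem_of_mem_iSup (ℳ := fun n =>
    (BaseChange.grading ν (sraGrading Ω Γ) n).map L) F.iSupIndep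
    (fun n => by rintro _ ⟨z, hz, rfl⟩; exact hmem n z hz) (n := n) hy hy'
  rwa [← hinj hzy]

end AlgHom

/-- Graded isomorphisms inducing the identity are the identity on `V` and `Γ`. -/
theorem algEquiv_apply {E : BaseChange ν (SRA Ω Γ) ≃ₐ[SymmetricAlgebra ℂ P] A}
    (hE : ∀ n y, y ∈ BaseChange.grading ν (sraGrading Ω Γ) n ↔ E y ∈ 𝒜 n)
    (hE' : ∀ s h, π (E (BaseChange.tmul ν s h)) =
      (SymmetricAlgebra.algebraMapInv s : ℂ) • sraToSmash Ω Γ h) :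
    (∀ v, E (BaseChange.tmul ν 1 (sraVec Ω Γ v)) = x v) ∧
      ∀ g, E (BaseChange.tmul ν 1 (sraGrp Ω g)) = γ g := by
  have hmem : ∀ (n : ℤ) (h : SRA Ω Γ), h ∈ sraGrading Ω Γ n → E (BaseChange.tmul ν 1 h) ∈ 𝒜 n :=
    fun n h hh => (hE n _).mp (Submodule.subset_span ⟨0, n, 1, h, one_mem_symPow, hh, by simp, rfl⟩)
  refine ⟨fun v => F.eq_of_map_eq (n := 1) (by norm_num) (hmem 1 _ (sraVec_mem v)) (hx v).1 ?_,
    fun g => F.eq_of_map_eq (n := 0) (by norm_num) (hmem 0 _ (sraGrp_mem g)) (hγ g).1 ?_⟩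
  · rw [hE', (hx v).2, sraToSmash_vec, map_one, one_smul]
  · rw [hE', (hγ g).2, sraToSmash_grp, map_one, one_smul]

omit hx in
-- Comparing coefficients along Γ, the parameter t is recovered from s = 1 and a pair with Ω(a, b) ≠
-- 0, and each c_C from a reflection in its class and vectors whose projections pair to 1. If V were
-- zero, t would not appear in the relations.
theorem param_unique (hΩ' : Ω.Nondegenerate) (hΓ : Γ ≤ Sp Ω) [Nontrivial V]
    {ν ν' : Param Γ →ₗ[ℂ] P} (h : ∀ u v, ∑ s, reflForm Ω s u v • (symMap ν (reflCoef s) • γ s) =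
      ∑ s, reflForm Ω s u v • (symMap ν' (reflCoef s) • γ s)) : ν = ν' := by
  have hr : ∀ s : Γ, ∃ r : Param Γ, reflCoef s = SymmetricAlgebra.ι ℂ _ r := fun s => by
    unfold reflCoef
    split_ifs
    · exact ⟨_, rfl⟩
    · exact ⟨_, rfl⟩
    · exact ⟨0, (map_zero _).symm⟩
  choose r hr using hr
  have key : ∀ u v s, reflForm Ω s u v • ν (r s) = reflForm Ω s u v • ν' (r s) := fun u v s => by
    refine congrFun (F.param_grp_injective hγ (p := fun s => reflForm Ω s u v • ν (r s))
      (q := fun s => reflForm Ω s u v • ν' (r s)) ?_) s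
    simpa only [_root_.map_smul, smul_assoc, hr, symMap_ι] using h u v
  have key' : ∀ u v s, reflForm Ω s u v ≠ 0 → ν (r s) = ν' (r s) := fun u v s hne =>
    smul_right_injective P hne (key u v s)
  refine Finsupp.lhom_ext' fun o => LinearMap.ext_ring ?_
  change ν (Finsupp.single o 1) = ν' (Finsupp.single o 1)
  cases o with
  | none =>
    obtain ⟨a, ha⟩ := exists_ne (0 : V)
    obtain ⟨b, hb⟩ : ∃ b, Ω a b ≠ 0 := by
      by_contra! h
      exact ha (hΩ'.1 a h)
    have h1 := key' a b 1 (by rwa [reflForm_one])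
    rwa [← symmetricAlgebra_ι_injective ((hr 1).symm.trans reflCoef_one)]
  | some C =>
    obtain ⟨_, s, hs, rfl⟩ := C
    obtain ⟨a, b, hab⟩ := exists_form_proj_eq_one hΩ' hΓ hs
    have h1 := key' a b s (by rw [reflForm_of_refl Ω hs, hab]; exact one_ne_zero)
    rw [symmetricAlgebra_ι_injective ((hr s).symm.trans (reflCoef_of_refl hs))] at h1
    exact h1

end IsGradedFlatDeformation

/-- Homomorphisms from a base change of the symplectic reflection algebra are determined by the
images of `V` and `Γ`. -/
theorem baseChange_algEquiv_ext {V : Type*} [AddCommGroup V] [Module ℂ V] [FiniteDimensional ℂ V]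
    {Ω : LinearMap.BilinForm ℂ V} {Γ : Subgroup (V ≃ₗ[ℂ] V)} [Finite Γ]
    {P A : Type*} [AddCommGroup P] [Module ℂ P] [Ring A] [Algebra (SymmetricAlgebra ℂ P) A]
    {ν : Param Γ →ₗ[ℂ] P} {E E' : BaseChange ν (SRA Ω Γ) ≃ₐ[SymmetricAlgebra ℂ P] A}
    (hv : ∀ v, E (BaseChange.tmul ν 1 (sraVec Ω Γ v)) = E' (BaseChange.tmul ν 1 (sraVec Ω Γ v)))
    (hg : ∀ g, E (BaseChange.tmul ν 1 (sraGrp Ω g)) = E' (BaseChange.tmul ν 1 (sraGrp Ω g))) :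
    E = E' := by
  have key : ∀ h : SRA Ω Γ, E (BaseChange.tmul ν 1 h) = E' (BaseChange.tmul ν 1 h) := fun h => by
    induction h using SRA.induction with
    | param r =>
      have h1 : BaseChange.tmul ν 1 (algebraMap _ (SRA Ω Γ) r) =
          algebraMap (SymmetricAlgebra ℂ P) (BaseChange ν (SRA Ω Γ)) (symMap ν r) := by
        rw [Algebra.algebraMap_eq_smul_one, Algebra.algebraMap_eq_smul_one, BaseChange.tmul_smul,
          BaseChange.one_def, BaseChange.smul_tmul, one_mul, mul_one]
      rw [h1, AlgEquiv.commutes, AlgEquiv.commutes]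
    | vec v => exact hv v
    | grp g => exact hg g
    | mul a b ha hb =>
      rw [← one_mul (1 : SymmetricAlgebra ℂ P), ← BaseChange.tmul_mul_tmul, map_mul, map_mul, ha, hb]
    | add a b ha hb => rw [BaseChange.tmul_add, map_add, map_add, ha, hb]
  refine AlgEquiv.ext fun y => ?_
  induction y using BaseChange.induction with
  | zero => rw [map_zero, map_zero]
  | tmul s h => rw [← mul_one s, ← BaseChange.smul_tmul, map_smul, map_smul, key]
  | add y z hy hz => rw [map_add, map_add, hy, hz]

/-- The commutation relations in a base change of the symplectic reflection algebra. -/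
theorem baseChange_comm {V : Type*} [AddCommGroup V] [Module ℂ V] [FiniteDimensional ℂ V]
    {Ω : LinearMap.BilinForm ℂ V} {Γ : Subgroup (V ≃ₗ[ℂ] V)} [Fintype Γ]
    {P A : Type*} [AddCommGroup P] [Module ℂ P] [Ring A] [Algebra ℂ A]
    [Algebra (SymmetricAlgebra ℂ P) A] [IsScalarTower ℂ (SymmetricAlgebra ℂ P) A]
    {ν : Param Γ →ₗ[ℂ] P} (E : BaseChange ν (SRA Ω Γ) ≃ₐ[SymmetricAlgebra ℂ P] A) (u v : V) :
    E (BaseChange.tmul ν 1 (sraVec Ω Γ u)) * E (BaseChange.tmul ν 1 (sraVec Ω Γ v)) -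
      E (BaseChange.tmul ν 1 (sraVec Ω Γ v)) * E (BaseChange.tmul ν 1 (sraVec Ω Γ u)) =
    ∑ s, reflForm Ω s u v • (symMap ν (reflCoef s) • E (BaseChange.tmul ν 1 (sraGrp Ω s))) := by
  let ψ : SRA Ω Γ →+ A := AddMonoidHom.mk' (fun h => E (BaseChange.tmul ν 1 h)) fun a b => by
    rw [BaseChange.tmul_add, map_add]
  have hψ : ∀ a b, ψ (a * b) = ψ a * ψ b := fun a b => by
    change E _ = E _ * E _
    rw [← map_mul, BaseChange.tmul_mul_tmul, one_mul]
  have hs : ∀ (p : SymmetricAlgebra ℂ (Param Γ)) (h : SRA Ω Γ), ψ (p • h) = symMap ν p • ψ h :=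
    fun p h => by
      change E _ = _ • E _
      rw [BaseChange.tmul_smul, one_mul, ← map_smul, BaseChange.smul_tmul, mul_one]
  change ψ _ * ψ _ - ψ _ * ψ _ = ∑ s, reflForm Ω s u v • (symMap ν (reflCoef s) • ψ _)
  rw [← hψ, ← hψ, sraVec_comm', map_add, add_sub_cancel_left, map_sum]
  refine Finset.sum_congr rfl fun s _ => ?_
  rw [← smul_assoc, hs, map_smul, smul_assoc]

end SympRefl

end

/-! ### Flatness and universality. -/

theorem mainTheorem6 {V : Type*} [AddCommGroup V] [Module ℂ V] [FiniteDimensional ℂ V]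
    (Ω : LinearMap.BilinForm ℂ V) (hΩ : Ω.IsAlt) (hΩ' : Ω.Nondegenerate)
    (Γ : Subgroup (V ≃ₗ[ℂ] V)) [Finite Γ] (hΓ : Γ ≤ SympRefl.Sp Ω) :
    SympRefl.IsGradedFlatDeformation Γ (P := SympRefl.Param Γ) (A := SympRefl.SRA Ω Γ)
      (SympRefl.sraGrading Ω Γ) (SympRefl.sraToSmash Ω Γ) ∧
    (SympRefl.SymplecticallyIrreducible Ω Γ →
      ∀ (P' H' : Type*) [AddCommGroup P'] [Module ℂ P'] [Ring H'] [Algebra ℂ H']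
        [Algebra (SymmetricAlgebra ℂ P') H'] [IsScalarTower ℂ (SymmetricAlgebra ℂ P') H']
        (ℋ : ℤ → Submodule ℂ H') (π : H' →ₐ[ℂ] SympRefl.SymSmash Γ),
        SympRefl.IsGradedFlatDeformation Γ (P := P') ℋ π →
        ∃! e : (ν : SympRefl.Param Γ →ₗ[ℂ] P') ×
            (SympRefl.BaseChange ν (SympRefl.SRA Ω Γ) ≃ₐ[SymmetricAlgebra ℂ P'] H'),
          (∀ n x, x ∈ SympRefl.BaseChange.grading e.1 (SympRefl.sraGrading Ω Γ) n ↔ e.2 x ∈ ℋ n) ∧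
          ∀ (s : SymmetricAlgebra ℂ P') (h : SympRefl.SRA Ω Γ),
            π (e.2 (SympRefl.BaseChange.tmul e.1 s h)) =
              (SymmetricAlgebra.algebraMapInv s : ℂ) • SympRefl.sraToSmash Ω Γ h) := by
  refine ⟨SympRefl.sra_isGradedFlatDeformation hΩ hΓ, fun hirr P' H' => ?_⟩
  intro _ _ _ _ _ _ ℋ π F
  have hΓfin := Fintype.ofFinite Γ
  have hV := hirr.1
  obtain ⟨γ, hγ⟩ := F.exists_grp
  obtain ⟨x, hx⟩ := F.exists_vec
  obtain ⟨κ, hκ⟩ := F.exists_commutator hγ hx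
  obtain ⟨ν, hν⟩ := F.exists_param hγ hx hκ hΩ hΩ' hΓ hirr
  have hcomm : ∀ u v, x u * x v - x v * x u = ∑ s, SympRefl.reflForm Ω s u v •
      (SympRefl.symMap ν (SympRefl.reflCoef s) • γ s) := fun u v => by
    rw [← hκ]
    exact Finset.sum_congr rfl fun s _ => by rw [hν, smul_assoc]
  obtain ⟨Θ, hp, hv, hg⟩ := F.exists_algHom hγ hx hcomm
  obtain ⟨E, hE, hEgr⟩ := F.exists_algEquiv hγ hx hp hv hg hΩ hΓ
  refine ⟨⟨ν, E⟩, ⟨hEgr, fun s h => ?_⟩, ?_⟩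
  · rw [hE, F.map_smul, F.map_algHom hγ hx hp hv hg]
  · rintro ⟨ν', E'⟩ ⟨hgr, hπ⟩
    obtain ⟨hv', hg'⟩ := F.algEquiv_apply hγ hx hgr hπ
    -- The two isomorphisms agree on V and Γ, where the lifts are unique, so ν and ν' describe the
    -- same commutators in H'.
    have hνν : ν' = ν := by
      refine F.param_unique hγ hΩ' hΓ fun u v => ?_
      rw [← hcomm, ← hv' u, ← hv' v, SympRefl.baseChange_comm E' u v]
      simp only [hg']
    subst hνν
    have hEE : E' = E := SympRefl.baseChange_algEquiv_ext
      (fun v => by rw [hv', hE, hv, one_smul]) fun g => by rw [hg', hE, hg, one_smul]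
    rw [hEE]
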